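/- Let $N\ge 1$, let $B_N$ be the open unit ball of $\mathbb{C}^N$ with its inner product $\langle\cdot,\cdot\rangle$, let $\sigma$ be normalized surface measure on $\partial B_N$ and $\nu$ normalized volume measure on $B_N$. The Hardy space $H^2(B_N)$ consists of the holomorphic $f$ on $B_N$ with $\|f\|^2=\sup_{0<r<1}\int_{\partial B_N}|f(r\xi)|^2\,d\sigma(\xi)<\infty$; for $s>-1$ the weighted Bergman space $A^2_s(B_N)$ consists of the holomorphic $f$ on $B_N$ with $\|f\|^2=\int_{B_N}|f|^2 w_s\,d\nu<\infty$, where $w_s(z)=\frac{\Gamma(N+s+1)}{\Gamma(N+1)\Gamma(s+1)}(1-|z|^2)^s$. For an analytic map $\varphi:B_N\to B_N$ write $C_\varphi f=f\circ\varphi$, and for a bounded operator $T$ write $\|T\|_e=\inf\{\|T-K\|: K\text{ compact}\}$. For $\zeta\in\partial B_N$ put $$d_\varphi(\zeta)=\liminf_{z\to\zeta,\ z\in B_N}\frac{1-|\varphi(z)|}{1-|z|}\in[0,\infty].$$ A restricted $\zeta$-curve is a curve $\Gamma:[0,1)\to B_N$ with $\Gamma(t)\to\zeta$ as $t\to1$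 such that, with $\gamma(t)=\langle\Gamma(t),\zeta\rangle\zeta$, one has $\frac{|\Gamma(t)-\gamma(t)|^2}{1-|\gamma(t)|^2}\to0$ as $t\to1$ and $\frac{|\gamma(t)-\zeta|}{1-|\gamma(t)|}$ is bounded on $[0,1)$. The map $\varphi$ has finite angular derivative at $\zeta$ if there are $\eta\in\partial B_N$ and $L\in\mathbb{C}$ such that $\frac{\langle\eta-\varphi(z),\eta\rangle}{\langle\zeta-z,\zeta\rangle}$ tends to $L$ along every restricted $\zeta$-curve. **Theorem 2.1.** Let $\varphi,\psi$ be analytic self-maps of $B_N$, let $\zeta\in\partial B_N$, and suppose that $\varphi$ has finite angular derivative at $\zeta$. Let $\mathcal{H}$ be $H^2(B_N)$, with $\beta=N$, or $A^2_s(B_N)$ for some $s>-1$, with $\beta=N+s+1$, and suppose that $C_\varphi$ and $C_\psi$ are bounded operators on $\mathcal{H}$. Then, unless the radial limits $\lim_{r\to1^-}\varphi(r\zeta)$ and $\lim_{r\to1^-}\psi(r\zeta)$ both exist and are equal and $d_\psi(\zeta)=d_\varphi(\zeta)$, the operators on $\mathcal{H}$ satisfy $$\|C_\varphi-C_\psi\|_e^2\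 \ge\ d_\varphi(\zeta)^{-\beta}.$$ -/

import Mathlib

open MeasureTheory Metric Set Filter Topology
open scoped ENNReal NNReal

noncomputable section

namespace BallCompOp

/-! ### Holomorphic functions on the unit ball -/

/-- `ℂ^N` with its Euclidean norm; Mathlib's inner product is conjugate linear in the first slot, so
`⟨z, w⟩` of the several-variables literature is `inner ℂ w z`. -/
abbrev Cn (N : ℕ) := EuclideanSpace ℂ (Fin N)

/-- The open unit ball `B_N`. -/
abbrev unitBall (N : ℕ) : Set (Cn N) := ball (0 : Cn N) 1

/-- A holomorphic function on `B_N`, represented by its extension by zero to `ℂ^N`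
(so that functions on the ball correspond to their representatives one to one). -/
def IsHolo {N : ℕ} (f : Cn N → ℂ) : Prop :=
  DifferentiableOn ℂ f (unitBall N) ∧ ∀ z ∉ unitBall N, f z = 0

theorem IsHolo.zero {N : ℕ} : IsHolo (0 : Cn N → ℂ) :=
  ⟨differentiableOn_const 0, fun _ _ => rfl⟩

theorem IsHolo.add {N : ℕ} {f g : Cn N → ℂ} (hf : IsHolo f) (hg : IsHolo g) : IsHolo (f + g) :=
  ⟨hf.1.add hg.1, fun z hz => by simp [hf.2 z hz, hg.2 z hz]⟩

theorem IsHolo.smul {N : ℕ} {f : Cn N → ℂ} (c : ℂ) (hf : IsHolo f) : IsHolo (c • f) :=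
  ⟨hf.1.const_smul c, fun z hz => by simp [hf.2 z hz]⟩

/-- An extended norm on the space of holomorphic functions on `B_N`. It is used below only for the
two explicit norms `hardyNorm` and `bergmanNorm`. -/
structure HoloENorm (N : ℕ) where
  toFun : (Cn N → ℂ) → ℝ≥0∞
  add_le : ∀ f g, IsHolo f → IsHolo g → toFun (f + g) ≤ toFun f + toFun g
  smul : ∀ (c : ℂ) f, toFun (c • f) = ‖c‖ₑ * toFun f
  eq_zero : ∀ f, IsHolo f → toFun f = 0 → f = 0

theorem HoloENorm.map_zero {N : ℕ} (p : HoloENorm N) : p.toFun 0 = 0 := by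
  simpa using p.smul 0 0

/-- The holomorphic functions on `B_N` for which the extended norm `p` is finite. -/
def holoSubmodule {N : ℕ} (p : HoloENorm N) : Submodule ℂ (Cn N → ℂ) where
  carrier := {f | IsHolo f ∧ p.toFun f < ∞}
  zero_mem' := ⟨IsHolo.zero, by simp [p.map_zero]⟩
  add_mem' := fun {f g} hf hg =>
    ⟨hf.1.add hg.1, (p.add_le f g hf.1 hg.1).trans_lt (ENNReal.add_lt_top.2 ⟨hf.2, hg.2⟩)⟩
  smul_mem' := fun c f hf =>
    ⟨hf.1.smul c, by rw [p.smul]; exact ENNReal.mul_lt_top (by simp) hf.2⟩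

/-- The type of holomorphic functions on `B_N` with finite `p`, normed by `p`. (A separate type,
so that it does not carry the topology of pointwise convergence.) -/
def HoloSpace {N : ℕ} (p : HoloENorm N) : Type := holoSubmodule p

namespace HoloSpace

variable {N : ℕ} {p : HoloENorm N}

/-- The underlying function (extended by zero). -/
def toFun (f : HoloSpace p) : Cn N → ℂ := Subtype.val f

instance instAddCommGroup : AddCommGroup (HoloSpace p) :=
  inferInstanceAs (AddCommGroup (holoSubmodule p))

/-- The norm of `HoloSpace p` is `p`. -/
def groupNorm (p : HoloENorm N) : AddGroupNorm (HoloSpace p) where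
  toFun f := (p.toFun f.toFun).toReal
  map_zero' := by
    change (p.toFun 0).toReal = 0
    simp [p.map_zero]
  add_le' f g := by
    change (p.toFun (f.toFun + g.toFun)).toReal ≤ _
    have hf : p.toFun f.toFun ≠ ∞ := f.2.2.ne
    have hg : p.toFun g.toFun ≠ ∞ := g.2.2.ne
    rw [← ENNReal.toReal_add hf hg]
    exact ENNReal.toReal_mono (ENNReal.add_ne_top.2 ⟨hf, hg⟩)
      (p.add_le _ _ f.2.1 g.2.1)
  neg' f := by
    change (p.toFun (-f.toFun)).toReal = _
    have := p.smul (-1) f.toFun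
    simp only [neg_smul, one_smul, enorm_neg, enorm_one, one_mul] at this
    rw [this]
  eq_zero_of_map_eq_zero' f hf := by
    rcases (ENNReal.toReal_eq_zero_iff _).1 hf with h | h
    · exact Subtype.ext (p.eq_zero _ f.2.1 h)
    · exact absurd h f.2.2.ne

instance instNormedAddCommGroup : NormedAddCommGroup (HoloSpace p) :=
  (groupNorm p).toNormedAddCommGroup

instance instModule : Module ℂ (HoloSpace p) :=
  inferInstanceAs (Module ℂ (holoSubmodule p))

theorem norm_def (f : HoloSpace p) : ‖f‖ = (p.toFun f.toFun).toReal := rfl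

instance instNormedSpace : NormedSpace ℂ (HoloSpace p) where
  norm_smul_le c f := by
    change (p.toFun (c • f.toFun)).toReal ≤ ‖c‖ * (p.toFun f.toFun).toReal
    rw [p.smul]
    simp

end HoloSpace

/-! ### Hardy and weighted Bergman spaces -/

/-- Normalized Lebesgue (surface) measure `σ` on the unit sphere `∂B_N`. -/
def sigma (N : ℕ) : Measure (sphere (0 : Cn N) 1) :=
  ((volume : Measure (Cn N)).toSphere univ)⁻¹ • (volume : Measure (Cn N)).toSphere

/-- Normalized Lebesgue volume measure `ν` on `B_N`. -/
def nu (N : ℕ) : Measure (Cn N) :=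
  ((volume : Measure (Cn N)) (unitBall N))⁻¹ • (volume : Measure (Cn N)).restrict (unitBall N)

/-- The weight `w_s(z) = Γ(N+s+1) / (Γ(N+1) Γ(s+1)) (1 - |z|²)^s`. -/
def bergmanWeight (N : ℕ) (s : ℝ) (z : Cn N) : ℝ :=
  Real.Gamma (N + s + 1) / (Real.Gamma (N + 1) * Real.Gamma (s + 1)) * (1 - ‖z‖ ^ 2) ^ s

/-- The measure `w_s dν` on `B_N`. -/
def bergmanMeasure (N : ℕ) (s : ℝ) : Measure (Cn N) :=
  (nu N).withDensity fun z => ENNReal.ofReal (bergmanWeight N s z)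

/-- `sup_{0<r<1} (∫_{∂B_N} |f(rξ)|² dσ(ξ))^{1/2}`. -/
def hardyFun (N : ℕ) (f : Cn N → ℂ) : ℝ≥0∞ :=
  ⨆ r ∈ Ioo (0 : ℝ) 1, eLpNorm (fun ξ : sphere (0 : Cn N) 1 => f (r • (ξ : Cn N))) 2 (sigma N)

/-- `(∫_{B_N} |f|² w_s dν)^{1/2}`. -/
def bergmanFun (N : ℕ) (s : ℝ) (f : Cn N → ℂ) : ℝ≥0∞ :=
  eLpNorm f 2 (bergmanMeasure N s)

theorem smul_mem_unitBall {N : ℕ} {r : ℝ} (hr : r ∈ Ioo (0 : ℝ) 1) (ξ : sphere (0 : Cn N) 1) :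
    r • (ξ : Cn N) ∈ unitBall N := by
  have : ‖(ξ : Cn N)‖ = 1 := by simp
  simp [norm_smul, this, abs_of_pos hr.1, hr.2]

theorem IsHolo.continuous_dilate {N : ℕ} {f : Cn N → ℂ} (hf : IsHolo f) {r : ℝ}
    (hr : r ∈ Ioo (0 : ℝ) 1) :
    Continuous fun ξ : sphere (0 : Cn N) 1 => f (r • (ξ : Cn N)) :=
  hf.1.continuousOn.comp_continuous (by fun_prop) (smul_mem_unitBall hr)

theorem IsHolo.measurable {N : ℕ} {f : Cn N → ℂ} (hf : IsHolo f) : Measurable f := by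
  have h : f = (unitBall N).indicator f := by
    ext z
    by_cases hz : z ∈ unitBall N
    · simp [hz]
    · simp [hz, hf.2 z hz]
  have hc : ContinuousOn f (unitBall N) := hf.1.continuousOn
  classical
  have h0 := hc.measurable_piecewise (g := 0) continuousOn_const measurableSet_ball
  rw [Set.piecewise_eq_indicator] at h0
  rwa [h]

theorem sigma_isOpenPosMeasure (N : ℕ) : (sigma N).IsOpenPosMeasure := by
  refine Measure.isOpenPosMeasure_smul _ ?_
  exact ENNReal.inv_ne_zero.2 (measure_ne_top _ _)

/-- The norm of the Hardy space `H²(B_N)`. -/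
def hardyNorm (N : ℕ) [NeZero N] : HoloENorm N where
  toFun := hardyFun N
  add_le f g hf hg := by
    refine iSup₂_le fun r hr => ?_
    refine (eLpNorm_add_le (hf.continuous_dilate hr).aestronglyMeasurable
      (hg.continuous_dilate hr).aestronglyMeasurable (by norm_num)).trans ?_
    exact add_le_add
      (le_iSup₂_of_le (f := fun (r : ℝ) (_ : r ∈ Ioo (0 : ℝ) 1) =>
        eLpNorm (fun ξ : sphere (0 : Cn N) 1 => f (r • (ξ : Cn N))) 2 (sigma N)) r hr le_rfl)
      (le_iSup₂_of_le (f := fun (r : ℝ) (_ : r ∈ Ioo (0 : ℝ) 1) =>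
        eLpNorm (fun ξ : sphere (0 : Cn N) 1 => g (r • (ξ : Cn N))) 2 (sigma N)) r hr le_rfl)
  smul c f := by
    simp only [hardyFun, ENNReal.mul_iSup]
    refine iSup_congr fun r => iSup_congr fun _ => ?_
    exact eLpNorm_const_smul c (fun ξ : sphere (0 : Cn N) 1 => f (r • (ξ : Cn N))) 2 (sigma N)
  eq_zero f hf h0 := by
    have := sigma_isOpenPosMeasure N
    have h1 : ∀ r ∈ Ioo (0 : ℝ) 1, ∀ ξ : sphere (0 : Cn N) 1, f (r • (ξ : Cn N)) = 0 := by
      intro r hr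
      have h2 : eLpNorm (fun ξ : sphere (0 : Cn N) 1 => f (r • (ξ : Cn N))) 2 (sigma N) = 0 := by
        simp only [hardyFun, ENNReal.iSup_eq_zero] at h0
        exact h0 r hr
      rw [eLpNorm_eq_zero_iff (hf.continuous_dilate hr).aestronglyMeasurable (by norm_num)] at h2
      have h3 := ((hf.continuous_dilate hr).ae_eq_iff_eq (sigma N) continuous_const).1 h2
      exact fun ξ => congrFun h3 ξ
    have h4 : ∀ z ∈ unitBall N, z ≠ 0 → f z = 0 := by
      intro z hz hz0
      have hz' : ‖z‖ ≠ 0 := norm_ne_zero_iff.2 hz0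
      have := h1 ‖z‖ ⟨norm_pos_iff.2 hz0, by simpa using hz⟩
        ⟨(‖z‖⁻¹ : ℝ) • z, by simp [norm_smul, hz']⟩
      simpa [smul_smul, hz'] using this
    have h5 : Set.EqOn f 0 (unitBall N) := by
      have hrr : f =ᵐ[volume.restrict (unitBall N)] 0 := by
        refine (ae_restrict_iff' measurableSet_ball).2 ?_
        have : ∀ᵐ z : Cn N, z ≠ 0 := by simp [ae_iff]
        filter_upwards [this] with z hz hzb using h4 z hzb hz
      exact Measure.eqOn_open_of_ae_eq hrr isOpen_ball hf.1.continuousOn continuousOn_const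
    ext z
    by_cases hz : z ∈ unitBall N
    · exact h5 hz
    · exact hf.2 z hz

theorem bergmanWeight_pos {N : ℕ} {s : ℝ} (hs : -1 < s) {z : Cn N} (hz : z ∈ unitBall N) :
    0 < bergmanWeight N s z := by
  have hz1 : ‖z‖ < 1 := by simpa using hz
  have h1 : 0 < 1 - ‖z‖ ^ 2 := by nlinarith [norm_nonneg z]
  have hN : (0 : ℝ) ≤ N := N.cast_nonneg
  unfold bergmanWeight
  have a := Real.Gamma_pos_of_pos (show 0 < (N : ℝ) + s + 1 by linarith)
  have b := Real.Gamma_pos_of_pos (show 0 < (N : ℝ) + 1 by linarith)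
  have c := Real.Gamma_pos_of_pos (show 0 < s + 1 by linarith)
  positivity

/-- The norm of the weighted Bergman space `A²_s(B_N)`, `s > -1`. -/
def bergmanNorm (N : ℕ) (s : ℝ) (hs : -1 < s) : HoloENorm N where
  toFun := bergmanFun N s
  add_le f g hf hg := eLpNorm_add_le hf.measurable.aestronglyMeasurable
      hg.measurable.aestronglyMeasurable (by norm_num)
  smul c f := eLpNorm_const_smul c f 2 _
  eq_zero f hf h0 := by
    rw [bergmanFun, eLpNorm_eq_zero_iff hf.measurable.aestronglyMeasurable (by norm_num),
      bergmanMeasure, nu] at h0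
    have hw : Measurable fun z : Cn N => ENNReal.ofReal (bergmanWeight N s z) := by
      unfold bergmanWeight
      fun_prop
    have h1 := (ae_withDensity_iff hw).1 h0
    have hc : ((volume : Measure (Cn N)) (unitBall N))⁻¹ ≠ 0 :=
      ENNReal.inv_ne_zero.2 measure_ball_lt_top.ne
    have h2 := (Measure.ae_ennreal_smul_measure_iff hc).1 h1
    have h3 : f =ᵐ[volume.restrict (unitBall N)] 0 := by
      have hm : ∀ᵐ z ∂(volume : Measure (Cn N)).restrict (unitBall N), z ∈ unitBall N :=
        ae_restrict_mem measurableSet_ball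
      filter_upwards [h2, hm] with z hz hzb
      exact hz (by simpa using bergmanWeight_pos hs hzb)
    have h5 := Measure.eqOn_open_of_ae_eq h3 isOpen_ball hf.1.continuousOn continuousOn_const
    ext z
    by_cases hz : z ∈ unitBall N
    · exact h5 hz
    · exact hf.2 z hz

/-- `H²(B_N)`. -/
abbrev HardySpace (N : ℕ) [NeZero N] : Type := HoloSpace (hardyNorm N)

/-- `A²_s(B_N)`, `s > -1`. -/
abbrev BergmanSpace (N : ℕ) (s : ℝ) (hs : -1 < s) : Type := HoloSpace (bergmanNorm N s hs)

/-! ### Composition operators and the essential norm -/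

/-- `φ` is an analytic self-map of `B_N` (values off the ball are irrelevant). -/
def IsAnalyticSelfMap {N : ℕ} (φ : Cn N → Cn N) : Prop :=
  DifferentiableOn ℂ φ (unitBall N) ∧ MapsTo φ (unitBall N) (unitBall N)

/-- `f ∘ φ` on `B_N`, extended by zero. -/
def compFun {N : ℕ} (φ : Cn N → Cn N) (f : Cn N → ℂ) : Cn N → ℂ :=
  (unitBall N).indicator fun z => f (φ z)

/-- `φ` induces a bounded composition operator on the space `HoloSpace p`: composition with `φ`
maps the space to itself and is bounded. -/
structure InducesBounded {N : ℕ} (p : HoloENorm N) (φ : Cn N → Cn N) : Prop where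
  mem : ∀ f : HoloSpace p, compFun φ f.toFun ∈ holoSubmodule p
  bound : ∃ C : ℝ, ∀ f : HoloSpace p, (p.toFun (compFun φ f.toFun)).toReal ≤ C * ‖f‖

/-- The bounded composition operator `C_φ f = f ∘ φ`. -/
def compOp {N : ℕ} {p : HoloENorm N} {φ : Cn N → Cn N} (h : InducesBounded p φ) :
    HoloSpace p →L[ℂ] HoloSpace p :=
  LinearMap.mkContinuousOfExistsBound
    { toFun := fun f => (⟨compFun φ f.toFun, h.mem f⟩ : holoSubmodule p)
      map_add' := fun f g => Subtype.ext <|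
        Set.indicator_add (unitBall N) (fun z => f.toFun (φ z)) (fun z => g.toFun (φ z))
      map_smul' := fun c f => Subtype.ext <|
        Set.indicator_const_smul (unitBall N) c (fun z => f.toFun (φ z)) }
    h.bound

theorem compOp_apply {N : ℕ} {p : HoloENorm N} {φ : Cn N → Cn N} (h : InducesBounded p φ)
    (f : HoloSpace p) {z : Cn N} (hz : z ∈ unitBall N) :
    (compOp h f).toFun z = f.toFun (φ z) := by
  change compFun φ f.toFun z = _
  simp [compFun, hz]

/-- The essential norm `‖T‖_e = inf {‖T - K‖ : K compact}`. -/
def essNorm {E : Type*} [NormedAddCommGroup E] [NormedSpace ℂ E] (T : E →L[ℂ] E) : ℝ :=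
  sInf {c : ℝ | ∃ K : E →L[ℂ] E, IsCompactOperator K ∧ c = ‖T - K‖}

/-! ### Boundary behaviour -/

/-- `Γ : [0,1) → B_N` is a restricted `ζ`-curve: a curve in `B_N` that approaches `ζ`, with
`|Γ(t) - γ(t)|² / (1 - |γ(t)|²) → 0` and `|γ(t) - ζ| / (1 - |γ(t)|)` bounded, where
`γ(t) = ⟨Γ(t), ζ⟩ ζ`. -/
structure IsRestrictedCurve {N : ℕ} (ζ : Cn N) (Γ : ℝ → Cn N) : Prop where
  continuousOn : ContinuousOn Γ (Ico 0 1)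
  mem_ball : ∀ t ∈ Ico (0 : ℝ) 1, Γ t ∈ unitBall N
  tendsto : Tendsto Γ (𝓝[<] 1) (𝓝 ζ)
  special : Tendsto
    (fun t => ‖Γ t - inner ℂ ζ (Γ t) • ζ‖ ^ 2 / (1 - ‖inner ℂ ζ (Γ t) • ζ‖ ^ 2)) (𝓝[<] 1) (𝓝 0)
  nontangential : ∃ M : ℝ, ∀ t ∈ Ico (0 : ℝ) 1,
    ‖inner ℂ ζ (Γ t) • ζ - ζ‖ / (1 - ‖inner ℂ ζ (Γ t) • ζ‖) ≤ M

/-- `f` has restricted limit `L` at `ζ`. -/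
def HasRestrictedLimit {N : ℕ} (f : Cn N → ℂ) (ζ : Cn N) (L : ℂ) : Prop :=
  ∀ Γ : ℝ → Cn N, IsRestrictedCurve ζ Γ → Tendsto (fun t => f (Γ t)) (𝓝[<] 1) (𝓝 L)

/-- `φ` has finite angular derivative at `ζ`: for some `η ∈ ∂B_N`, the quotient
`⟨η - φ(z), η⟩ / ⟨ζ - z, ζ⟩` has a (finite) restricted limit at `ζ`. -/
def HasFiniteAngularDeriv {N : ℕ} (φ : Cn N → Cn N) (ζ : Cn N) : Prop :=
  ∃ η ∈ sphere (0 : Cn N) 1, ∃ L : ℂ,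
    HasRestrictedLimit (fun z => inner ℂ η (η - φ z) / inner ℂ ζ (ζ - z)) ζ L

/-- `d_φ(ζ) = liminf_{z → ζ} (1 - |φ(z)|) / (1 - |z|)`, with `z → ζ` unrestrictedly in `B_N`;
an element of `[0, ∞]`. -/
def dCoeff {N : ℕ} (φ : Cn N → Cn N) (ζ : Cn N) : ℝ≥0∞ :=
  liminf (fun z => ENNReal.ofReal ((1 - ‖φ z‖) / (1 - ‖z‖))) (𝓝[unitBall N] ζ)

/-- `ψ(ζ) = φ(ζ)` as radial limits: both radial limits at `ζ` exist and they coincide. -/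
def SameRadialLimit {N : ℕ} (φ ψ : Cn N → Cn N) (ζ : Cn N) : Prop :=
  ∃ w : Cn N, Tendsto (fun r : ℝ => φ (r • ζ)) (𝓝[<] 1) (𝓝 w) ∧
    Tendsto (fun r : ℝ => ψ (r • ζ)) (𝓝[<] 1) (𝓝 w)

end BallCompOp

end

open BallCompOp

namespace BallCompOp

/-! ### Automorphisms of the ball and the Schwarz–Pick inequality -/

/-! Write d for d_φ(ζ). If d = ∞ the bound is 0. Otherwise let K be compact, T = C_φ − C_ψ − K, and
test T on the kernel f = (1 − ⟨·, a⟩)^(−β) with a = φ(z), where z → ζ. Two facts about the space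
suffice, recorded in `HasPowerKernel`: evaluation at z has norm at most (1 − |z|²)^(−β/2), and after
normalization tends to 0 on each fixed function as |z| → 1 on a complex line through 0; and ‖f‖ ≤ (1
− |a|²)^(−β/2). Evaluating T f at z and normalizing bounds ‖T‖ below by ((1 − |z|²)/(1 −
|φ(z)|²))^(β/2), minus a contribution of f(ψ(z)) and one of K. The latter tends to 0 because the
image of the unit ball under K is totally bounded. The former is small once 1 − |z|² is small
against |1 − ⟨ψ(z), φ(z)⟩|. This is `HasPowerKernel.le_norm_sub`.

The points z are taken on a segment z = (1 − t(1 + iM))ζ, t → 0+. Schwarz–Pick gives Julia's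
inequality (`exists_julia`), and a Harnack argument turns it into 1 − ⟨φ(z), η⟩ ~ d t (1 + iM) for
some unit η (`exists_tendsto_one_sub_inner_div`). Hence (1 − |φ(z)|²)/(1 − |z|²) is asymptotically
at most d, whatever M is. If d_ψ(ζ) = ∞, or if ψ tends to another boundary point, the segment M = 0
already separates φ and ψ. If both maps tend to η but d_ψ(ζ) ≠ d, then 1 − ⟨ψ, φ⟩ divided by t has
imaginary part close to (d_ψ(ζ) − d)M, up to an error bounded independently of M from the components
orthogonal to η; a large M separates them (`exists_slant_separated`).

The two facts about the space come from unitary invariance (`HasInvariantMeasures.hasPowerKernel`).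
Powers of one linear functional are orthogonal, and restricting to a complex line through 0 does not
increase the norm, so everything reduces to power series in one variable with weights equal to the
reciprocals of the coefficients of (1 − z)^(−β). The weights are identified by comparing a Gaussian
integral in Cartesian and in polar coordinates (`sphereMoment_eq`), followed by a beta integral in
the Bergman case. -/

theorem one_sub_norm_sq_pos {E : Type*} [NormedAddCommGroup E] {a : E} (ha : ‖a‖ < 1) :
    0 < 1 - ‖a‖ ^ 2 := by
  nlinarith [norm_nonneg a]

section Automorphism

variable {E : Type*} [NormedAddCommGroup E] [InnerProductSpace ℂ E]

/-- The involutive automorphism of the unit ball exchanging `0` and `a`. -/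
noncomputable def ballInv (a z : E) : E :=
  (1 - inner ℂ a z)⁻¹ • (a - ((√(1 - ‖a‖ ^ 2) : ℝ) : ℂ) • z
    - (inner ℂ a z / (1 + ((√(1 - ‖a‖ ^ 2) : ℝ) : ℂ))) • a)

theorem norm_inner_lt_one {a z : E} (ha : ‖a‖ < 1) (hz : ‖z‖ ≤ 1) : ‖(inner ℂ a z : ℂ)‖ < 1 := by
  have := norm_inner_le_norm (𝕜 := ℂ) a z
  nlinarith [norm_nonneg a, norm_nonneg z]

theorem one_sub_inner_ne_zero {a z : E} (ha : ‖a‖ < 1) (hz : ‖z‖ ≤ 1) :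
    (1 : ℂ) - inner ℂ a z ≠ 0 := by
  intro h
  have h1 := norm_inner_lt_one ha hz
  rw [← sub_eq_zero.1 h] at h1
  simp at h1

theorem one_sub_norm_le_norm_one_sub_inner {a z : E} (ha : ‖a‖ ≤ 1) :
    1 - ‖z‖ ≤ ‖(1 : ℂ) - inner ℂ a z‖ := by
  have h1 := norm_inner_le_norm (𝕜 := ℂ) a z
  have h2 := norm_sub_norm_le (1 : ℂ) (inner ℂ a z)
  rw [norm_one] at h2
  nlinarith [norm_nonneg a, norm_nonneg z]

/-- With s² = 1 − |a|² and t = ⟨z, a⟩, the vector in the numerator of `ballInv a z` has squared norm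
|1 − t|² − s²(1 − |z|²). This identity makes Schwarz–Pick an inequality between inner products. -/
theorem one_sub_norm_sq_ballInv {a z : E} (ha : ‖a‖ < 1) (hz : ‖z‖ ≤ 1) :
    (1 - ‖ballInv a z‖ ^ 2) * ‖(1 : ℂ) - inner ℂ a z‖ ^ 2 = (1 - ‖a‖ ^ 2) * (1 - ‖z‖ ^ 2) := by
  have h0 := one_sub_inner_ne_zero ha hz
  have hp := one_sub_norm_sq_pos ha
  obtain ⟨s, hs, hs2⟩ : ∃ s, s = √(1 - ‖a‖ ^ 2) ∧ s ^ 2 = 1 - ‖a‖ ^ 2 :=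
    ⟨_, rfl, Real.sq_sqrt hp.le⟩
  have hs0 : 0 < s := hs ▸ Real.sqrt_pos.2 hp
  set t : ℂ := inner ℂ a z with ht
  have key : ‖a - (s : ℂ) • z - (t / (1 + (s : ℂ))) • a‖ ^ 2
      = ‖(1 : ℂ) - t‖ ^ 2 - s ^ 2 * (1 - ‖z‖ ^ 2) := by
    have e1 : a - (s : ℂ) • z - (t / (1 + (s : ℂ))) • a
        = (1 - t / (1 + (s : ℂ))) • a - (s : ℂ) • z := by
      rw [sub_smul, one_smul]; abel
    have hs1 : (1 + (s : ℂ)) = ((1 + s : ℝ) : ℂ) := by push_cast; rfl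
    have hq : t / (1 + (s : ℂ)) = (((1 + s)⁻¹ : ℝ) : ℂ) * t := by
      rw [hs1, div_eq_mul_inv, mul_comm]; push_cast; rfl
    rw [e1, @norm_sub_sq ℂ, norm_smul, norm_smul, inner_smul_left, inner_smul_right, ← ht, hq,
      mul_pow, mul_pow, Complex.sq_norm, Complex.sq_norm, Complex.sq_norm]
    have ha2 : ‖a‖ ^ 2 = 1 - s ^ 2 := by linarith
    rw [ha2]
    -- Naming the inverse of 1 + s makes the identity polynomial modulo the relation q(1 + s) = 1.
    obtain ⟨q, hq', hq2⟩ : ∃ q, q = (1 + s)⁻¹ ∧ q * (1 + s) = 1 :=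
      ⟨_, rfl, inv_mul_cancel₀ (by linarith)⟩
    rw [← hq']
    simp only [Complex.normSq_apply, map_sub, map_one, map_mul, Complex.conj_ofReal,
      RCLike.re_to_complex, Complex.sub_re, Complex.mul_re, Complex.mul_im, Complex.one_re,
      Complex.one_im, Complex.sub_im, Complex.conj_re, Complex.conj_im, Complex.ofReal_re,
      Complex.ofReal_im]
    linear_combination ((t.re ^ 2 + t.im ^ 2) * (q * (1 - s) + 1) - 2 * (1 - s) * t.re) * hq2
  rw [ballInv, ← hs, ← ht, norm_smul, mul_pow, key, ← hs2, norm_inv, inv_pow]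
  have h3 : ‖(1 : ℂ) - t‖ ^ 2 ≠ 0 := pow_ne_zero _ (norm_ne_zero_iff.2 h0)
  field_simp
  ring

theorem norm_ballInv_lt_one {a z : E} (ha : ‖a‖ < 1) (hz : ‖z‖ < 1) : ‖ballInv a z‖ < 1 := by
  have h := one_sub_norm_sq_ballInv ha hz.le
  have h1 := mul_pos (one_sub_norm_sq_pos ha) (one_sub_norm_sq_pos hz)
  rw [← h] at h1
  have := pos_of_mul_pos_left h1 (sq_nonneg _)
  nlinarith [norm_nonneg (ballInv a z)]

theorem ballInv_zero (a : E) : ballInv a 0 = a := by simp [ballInv]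

theorem inner_self_ofReal (a : E) : (inner ℂ a a : ℂ) = ((‖a‖ ^ 2 : ℝ) : ℂ) := by
  rw [inner_self_eq_norm_sq_to_K]; norm_cast

theorem ballInv_self {a : E} (ha : ‖a‖ < 1) : ballInv a a = 0 := by
  have hp := one_sub_norm_sq_pos ha
  obtain ⟨s, hs, hs2⟩ : ∃ s, s = √(1 - ‖a‖ ^ 2) ∧ s ^ 2 = 1 - ‖a‖ ^ 2 :=
    ⟨_, rfl, Real.sq_sqrt hp.le⟩
  have hs0 : 0 < s := hs ▸ Real.sqrt_pos.2 hp
  have hs1 : (1 + (s : ℂ)) ≠ 0 := by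
    have : (1 + (s : ℂ)) = ((1 + s : ℝ) : ℂ) := by push_cast; rfl
    rw [this]; exact_mod_cast (by linarith : (1 + s) ≠ 0)
  have h : a - (s : ℂ) • a - (((‖a‖ ^ 2 : ℝ) : ℂ) / (1 + (s : ℂ))) • a = 0 := by
    have : ‖a‖ ^ 2 = 1 - s ^ 2 := by linarith
    rw [this]
    have : (((1 - s ^ 2 : ℝ) : ℂ) / (1 + (s : ℂ))) = 1 - s := by
      field_simp; push_cast; ring
    rw [this]; module
  rw [ballInv, ← hs, inner_self_ofReal, h, smul_zero]

/-- The computation closes because 1 − ⟨`ballInv a z`, a⟩ = s²/(1 − ⟨z, a⟩); then the coefficients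
of a and z are compared. -/
theorem ballInv_ballInv {a z : E} (ha : ‖a‖ < 1) (hz : ‖z‖ < 1) :
    ballInv a (ballInv a z) = z := by
  have h0 := one_sub_inner_ne_zero ha hz.le
  have hp := one_sub_norm_sq_pos ha
  obtain ⟨s, hs, hs2⟩ : ∃ s, s = √(1 - ‖a‖ ^ 2) ∧ s ^ 2 = 1 - ‖a‖ ^ 2 :=
    ⟨_, rfl, Real.sq_sqrt hp.le⟩
  have hs0 : 0 < s := hs ▸ Real.sqrt_pos.2 hp
  have hsc : (s : ℂ) ≠ 0 := by exact_mod_cast hs0.ne'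
  have hs1 : (1 + (s : ℂ)) ≠ 0 := by
    have : (1 + (s : ℂ)) = ((1 + s : ℝ) : ℂ) := by push_cast; rfl
    rw [this]; exact_mod_cast (by linarith : (1 + s) ≠ 0)
  have ha2 : ‖a‖ ^ 2 = 1 - s ^ 2 := by linarith
  have hin : (inner ℂ a (ballInv a z) : ℂ) = 1 - (s : ℂ) ^ 2 / (1 - inner ℂ a z) := by
    rw [ballInv, ← hs, inner_smul_right, inner_sub_right, inner_sub_right, inner_smul_right,
      inner_smul_right, inner_self_ofReal, ha2]
    push_cast
    field_simp
    ring
  rw [ballInv, hin, ballInv, ← hs]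
  set t : ℂ := inner ℂ a z
  rw [show (1 : ℂ) - (1 - (s : ℂ) ^ 2 / (1 - t)) = (s : ℂ) ^ 2 / (1 - t) by ring]
  match_scalars
  · field_simp
    ring
  · field_simp

theorem differentiableOn_ballInv {a : E} (ha : ‖a‖ < 1) :
    DifferentiableOn ℂ (ballInv a) (ball 0 1) := by
  have h : Differentiable ℂ fun z : E => (inner ℂ a z : ℂ) := (innerSL ℂ a).differentiable
  unfold ballInv
  refine DifferentiableOn.smul (DifferentiableOn.inv (by fun_prop) fun z hz => ?_) (by fun_prop)
  exact one_sub_inner_ne_zero ha (by simpa using (mem_ball_zero_iff.1 hz).le)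

/-- **Schwarz–Pick inequality** for holomorphic self-maps of the unit ball. -/
theorem schwarzPick_ball {φ : E → E} (hd : DifferentiableOn ℂ φ (ball 0 1))
    (hm : MapsTo φ (ball 0 1) (ball 0 1)) {z w : E} (hz : ‖z‖ < 1) (hw : ‖w‖ < 1) :
    (1 - ‖z‖ ^ 2) * (1 - ‖w‖ ^ 2) * ‖(1 : ℂ) - inner ℂ (φ w) (φ z)‖ ^ 2
      ≤ (1 - ‖φ z‖ ^ 2) * (1 - ‖φ w‖ ^ 2) * ‖(1 : ℂ) - inner ℂ w z‖ ^ 2 := by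
  have hφ : ∀ {x : E}, ‖x‖ < 1 → ‖φ x‖ < 1 := fun hx =>
    mem_ball_zero_iff.1 (hm (mem_ball_zero_iff.2 hx))
  have mw : MapsTo (ballInv w) (ball 0 1) (ball 0 1) := fun x hx =>
    mem_ball_zero_iff.2 (norm_ballInv_lt_one hw (mem_ball_zero_iff.1 hx))
  have mφ : MapsTo (ballInv (φ w)) (ball 0 1) (ball 0 1) := fun x hx =>
    mem_ball_zero_iff.2 (norm_ballInv_lt_one (hφ hw) (mem_ball_zero_iff.1 hx))
  -- Conjugating φ by the automorphisms that move w and φ(w) to the origin gives a self-map fixing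
  -- 0, to which the Schwarz lemma applies.
  have hg : DifferentiableOn ℂ (fun x => ballInv (φ w) (φ (ballInv w x))) (ball 0 1) :=
    (differentiableOn_ballInv (hφ hw)).comp
      (hd.comp (differentiableOn_ballInv hw) mw) (hm.comp mw)
  have h := Complex.norm_le_norm_of_mapsTo_ball (z := ballInv w z) hg
    (fun x hx => ball_subset_closedBall (mφ (hm (mw hx))))
    (by simp only [ballInv_zero]; exact ballInv_self (hφ hw)) (norm_ballInv_lt_one hw hz)
  simp only [ballInv_ballInv hw hz] at h
  have e1 := one_sub_norm_sq_ballInv hw hz.le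
  have e2 := one_sub_norm_sq_ballInv (hφ hw) (hφ hz).le
  have h2 : 1 - ‖ballInv w z‖ ^ 2 ≤ 1 - ‖ballInv (φ w) (φ z)‖ ^ 2 := by
    have := pow_le_pow_left₀ (norm_nonneg _) h 2
    linarith
  calc _ = (1 - ‖ballInv w z‖ ^ 2) * (‖(1 : ℂ) - inner ℂ w z‖ ^ 2 *
        ‖(1 : ℂ) - inner ℂ (φ w) (φ z)‖ ^ 2) := by rw [← mul_assoc, e1]; ring
    _ ≤ (1 - ‖ballInv (φ w) (φ z)‖ ^ 2) * (‖(1 : ℂ) - inner ℂ w z‖ ^ 2 *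
        ‖(1 : ℂ) - inner ℂ (φ w) (φ z)‖ ^ 2) := by gcongr
    _ = _ := by rw [mul_left_comm, e2]; ring

end Automorphism

/-! ### Julia's inequality -/

variable {N : ℕ}

theorem IsAnalyticSelfMap.norm_lt_one {φ : Cn N → Cn N} (hφ : IsAnalyticSelfMap φ) {z : Cn N}
    (hz : ‖z‖ < 1) : ‖φ z‖ < 1 :=
  mem_ball_zero_iff.1 (hφ.2 (mem_ball_zero_iff.2 hz))

/-- Schwarz–Pick against the base point 0. It keeps `dCoeff` away from 0, so that negative powers of
it are finite. -/
theorem IsAnalyticSelfMap.exists_pos_mul_le {φ : Cn N → Cn N} (hφ : IsAnalyticSelfMap φ) :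
    ∃ c > 0, ∀ z : Cn N, ‖z‖ < 1 → c * (1 - ‖z‖) ≤ 1 - ‖φ z‖ := by
  have h0 := hφ.norm_lt_one (z := 0) (by simp)
  -- The 4 bounds the product of 1 + |φ(z)| and 1 + |φ(0)|.
  refine ⟨(1 - ‖φ 0‖) / 4, by linarith, fun z hz => ?_⟩
  have h := schwarzPick_ball hφ.1 hφ.2 hz (w := 0) (by simp)
  have h1 := hφ.norm_lt_one hz
  have h2 : 1 - ‖φ 0‖ ≤ ‖(1 : ℂ) - inner ℂ (φ 0) (φ z)‖ := by
    have a1 := norm_inner_le_norm (𝕜 := ℂ) (φ 0) (φ z)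
    have a2 := norm_sub_norm_le (1 : ℂ) (inner ℂ (φ 0) (φ z))
    rw [norm_one] at a2
    nlinarith [norm_nonneg (φ 0), norm_nonneg (φ z)]
  simp only [inner_zero_left, sub_zero, norm_zero, norm_one, one_pow, mul_one,
    zero_pow (two_ne_zero)] at h
  set p := ‖φ 0‖
  set x := ‖z‖ with hx
  have hx0 : 0 ≤ x := norm_nonneg _
  set y := ‖φ z‖
  have hy0 : 0 ≤ y := norm_nonneg _
  have hp0 : 0 ≤ p := norm_nonneg _
  have h3 : (1 - p) ^ 2 ≤ ‖(1 : ℂ) - inner ℂ (φ 0) (φ z)‖ ^ 2 :=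
    pow_le_pow_left₀ (by linarith) h2 2
  have h4 : (1 - x ^ 2) * (1 - p) ^ 2 ≤ (1 - y ^ 2) * (1 - p ^ 2) :=
    (mul_le_mul_of_nonneg_left h3 (by nlinarith)).trans h
  have h5 : (1 - x ^ 2) * (1 - p) ≤ (1 - y ^ 2) * (1 + p) := by
    have : 0 < 1 - p := by linarith
    refine le_of_mul_le_mul_right ?_ this
    nlinarith
  have h6 : (1 - x) * (1 - p) ≤ (1 - x ^ 2) * (1 - p) := by
    apply mul_le_mul_of_nonneg_right _ (by linarith)
    nlinarith
  have h7 : (1 - y ^ 2) * (1 + p) ≤ 4 * (1 - y) := by nlinarith [mul_nonneg (sub_nonneg.2 h1.le) hy0]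
  linarith

theorem dCoeff_ne_zero {φ : Cn N → Cn N} (hφ : IsAnalyticSelfMap φ) (ζ : Cn N) :
    dCoeff φ ζ ≠ 0 := by
  obtain ⟨c, hc, h⟩ := hφ.exists_pos_mul_le
  have : ENNReal.ofReal c ≤ dCoeff φ ζ := by
    refine le_liminf_of_le (by isBoundedDefault) ?_
    filter_upwards [self_mem_nhdsWithin] with z hz
    have hz1 : ‖z‖ < 1 := mem_ball_zero_iff.1 hz
    refine ENNReal.ofReal_le_ofReal ?_
    rw [le_div_iff₀ (by linarith)]
    exact h z hz1
  intro h0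
  rw [h0] at this
  simp at this
  linarith

theorem eventually_mul_lt_of_lt_dCoeff {φ : Cn N → Cn N} {ζ : Cn N} {c : ℝ} (hc : 0 ≤ c)
    (h : ENNReal.ofReal c < dCoeff φ ζ) :
    ∀ᶠ z in 𝓝[unitBall N] ζ, c * (1 - ‖z‖) < 1 - ‖φ z‖ := by
  filter_upwards [eventually_lt_of_lt_liminf h, self_mem_nhdsWithin] with z h1 hz
  have hz1 : ‖z‖ < 1 := mem_ball_zero_iff.1 hz
  rw [ENNReal.ofReal_lt_ofReal_iff_of_nonneg hc, lt_div_iff₀ (by linarith)] at h1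
  exact h1

/-- Apply Schwarz–Pick to the pair z, w with w running through a sequence tending to ζ that realizes
the lower limit; η is a cluster point of the values φ(w). -/
theorem exists_julia {φ : Cn N → Cn N} (hφ : IsAnalyticSelfMap φ) {ζ : Cn N}
    (hd : dCoeff φ ζ ≠ ∞) (hζ : ‖ζ‖ = 1) : ∃ η : Cn N, ‖η‖ = 1 ∧ ∀ z : Cn N, ‖z‖ < 1 →
      (1 - ‖z‖ ^ 2) * ‖(1 : ℂ) - inner ℂ η (φ z)‖ ^ 2
        ≤ (dCoeff φ ζ).toReal * (1 - ‖φ z‖ ^ 2) * ‖(1 : ℂ) - inner ℂ ζ z‖ ^ 2 := by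
  set d := (dCoeff φ ζ).toReal with hd'
  have hdd : dCoeff φ ζ = ENNReal.ofReal d := (ENNReal.ofReal_toReal hd).symm
  have hd0 : 0 ≤ d := ENNReal.toReal_nonneg
  have hex : ∀ n : ℕ, ∃ w : Cn N, ‖w‖ < 1 ∧ dist w ζ < 1 / ((n : ℝ) + 1) ∧
      1 - ‖φ w‖ < (d + 1 / ((n : ℝ) + 1)) * (1 - ‖w‖) := by
    intro n
    have hn : (0 : ℝ) < 1 / ((n : ℝ) + 1) := Nat.one_div_pos_of_nat
    have hlt : dCoeff φ ζ < ENNReal.ofReal (d + 1 / ((n : ℝ) + 1)) := by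
      rw [hdd]; exact (ENNReal.ofReal_lt_ofReal_iff_of_nonneg hd0).2 (by linarith)
    have h1 := frequently_lt_of_liminf_lt (by isBoundedDefault) hlt
    have h2 : ∀ᶠ w in 𝓝[unitBall N] ζ, w ∈ unitBall N ∧ dist w ζ < 1 / ((n : ℝ) + 1) :=
      Filter.Eventually.and self_mem_nhdsWithin (nhdsWithin_le_nhds (ball_mem_nhds ζ hn))
    obtain ⟨w, hw1, hw2, hw3⟩ := (h1.and_eventually h2).exists
    have hw : ‖w‖ < 1 := mem_ball_zero_iff.1 hw2
    refine ⟨w, hw, hw3, ?_⟩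
    rw [ENNReal.ofReal_lt_ofReal_iff (by linarith), div_lt_iff₀ (by linarith)] at hw1
    exact hw1
  choose w hw1 hw2 hw3 using hex
  have t0 : Tendsto (fun n : ℕ => 1 / ((n : ℝ) + 1)) atTop (𝓝 0) :=
    tendsto_one_div_add_atTop_nhds_zero_nat
  have tw : Tendsto w atTop (𝓝 ζ) :=
    tendsto_iff_dist_tendsto_zero.2 (squeeze_zero (fun _ => dist_nonneg) (fun n => (hw2 n).le) t0)
  obtain ⟨η, -, k, hk, tη⟩ := (isCompact_closedBall (0 : Cn N) 1).tendsto_subseq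
    (x := fun n => φ (w n)) fun n => mem_closedBall_zero_iff.2 (hφ.norm_lt_one (hw1 n)).le
  have twk := tw.comp hk.tendsto_atTop
  have t0k := t0.comp hk.tendsto_atTop
  have tnw : Tendsto (fun n => ‖w (k n)‖) atTop (𝓝 1) := hζ ▸ twk.norm
  have tnφ : Tendsto (fun n => ‖φ (w (k n))‖) atTop (𝓝 ‖η‖) := tη.norm
  -- Along the sequence 1 − |φ(w)| is at most a bounded multiple of 1 − |w|, which tends to 0.
  have hη : ‖η‖ = 1 := by
    refine le_antisymm (le_of_tendsto' tnφ fun n => (hφ.norm_lt_one (hw1 _)).le) ?_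
    have : Tendsto (fun n => 1 - (d + 1 / (((k n : ℕ) : ℝ) + 1)) * (1 - ‖w (k n)‖)) atTop
        (𝓝 (1 - (d + 0) * (1 - 1))) :=
      tendsto_const_nhds.sub ((tendsto_const_nhds.add t0k).mul (tendsto_const_nhds.sub tnw))
    simp only [sub_self, mul_zero, sub_zero] at this
    exact le_of_tendsto_of_tendsto' this tnφ fun n => by linarith [hw3 (k n)]
  refine ⟨η, hη, fun z hz => ?_⟩
  -- The factor 1 − |w| vanishes in the limit, so it is cancelled beforehand; of 1 − |w|² and 1 −
  -- |φ(w)|² only the factors 1 + |w| and 1 + |φ(w)| remain, and both tend to 2.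
  have hL : Tendsto (fun n => (1 - ‖z‖ ^ 2) * (1 + ‖w (k n)‖) *
      ‖(1 : ℂ) - inner ℂ (φ (w (k n))) (φ z)‖ ^ 2) atTop
      (𝓝 ((1 - ‖z‖ ^ 2) * (1 + 1) * ‖(1 : ℂ) - inner ℂ η (φ z)‖ ^ 2)) :=
    (tendsto_const_nhds.mul (tendsto_const_nhds.add tnw)).mul
      ((tendsto_const_nhds.sub (tη.inner tendsto_const_nhds)).norm.pow 2)
  have hR : Tendsto (fun n => (1 - ‖φ z‖ ^ 2) * ((d + 1 / (((k n : ℕ) : ℝ) + 1)) *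
      (1 + ‖φ (w (k n))‖)) * ‖(1 : ℂ) - inner ℂ (w (k n)) z‖ ^ 2) atTop
      (𝓝 ((1 - ‖φ z‖ ^ 2) * ((d + 0) * (1 + 1)) * ‖(1 : ℂ) - inner ℂ ζ z‖ ^ 2)) := by
    rw [hη] at tnφ
    exact (tendsto_const_nhds.mul ((tendsto_const_nhds.add t0k).mul
      (tendsto_const_nhds.add tnφ))).mul
      ((tendsto_const_nhds.sub (twk.inner tendsto_const_nhds)).norm.pow 2)
  have := le_of_tendsto_of_tendsto' hL hR fun n => by
    have h := schwarzPick_ball hφ.1 hφ.2 hz (hw1 (k n))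
    have hpos : 0 < 1 - ‖w (k n)‖ := by linarith [hw1 (k n)]
    refine le_of_mul_le_mul_left ?_ hpos
    have hy := hφ.norm_lt_one hz
    calc _ = (1 - ‖z‖ ^ 2) * (1 - ‖w (k n)‖ ^ 2) *
          ‖(1 : ℂ) - inner ℂ (φ (w (k n))) (φ z)‖ ^ 2 := by ring
      _ ≤ _ := h
      _ = (1 - ‖φ z‖ ^ 2) * ((1 - ‖φ (w (k n))‖) * (1 + ‖φ (w (k n))‖)) *
          ‖(1 : ℂ) - inner ℂ (w (k n)) z‖ ^ 2 := by ring
      _ ≤ (1 - ‖φ z‖ ^ 2) * (((d + 1 / (((k n : ℕ) : ℝ) + 1)) * (1 - ‖w (k n)‖)) *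
          (1 + ‖φ (w (k n))‖)) * ‖(1 : ℂ) - inner ℂ (w (k n)) z‖ ^ 2 := by
        have := hw3 (k n)
        have := one_sub_norm_sq_pos hy
        gcongr
      _ = _ := by ring
  nlinarith

end BallCompOp

namespace BallCompOp

/-! ### Limits along segments ending at a boundary point of the disc -/

/-- A Harnack inequality: Borel–Carathéodory for −h, whose real part is below every ε > 0, and then
ε → 0. -/
theorem norm_le_of_re_nonneg {h : ℂ → ℂ} {c z : ℂ} {R : ℝ} (hd : DifferentiableOn ℂ h (ball c R))
    (hre : ∀ w ∈ ball c R, 0 ≤ (h w).re) (hz : z ∈ ball c R) :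
    ‖h z‖ ≤ ‖h c‖ * (R + ‖z - c‖) / (R - ‖z - c‖) := by
  have hzR : ‖z - c‖ < R := by rwa [mem_ball, dist_eq_norm] at hz
  have hR : 0 < R := (norm_nonneg _).trans_lt hzR
  have hmaps : MapsTo (fun w => c + w) (ball 0 R) (ball c R) := fun w hw => by
    simpa [dist_eq_norm] using hw
  have key : ∀ ε > 0, ‖h z‖ ≤ 2 * ε * ‖z - c‖ / (R - ‖z - c‖) +
      ‖h c‖ * (R + ‖z - c‖) / (R - ‖z - c‖) := by
    intro ε hε
    have := Complex.borelCaratheodory (f := fun w => -h (c + w)) (z := z - c) hε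
      ((hd.comp (by fun_prop) hmaps).neg)
      (fun w hw => by
        have := hre _ (hmaps hw)
        simp only [mem_ofPred_eq, Complex.neg_re]
        linarith) hR (by simpa using hzR)
    simpa using this
  have t : Tendsto (fun ε : ℝ => 2 * ε * ‖z - c‖ / (R - ‖z - c‖) +
      ‖h c‖ * (R + ‖z - c‖) / (R - ‖z - c‖)) (𝓝[>] 0)
      (𝓝 (2 * 0 * ‖z - c‖ / (R - ‖z - c‖) + ‖h c‖ * (R + ‖z - c‖) / (R - ‖z - c‖))) := by
    apply Tendsto.mono_left _ nhdsWithin_le_nhds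
    exact Continuous.tendsto (by fun_prop) 0
  simp only [mul_zero, zero_mul, zero_div, zero_add] at t
  exact ge_of_tendsto t (by filter_upwards [self_mem_nhdsWithin] with ε hε using key ε hε)

/-- The point `1 - t (1 + i M)`, which for `t → 0` approaches `1` along a segment. -/
noncomputable def slant (M t : ℝ) : ℂ := 1 - t * (1 + M * Complex.I)

theorem one_sub_norm_sq_slant (M t : ℝ) : 1 - ‖slant M t‖ ^ 2 = t * (2 - (1 + M ^ 2) * t) := by
  rw [Complex.sq_norm, Complex.normSq_apply, slant]
  simp
  ring

theorem eventually_small {C : ℝ} (hC : 0 < C) : ∀ᶠ t : ℝ in 𝓝[>] 0, 0 < t ∧ t < C := by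
  filter_upwards [Ioo_mem_nhdsGT hC] with t ht using ht

theorem eventually_norm_slant_lt (M : ℝ) : ∀ᶠ t in 𝓝[>] 0, ‖slant M t‖ < 1 := by
  have hM : 0 < 1 + M ^ 2 := by positivity
  filter_upwards [eventually_small (C := 2 / (1 + M ^ 2)) (by positivity)] with t ht
  have h1 : (1 + M ^ 2) * t < 2 := by
    have := (lt_div_iff₀ hM).1 ht.2
    linarith
  have h2 : 0 < 1 - ‖slant M t‖ ^ 2 := by
    rw [one_sub_norm_sq_slant]
    exact mul_pos ht.1 (by linarith)
  nlinarith [norm_nonneg (slant M t)]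

theorem tendsto_slant (M : ℝ) : Tendsto (slant M) (𝓝[>] 0) (𝓝 1) := by
  apply Tendsto.mono_left _ nhdsWithin_le_nhds
  have : Continuous (slant M) := by unfold slant; fun_prop
  simpa [slant] using this.tendsto 0

/-- The disc of centre 1 − T and radius T = (1 + M²)t touches the unit circle at 1. The slanted
point sits in it at the fixed relative distance |M|/√(1 + M²) < 1 from the centre, so Harnack
constants do not depend on t. -/
theorem norm_slant_sub_sq (M t : ℝ) :
    ‖slant M t - slant 0 ((1 + M ^ 2) * t)‖ ^ 2 = M ^ 2 / (1 + M ^ 2) * ((1 + M ^ 2) * t) ^ 2 := by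
  have hM : 1 + M ^ 2 ≠ 0 := by positivity
  have e : slant M t - slant 0 ((1 + M ^ 2) * t) =
      ((M ^ 2 * t : ℝ) : ℂ) - ((t * M : ℝ) : ℂ) * Complex.I := by
    simp only [slant]; push_cast; ring
  rw [Complex.sq_norm, Complex.normSq_apply, e]
  simp only [Complex.sub_re, Complex.sub_im, Complex.re_ofReal_mul, Complex.im_ofReal_mul,
    Complex.I_re, Complex.I_im, Complex.ofReal_re, Complex.ofReal_im]
  field_simp
  ring

theorem ball_slant_subset {T : ℝ} (hT : T ≤ 1) : ball (slant 0 T) T ⊆ ball 0 1 := by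
  intro w hw
  have hT0 : 0 < T := pos_of_mem_ball hw
  rw [mem_ball_zero_iff]
  rw [mem_ball, dist_eq_norm] at hw
  have h1 : ‖slant 0 T‖ = 1 - T := by
    have : slant 0 T = ((1 - T : ℝ) : ℂ) := by simp [slant]
    rw [this, Complex.norm_real, Real.norm_of_nonneg (by linarith)]
  have := norm_le_norm_sub_add w (slant 0 T)
  linarith

/-- Harnack on these tangent discs compares the value at the slanted point with the value at the
real centre, where the decay is assumed. -/
theorem tendsto_mul_slant_of_re_nonneg {h : ℂ → ℂ} (hd : DifferentiableOn ℂ h (ball 0 1))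
    (hre : ∀ w ∈ ball (0 : ℂ) 1, 0 ≤ (h w).re)
    (h0 : Tendsto (fun t : ℝ => t * h (slant 0 t)) (𝓝[>] 0) (𝓝 0)) (M : ℝ) :
    Tendsto (fun t : ℝ => t * h (slant M t)) (𝓝[>] 0) (𝓝 0) := by
  have hM : 0 < 1 + M ^ 2 := by positivity
  set κ := √(M ^ 2 / (1 + M ^ 2)) with hκ
  have hκ1 : κ < 1 := by
    rw [hκ, Real.sqrt_lt' one_pos, one_pow, div_lt_one hM]; linarith
  have hκ0 : 0 ≤ κ := Real.sqrt_nonneg _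
  have hT : Tendsto (fun t : ℝ => (1 + M ^ 2) * t) (𝓝[>] 0) (𝓝[>] 0) := by
    refine tendsto_nhdsWithin_iff.2 ⟨?_, ?_⟩
    · apply Tendsto.mono_left _ nhdsWithin_le_nhds
      have : Continuous fun t : ℝ => (1 + M ^ 2) * t := by fun_prop
      simpa using this.tendsto 0
    · filter_upwards [self_mem_nhdsWithin] with t ht using mul_pos hM ht
  have h1 := ((h0.comp hT).norm).mul_const ((1 + κ) / (1 - κ) / (1 + M ^ 2))
  simp only [norm_zero, zero_mul] at h1
  refine squeeze_zero_norm' ?_ h1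
  filter_upwards [eventually_small (C := 1 / (1 + M ^ 2)) (by positivity)] with t ht
  set T := (1 + M ^ 2) * t with hTd
  have hT0 : 0 < T := mul_pos hM ht.1
  have hT1 : T ≤ 1 := by
    have := (lt_div_iff₀ hM).1 ht.2
    linarith
  have e : ‖slant M t - slant 0 T‖ = κ * T := by
    have := norm_slant_sub_sq M t
    rw [← hTd] at this
    rw [← Real.sqrt_sq (norm_nonneg (slant M t - slant 0 T)), this, Real.sqrt_mul' _ (sq_nonneg _),
      Real.sqrt_sq hT0.le]
  have hb := norm_le_of_re_nonneg (z := slant M t) (hd.mono (ball_slant_subset hT1))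
    (fun w hw => hre w (ball_slant_subset hT1 hw)) (by
      rw [mem_ball, dist_eq_norm, e]; nlinarith)
  rw [e] at hb
  have hk : 0 < 1 - κ := by linarith
  simp only [Function.comp_apply]
  rw [norm_mul, norm_mul, Complex.norm_real, Complex.norm_real, Real.norm_of_nonneg ht.1.le,
    Real.norm_of_nonneg (by positivity : 0 ≤ (1 + M ^ 2) * t), ← hTd]
  calc t * ‖h (slant M t)‖ ≤ t * (‖h (slant 0 T)‖ * (T + κ * T) / (T - κ * T)) := by
        gcongr; exact ht.1.le
    _ = _ := by
      have : T - κ * T ≠ 0 := by nlinarith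
      rw [show T - κ * T = T * (1 - κ) by ring, show t = T / (1 + M ^ 2) by rw [hTd]; field_simp]
      field_simp

/-- The Julia–Carathéodory theorem along segments, for the function `1 - v` on the disc. -/
theorem tendsto_div_slant {v : ℂ → ℂ} {d : ℝ} (hd0 : 0 < d) (hv : DifferentiableOn ℂ v (ball 0 1))
    (hv0 : ∀ w ∈ ball (0 : ℂ) 1, v w ≠ 0)
    (hJ : ∀ w ∈ ball (0 : ℂ) 1,
      (1 - ‖w‖ ^ 2) * ‖v w‖ ^ 2 ≤ d * (1 - ‖1 - v w‖ ^ 2) * ‖1 - w‖ ^ 2)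
    (hL : ∀ c < d, 0 < c → ∀ᶠ t : ℝ in 𝓝[>] 0, c * t ≤ ‖v (slant 0 t)‖) (M : ℝ) :
    Tendsto (fun t : ℝ => v (slant M t) / t) (𝓝[>] 0) (𝓝 (d * (1 + M * Complex.I))) := by
  have sq_one_sub : ∀ x : ℂ, 1 - ‖1 - x‖ ^ 2 = 2 * x.re - ‖x‖ ^ 2 := fun x => by
    rw [Complex.sq_norm, Complex.sq_norm, Complex.normSq_apply, Complex.normSq_apply]
    simp; ring
  have hrad : Tendsto (fun t : ℝ => v (slant 0 t) / t) (𝓝[>] 0) (𝓝 (d : ℂ)) := by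
    rw [tendsto_iff_norm_sub_tendsto_zero]
    refine (tendsto_order.2 ⟨fun a ha => Eventually.of_forall fun t => ha.trans_le (norm_nonneg _),
      fun ε hε => ?_⟩)
    -- Put q = v/t. Julia gives (2 + (d − 1)t)|q|² ≤ 2d Re q, whence |q − d|² ≤ d² − (1 + (d −
    -- 1)t)|q|². Since |q| ≥ c eventually, c is taken close enough to d for the limiting bound d² −
    -- c² to be below ε².
    obtain ⟨c, hc0, hcd, hc⟩ : ∃ c, 0 < c ∧ c < d ∧ d ^ 2 - c ^ 2 < ε ^ 2 := by
      have : Tendsto (fun c : ℝ => d ^ 2 - c ^ 2) (𝓝[<] d) (𝓝 0) := by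
        apply Tendsto.mono_left _ nhdsWithin_le_nhds
        have : Continuous fun c : ℝ => d ^ 2 - c ^ 2 := by fun_prop
        simpa using this.tendsto d
      obtain ⟨c, h1, h2⟩ := ((this.eventually (gt_mem_nhds (by positivity : 0 < ε ^ 2))).and
        (Ioo_mem_nhdsLT hd0)).exists
      exact ⟨c, h2.1, h2.2, h1⟩
    have ht : Tendsto (fun t : ℝ => d ^ 2 - c ^ 2 * (1 + (d - 1) * t)) (𝓝[>] 0)
        (𝓝 (d ^ 2 - c ^ 2)) := by
      apply Tendsto.mono_left _ nhdsWithin_le_nhds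
      have : Continuous fun t : ℝ => d ^ 2 - c ^ 2 * (1 + (d - 1) * t) := by fun_prop
      simpa using this.tendsto 0
    filter_upwards [hL c hcd hc0, ht.eventually (gt_mem_nhds hc), eventually_small one_pos,
      eventually_norm_slant_lt 0] with t h1 h2 h3 h4
    have hj := hJ _ (mem_ball_zero_iff.2 h4)
    set q := v (slant 0 t) / (t : ℂ) with hq
    have htc : (t : ℂ) ≠ 0 := by exact_mod_cast h3.1.ne'
    have hvq : v (slant 0 t) = t * q := by rw [hq]; field_simp
    have hn : ‖1 - slant 0 t‖ = t := by
      simp [slant, abs_of_pos h3.1]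
    rw [one_sub_norm_sq_slant, sq_one_sub, hn, hvq, norm_mul, Complex.norm_real,
      Real.norm_of_nonneg h3.1.le, Complex.re_ofReal_mul] at hj
    rw [hvq, norm_mul, Complex.norm_real, Real.norm_of_nonneg h3.1.le] at h1
    have hcq : c ≤ ‖q‖ := by nlinarith
    have hj2 : (2 - t + d * t) * ‖q‖ ^ 2 ≤ 2 * d * q.re := by
      have : 0 < t ^ 3 := pow_pos h3.1 3
      refine le_of_mul_le_mul_left ?_ this
      nlinarith
    have e : ‖q - d‖ ^ 2 = ‖q‖ ^ 2 - 2 * d * q.re + d ^ 2 := by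
      rw [Complex.sq_norm, Complex.sq_norm, Complex.normSq_apply, Complex.normSq_apply]
      simp; ring
    have hlt : ‖q - d‖ ^ 2 < ε ^ 2 := by
      have : c ^ 2 ≤ ‖q‖ ^ 2 := pow_le_pow_left₀ hc0.le hcq 2
      have h5 : 0 < 1 + (d - 1) * t := by nlinarith
      nlinarith [mul_le_mul_of_nonneg_right this h5.le]
    exact lt_of_pow_lt_pow_left₀ 2 hε.le hlt
  have hdc : (d : ℂ) ≠ 0 := by exact_mod_cast hd0.ne'
  -- With u = 1 − v, the first term is the Cayley transform (1 + u)/(1 − u). Julia's inequality says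
  -- exactly that its real part dominates that of the subtracted term.
  set h : ℂ → ℂ := fun w => (2 - v w) / v w - (1 / d) * ((1 + w) / (1 - w)) with hh
  have hw1 : ∀ w ∈ ball (0 : ℂ) 1, 1 - w ≠ 0 := fun w hw h => by
    rw [← sub_eq_zero.1 h] at hw; simp at hw
  have hhd : DifferentiableOn ℂ h (ball 0 1) := by
    refine ((hv.const_sub 2).div hv hv0).sub (DifferentiableOn.const_mul
      (DifferentiableOn.div (by fun_prop) (by fun_prop) hw1) _)
  have re_div : ∀ x y : ℂ, (x / y).re = (x * star y).re / ‖y‖ ^ 2 := fun x y => by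
    rw [Complex.sq_norm, Complex.div_re]
    simp; ring
  have hhre : ∀ w ∈ ball (0 : ℂ) 1, 0 ≤ (h w).re := by
    intro w hw
    have a1 : 0 < ‖v w‖ ^ 2 := pow_pos (norm_pos_iff.2 (hv0 w hw)) 2
    have a2 : 0 < ‖1 - w‖ ^ 2 := pow_pos (norm_pos_iff.2 (hw1 w hw)) 2
    have e1 : ((2 - v w) / v w).re = (1 - ‖1 - v w‖ ^ 2) / ‖v w‖ ^ 2 := by
      rw [re_div, sq_one_sub, Complex.sq_norm, Complex.normSq_apply]
      simp; ring
    have e2 : ((1 + w) / (1 - w)).re = (1 - ‖w‖ ^ 2) / ‖1 - w‖ ^ 2 := by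
      rw [re_div, Complex.sq_norm w, Complex.normSq_apply w]
      simp; ring
    have e3 : (1 / (d : ℂ)) = ((1 / d : ℝ) : ℂ) := by push_cast; rfl
    have hj := hJ w hw
    simp only [hh, Complex.sub_re, e3, Complex.re_ofReal_mul, e1, e2]
    rw [sub_nonneg, div_mul_div_comm, div_le_div_iff₀ (by positivity) a1]
    linarith
  have h0 : Tendsto (fun t : ℝ => t * h (slant 0 t)) (𝓝[>] 0) (𝓝 0) := by
    have htc : Tendsto (fun t : ℝ => (t : ℂ)) (𝓝[>] 0) (𝓝 0) := by
      apply Tendsto.mono_left _ nhdsWithin_le_nhds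
      simpa using Complex.continuous_ofReal.tendsto 0
    have h1 : Tendsto (fun t : ℝ => (2 - t * (v (slant 0 t) / t)) / (v (slant 0 t) / t)
        - (1 / d) * (2 - t)) (𝓝[>] 0) (𝓝 ((2 - 0 * d) / (d : ℂ) - (1 / d) * (2 - 0))) :=
      ((tendsto_const_nhds.sub (htc.mul hrad)).div hrad hdc).sub
        (tendsto_const_nhds.mul (tendsto_const_nhds.sub htc))
    have h2 : (2 - 0 * d) / (d : ℂ) - (1 / d) * (2 - 0) = 0 := by ring
    rw [h2] at h1
    refine h1.congr' ?_
    filter_upwards [self_mem_nhdsWithin, eventually_norm_slant_lt 0] with t ht hs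
    have htc : (t : ℂ) ≠ 0 := by exact_mod_cast (ne_of_gt ht)
    have hvt := hv0 _ (mem_ball_zero_iff.2 hs)
    have e1 : 1 - slant 0 t = t := by simp [slant]
    have e2 : 1 + slant 0 t = 2 - t := by simp [slant]; ring
    simp only [hh]
    rw [e1, e2]
    field_simp
  have hM0 : (1 + (M : ℂ) * Complex.I) ≠ 0 := by
    intro h
    have := congrArg Complex.re h
    simp at this
  have hlim := tendsto_mul_slant_of_re_nonneg hhd hhre h0 M
  have htc : Tendsto (fun t : ℝ => (t : ℂ)) (𝓝[>] 0) (𝓝 0) := by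
    apply Tendsto.mono_left _ nhdsWithin_le_nhds
    simpa using Complex.continuous_ofReal.tendsto 0
  -- On the segment the expression inside equals t/v: adding back the subtracted Cayley transform
  -- gives t(2 − v)/v, adding t gives 2t/v, and halving finishes. The limit of v/t follows by
  -- inversion.
  have h1 : Tendsto (fun t : ℝ => (t * h (slant M t) + (1 / d) * ((1 + slant M t) /
      (1 + (M : ℂ) * Complex.I)) + t) / 2) (𝓝[>] 0)
      (𝓝 ((0 + (1 / d) * ((1 + 1) / (1 + (M : ℂ) * Complex.I)) + 0) / 2)) :=
    ((hlim.add (tendsto_const_nhds.mul ((tendsto_const_nhds.add (tendsto_slant M)).div_const _))).add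
      htc).div_const _
  have h2 : (0 + (1 / d) * ((1 + 1) / (1 + (M : ℂ) * Complex.I)) + 0) / 2 =
      ((d : ℂ) * (1 + M * Complex.I))⁻¹ := by
    field_simp; ring
  rw [h2] at h1
  have h3 := h1.inv₀ (inv_ne_zero (mul_ne_zero hdc hM0))
  rw [inv_inv] at h3
  refine h3.congr' ?_
  filter_upwards [self_mem_nhdsWithin, eventually_norm_slant_lt M] with t ht hs
  have htc : (t : ℂ) ≠ 0 := by exact_mod_cast (ne_of_gt ht)
  have hvt := hv0 _ (mem_ball_zero_iff.2 hs)
  have e1 : 1 - slant M t = t * (1 + (M : ℂ) * Complex.I) := by simp [slant]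
  rw [← inv_div]
  have e2 : (t : ℂ) * h (slant M t) + (1 / d) * ((1 + slant M t) / (1 + (M : ℂ) * Complex.I)) =
      t * ((2 - v (slant M t)) / v (slant M t)) := by
    simp only [hh]
    rw [e1, mul_sub, show (t : ℂ) * (1 / d * ((1 + slant M t) / (t * (1 + (M : ℂ) * Complex.I)))) =
      1 / d * ((1 + slant M t) / (1 + (M : ℂ) * Complex.I)) by field_simp]
    ring
  rw [e2]
  field_simp
  ring

end BallCompOp

namespace BallCompOp

/-! ### Boundary behaviour of self-maps of the ball along slanted segments -/

variable {N : ℕ}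

theorem norm_slant_smul {ζ : Cn N} (hζ : ‖ζ‖ = 1) (M t : ℝ) :
    ‖slant M t • ζ‖ = ‖slant M t‖ := by rw [norm_smul, hζ, mul_one]

theorem tendsto_slant_smul {ζ : Cn N} (hζ : ‖ζ‖ = 1) (M : ℝ) :
    Tendsto (fun t => slant M t • ζ) (𝓝[>] 0) (𝓝[unitBall N] ζ) := by
  refine tendsto_nhdsWithin_iff.2 ⟨?_, ?_⟩
  · simpa using (tendsto_slant M).smul_const ζ
  · filter_upwards [eventually_norm_slant_lt M] with t ht
    rwa [mem_ball_zero_iff, norm_slant_smul hζ]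

theorem norm_slant_zero {t : ℝ} (ht : t ≤ 1) : ‖slant 0 t‖ = 1 - t := by
  have : slant 0 t = ((1 - t : ℝ) : ℂ) := by simp [slant]
  rw [this, Complex.norm_real, Real.norm_of_nonneg (by linarith)]

theorem one_sub_norm_sq_le_two_mul_re {η x : Cn N} (hη : ‖η‖ = 1) :
    1 - ‖x‖ ^ 2 ≤ 2 * (1 - inner ℂ η x : ℂ).re := by
  have h := norm_inner_le_norm (𝕜 := ℂ) η x
  rw [hη, one_mul] at h
  have h1 : ‖(inner ℂ η x : ℂ)‖ ^ 2 ≤ ‖x‖ ^ 2 := pow_le_pow_left₀ (norm_nonneg _) h 2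
  rw [Complex.sq_norm, Complex.normSq_apply] at h1
  simp only [Complex.sub_re, Complex.one_re]
  nlinarith [sq_nonneg (1 - (inner ℂ η x : ℂ).re), sq_nonneg (inner ℂ η x : ℂ).im]

theorem norm_sub_sq_le_two_mul_re {η x : Cn N} (hη : ‖η‖ = 1) (hx : ‖x‖ ≤ 1) :
    ‖η - x‖ ^ 2 ≤ 2 * (1 - inner ℂ η x : ℂ).re := by
  rw [@norm_sub_sq ℂ, hη]
  simp only [RCLike.re_to_complex, Complex.sub_re, Complex.one_re]
  nlinarith [norm_nonneg x]

/-- By Pythagoras the left side is |x|² − |⟨x, η⟩|² ≤ 1 − |⟨x, η⟩|². It makes the part of φ(z)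
orthogonal to η of order √t. -/
theorem norm_sub_inner_smul_sq_le {η x : Cn N} (hη : ‖η‖ = 1) (hx : ‖x‖ ≤ 1) :
    ‖x - (inner ℂ η x : ℂ) • η‖ ^ 2 ≤ 2 * (1 - inner ℂ η x : ℂ).re := by
  rw [@norm_sub_sq ℂ, norm_smul, hη, mul_one, inner_smul_right, ← inner_conj_symm x η,
    Complex.mul_conj, Complex.sq_norm (inner ℂ η x : ℂ), Complex.normSq_apply]
  simp only [RCLike.re_to_complex, Complex.sub_re, Complex.one_re, Complex.ofReal_re]
  nlinarith [norm_nonneg x, sq_nonneg (1 - (inner ℂ η x : ℂ).re), sq_nonneg (inner ℂ η x : ℂ).im]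

theorem inner_sub_conj_mul {η x y : Cn N} (hη : ‖η‖ = 1) :
    inner ℂ (x - (inner ℂ η x : ℂ) • η) (y - (inner ℂ η y : ℂ) • η) =
      inner ℂ x y - (starRingEnd ℂ) (inner ℂ η x) * inner ℂ η y := by
  rw [inner_sub_left, inner_sub_right, inner_sub_right, inner_smul_left, inner_smul_left,
    inner_smul_right, inner_smul_right, inner_self_ofReal, hη, ← inner_conj_symm x η]
  push_cast
  ring

/-- Lower bound for `|1 - ⟨y, x⟩|` in terms of the components along a unit vector. -/
theorem le_norm_one_sub_inner {η x y : Cn N} (hη : ‖η‖ = 1) (hx : ‖x‖ ≤ 1) (hy : ‖y‖ ≤ 1) :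
    ‖(1 : ℂ) - (starRingEnd ℂ) (inner ℂ η x) * inner ℂ η y‖
      - √(2 * (1 - inner ℂ η x : ℂ).re) * √(2 * (1 - inner ℂ η y : ℂ).re) ≤
      ‖(1 : ℂ) - inner ℂ x y‖ := by
  have h1 := norm_inner_le_norm (𝕜 := ℂ) (x - (inner ℂ η x : ℂ) • η) (y - (inner ℂ η y : ℂ) • η)
  rw [inner_sub_conj_mul hη] at h1
  have h2 := Real.le_sqrt_of_sq_le (norm_sub_inner_smul_sq_le hη hx)
  have h3 := Real.le_sqrt_of_sq_le (norm_sub_inner_smul_sq_le hη hy)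
  have h4 := h1.trans (mul_le_mul h2 h3 (norm_nonneg _) (Real.sqrt_nonneg _))
  have h5 := norm_add_le ((1 : ℂ) - inner ℂ x y)
    (inner ℂ x y - (starRingEnd ℂ) (inner ℂ η x) * inner ℂ η y)
  rw [sub_add_sub_cancel] at h5
  linarith

/-- The Julia–Carathéodory theorem for self-maps of the ball, along segments. -/
theorem exists_tendsto_one_sub_inner_div {φ : Cn N → Cn N} (hφ : IsAnalyticSelfMap φ) {ζ : Cn N}
    (hd : dCoeff φ ζ ≠ ∞) (hζ : ‖ζ‖ = 1) : ∃ η : Cn N, ‖η‖ = 1 ∧ ∀ M : ℝ,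
      Tendsto (fun t : ℝ => (1 - inner ℂ η (φ (slant M t • ζ)) : ℂ) / t) (𝓝[>] 0)
        (𝓝 ((dCoeff φ ζ).toReal * (1 + M * Complex.I))) := by
  obtain ⟨η, hη, hJ⟩ := exists_julia hφ hd hζ
  refine ⟨η, hη, fun M => ?_⟩
  have hd0 : 0 < (dCoeff φ ζ).toReal := ENNReal.toReal_pos (dCoeff_ne_zero hφ ζ) hd
  have hmaps : MapsTo (fun w : ℂ => w • ζ) (ball 0 1) (unitBall N) := fun w hw => by
    rw [mem_ball_zero_iff] at hw ⊢
    rwa [norm_smul, hζ, mul_one]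
  have hinner : Differentiable ℂ fun z : Cn N => (inner ℂ η z : ℂ) := (innerSL ℂ η).differentiable
  refine tendsto_div_slant (v := fun w => 1 - inner ℂ η (φ (w • ζ))) hd0 ?_ ?_ ?_ ?_ M
  · exact (hinner.comp_differentiableOn (hφ.1.comp (by fun_prop) hmaps)).const_sub 1
  · intro w hw h
    have h1 := hφ.norm_lt_one (mem_ball_zero_iff.1 (hmaps hw))
    have h2 := norm_inner_le_norm (𝕜 := ℂ) η (φ (w • ζ))
    rw [← sub_eq_zero.1 h, hη, norm_one, one_mul] at h2
    linarith
  · intro w hw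
    have hw1 := mem_ball_zero_iff.1 (hmaps hw)
    refine (le_of_eq ?_).trans ((hJ (w • ζ) hw1).trans ?_)
    · rw [norm_smul, hζ, mul_one]
    · rw [inner_smul_right, inner_self_ofReal, hζ, sub_sub_cancel]
      have h2 := norm_inner_le_norm (𝕜 := ℂ) η (φ (w • ζ))
      rw [hη, one_mul] at h2
      have h3 := pow_le_pow_left₀ (norm_nonneg _) h2 2
      simp only [one_pow, Complex.ofReal_one, mul_one]
      gcongr
  · intro c hcd hc
    have hlt : ENNReal.ofReal c < dCoeff φ ζ := by
      rw [← ENNReal.ofReal_toReal hd]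
      exact (ENNReal.ofReal_lt_ofReal_iff hd0).2 hcd
    filter_upwards [(tendsto_slant_smul hζ 0).eventually (eventually_mul_lt_of_lt_dCoeff hc.le hlt),
      eventually_small one_pos] with t h1 h2
    rw [norm_slant_smul hζ, norm_slant_zero h2.2.le, sub_sub_cancel] at h1
    exact h1.le.trans (one_sub_norm_le_norm_one_sub_inner hη.le)

theorem tendsto_of_one_sub_inner_div {φ : Cn N → Cn N} (hφ : IsAnalyticSelfMap φ) {ζ η : Cn N}
    (hζ : ‖ζ‖ = 1) (hη : ‖η‖ = 1) {L : ℂ} {M : ℝ}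
    (h : Tendsto (fun t : ℝ => (1 - inner ℂ η (φ (slant M t • ζ)) : ℂ) / t) (𝓝[>] 0) (𝓝 L)) :
    Tendsto (fun t => φ (slant M t • ζ)) (𝓝[>] 0) (𝓝 η) := by
  have htc : Tendsto (fun t : ℝ => (t : ℂ)) (𝓝[>] 0) (𝓝 0) := by
    apply Tendsto.mono_left _ nhdsWithin_le_nhds
    simpa using Complex.continuous_ofReal.tendsto 0
  have h1 := (Complex.continuous_re.tendsto _).comp ((htc.mul h).const_mul 2)
  simp only [zero_mul, mul_zero, Complex.zero_re] at h1
  have h2 : Tendsto (fun t => ‖η - φ (slant M t • ζ)‖ ^ 2) (𝓝[>] 0) (𝓝 0) := by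
    refine squeeze_zero' (Eventually.of_forall fun t => sq_nonneg _) ?_ h1
    filter_upwards [eventually_norm_slant_lt M, self_mem_nhdsWithin] with t ht ht0
    have htc : (t : ℂ) ≠ 0 := by exact_mod_cast (ne_of_gt ht0)
    have hz : ‖φ (slant M t • ζ)‖ ≤ 1 := (hφ.norm_lt_one (by rwa [norm_slant_smul hζ])).le
    refine (norm_sub_sq_le_two_mul_re hη hz).trans (le_of_eq ?_)
    simp only [Function.comp_apply]
    rw [mul_div_cancel₀ _ htc]
    simp
  have h3 : Tendsto (fun t => ‖η - φ (slant M t • ζ)‖) (𝓝[>] 0) (𝓝 0) := by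
    simpa [Real.sqrt_sq] using h2.sqrt
  rw [tendsto_iff_norm_sub_tendsto_zero]
  simpa [norm_sub_rev] using h3

/-- Since Re(1 + iM) = 1, the slope drops out: the left side is at most 2 Re(1 − ⟨φ, η⟩) ~ 2dt,
while 1 − |z|² ~ 2t. -/
theorem eventually_one_sub_norm_sq_le {φ : Cn N → Cn N} {ζ η : Cn N}
    (hζ : ‖ζ‖ = 1) (hη : ‖η‖ = 1) {d M : ℝ}
    (h : Tendsto (fun t : ℝ => (1 - inner ℂ η (φ (slant M t • ζ)) : ℂ) / t) (𝓝[>] 0)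
      (𝓝 (d * (1 + M * Complex.I)))) {ε : ℝ} (hε : 0 < ε) :
    ∀ᶠ t in 𝓝[>] 0, 1 - ‖φ (slant M t • ζ)‖ ^ 2 ≤ (d + ε) * (1 - ‖slant M t • ζ‖ ^ 2) := by
  have h1 := (Complex.continuous_re.tendsto _).comp h
  have h2 : Tendsto (fun t : ℝ => (d + ε) * (2 - (1 + M ^ 2) * t)) (𝓝[>] 0) (𝓝 ((d + ε) * 2)) := by
    apply Tendsto.mono_left _ nhdsWithin_le_nhds
    have : Continuous fun t : ℝ => (d + ε) * (2 - (1 + M ^ 2) * t) := by fun_prop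
    simpa using this.tendsto 0
  have h3 := (h1.const_mul 2).eventually_lt h2 (by simp; linarith)
  filter_upwards [h3, self_mem_nhdsWithin] with t h3 ht
  have ht0 : 0 < t := ht
  rw [norm_slant_smul hζ, one_sub_norm_sq_slant]
  refine (one_sub_norm_sq_le_two_mul_re hη).trans ?_
  simp only [Function.comp_apply, Complex.div_ofReal_re] at h3
  rw [mul_div_assoc', div_lt_iff₀ ht0] at h3
  linarith

theorem tendsto_radial_of_slant {φ : Cn N → Cn N} {ζ η : Cn N}
    (h : Tendsto (fun t => φ (slant 0 t • ζ)) (𝓝[>] 0) (𝓝 η)) :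
    Tendsto (fun r : ℝ => φ (r • ζ)) (𝓝[<] 1) (𝓝 η) := by
  have h1 : Tendsto (fun r : ℝ => 1 - r) (𝓝[<] 1) (𝓝[>] 0) := by
    refine tendsto_nhdsWithin_iff.2 ⟨?_, ?_⟩
    · apply Tendsto.mono_left _ nhdsWithin_le_nhds
      have : Continuous fun r : ℝ => 1 - r := by fun_prop
      simpa using this.tendsto 1
    · filter_upwards [self_mem_nhdsWithin] with r hr using sub_pos.2 (mem_Iio.1 hr)
  refine (h.comp h1).congr fun r => ?_
  simp only [Function.comp_apply]
  congr 1
  have : slant 0 (1 - r) = (r : ℂ) := by simp [slant]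
  rw [this]
  exact Complex.coe_smul r ζ

/-- Different boundary data make `φ` and `ψ` hyperbolically far apart along some segment, on which
`φ` realises its angular derivative. -/
theorem exists_slant_separated {φ ψ : Cn N → Cn N} (hφ : IsAnalyticSelfMap φ)
    (hψ : IsAnalyticSelfMap ψ) {ζ : Cn N} (hζ : ‖ζ‖ = 1) (hd : dCoeff φ ζ ≠ ∞)
    (hne : ¬ (SameRadialLimit φ ψ ζ ∧ dCoeff ψ ζ = dCoeff φ ζ)) {ε : ℝ} (hε : 0 < ε) :
    ∃ M : ℝ, ∀ᶠ t in 𝓝[>] 0,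
      1 - ‖φ (slant M t • ζ)‖ ^ 2 ≤ ((dCoeff φ ζ).toReal + ε) * (1 - ‖slant M t • ζ‖ ^ 2) ∧
      1 - ‖slant M t • ζ‖ ^ 2 ≤
        ε * ‖(1 : ℂ) - inner ℂ (φ (slant M t • ζ)) (ψ (slant M t • ζ))‖ := by
  obtain ⟨η, hη, hη1⟩ := exists_tendsto_one_sub_inner_div hφ hd hζ
  have tφ := fun M => tendsto_of_one_sub_inner_div hφ hζ hη (hη1 M)
  have hball : ∀ M, ∀ᶠ t in 𝓝[>] 0, ‖slant M t • ζ‖ < 1 := fun M => by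
    simpa only [norm_slant_smul hζ] using eventually_norm_slant_lt M
  by_cases hψd : dCoeff ψ ζ = ∞
  · refine ⟨0, (eventually_one_sub_norm_sq_le hζ hη (hη1 0) hε).and ?_⟩
    -- The 2 pays for 1 − |z|² ≤ 2(1 − |z|).
    have hlt : ENNReal.ofReal (2 / ε) < dCoeff ψ ζ := by rw [hψd]; exact ENNReal.ofReal_lt_top
    filter_upwards [hball 0, (tendsto_slant_smul hζ 0).eventually
      (eventually_mul_lt_of_lt_dCoeff (by positivity) hlt)] with t h1 h2
    have h3 := h2.le.trans (one_sub_norm_le_norm_one_sub_inner (z := ψ (slant 0 t • ζ))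
      (hφ.norm_lt_one h1).le)
    rw [div_mul_eq_mul_div, div_le_iff₀ hε] at h3
    nlinarith [norm_nonneg (slant 0 t • ζ)]
  obtain ⟨ω, hω, hω1⟩ := exists_tendsto_one_sub_inner_div hψ hψd hζ
  have tψ := fun M => tendsto_of_one_sub_inner_div hψ hζ hω (hω1 M)
  by_cases hηω : η = ω
  · subst hηω
    have hdne : dCoeff ψ ζ ≠ dCoeff φ ζ := fun h => hne
      ⟨⟨η, tendsto_radial_of_slant (tφ 0), tendsto_radial_of_slant (tψ 0)⟩, h⟩
    set d₁ := (dCoeff φ ζ).toReal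
    set d₂ := (dCoeff ψ ζ).toReal
    have hd12 : d₂ - d₁ ≠ 0 := fun h => hdne <|
      (ENNReal.toReal_eq_toReal_iff' hψd hd).1 (sub_eq_zero.1 h)
    -- The limit inferior of |1 − ⟨ψ, φ⟩|/t is at least |(d₂ − d₁)M| − √(2d₁)√(2d₂). It has to
    -- exceed 2/ε because 1 − |z|² ≤ 2t; the summand 1 makes this strict, and the sign of M follows
    -- that of d₂ − d₁.
    obtain ⟨M, hM⟩ : ∃ M : ℝ, (d₂ - d₁) * M = 2 / ε + √(2 * d₁) * √(2 * d₂) + 1 :=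
      ⟨(2 / ε + √(2 * d₁) * √(2 * d₂) + 1) / (d₂ - d₁), mul_div_cancel₀ _ hd12⟩
    refine ⟨M, (eventually_one_sub_norm_sq_le hζ hη (hη1 M) hε).and ?_⟩
    have t1 := hη1 M
    have t2 := hω1 M
    set q₁ : ℝ → ℂ := fun t => (1 - inner ℂ η (φ (slant M t • ζ)) : ℂ) / t with hq₁
    set q₂ : ℝ → ℂ := fun t => (1 - inner ℂ η (ψ (slant M t • ζ)) : ℂ) / t with hq₂
    have htc : Tendsto (fun t : ℝ => (t : ℂ)) (𝓝[>] 0) (𝓝 0) := by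
      apply Tendsto.mono_left _ nhdsWithin_le_nhds
      simpa using Complex.continuous_ofReal.tendsto 0
    have t1c := (Complex.continuous_conj.tendsto _).comp t1
    -- With 1 − ⟨φ, η⟩ = t q₁ and 1 − ⟨ψ, η⟩ = t q₂, every term of `le_norm_one_sub_inner` carries a
    -- factor t; this is the limit of what remains.
    have tlim : Tendsto (fun t : ℝ => ‖(starRingEnd ℂ) (q₁ t) + q₂ t -
        t * ((starRingEnd ℂ) (q₁ t) * q₂ t)‖ - √(2 * (q₁ t).re) * √(2 * (q₂ t).re)) (𝓝[>] 0)
        (𝓝 (‖(starRingEnd ℂ) ((d₁ : ℂ) * (1 + M * Complex.I)) + d₂ * (1 + M * Complex.I) -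
          0 * ((starRingEnd ℂ) ((d₁ : ℂ) * (1 + M * Complex.I)) * (d₂ * (1 + M * Complex.I)))‖ -
          √(2 * ((d₁ : ℂ) * (1 + M * Complex.I)).re) *
            √(2 * ((d₂ : ℂ) * (1 + M * Complex.I)).re))) :=
      ((t1c.add t2).sub (htc.mul (t1c.mul t2))).norm.sub
        ((((Complex.continuous_re.tendsto _).comp t1).const_mul 2).sqrt.mul
        (((Complex.continuous_re.tendsto _).comp t2).const_mul 2).sqrt)
    have hgt : 2 / ε < ‖(starRingEnd ℂ) ((d₁ : ℂ) * (1 + M * Complex.I)) +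
        d₂ * (1 + M * Complex.I) -
          0 * ((starRingEnd ℂ) ((d₁ : ℂ) * (1 + M * Complex.I)) * (d₂ * (1 + M * Complex.I)))‖ -
          √(2 * ((d₁ : ℂ) * (1 + M * Complex.I)).re) *
            √(2 * ((d₂ : ℂ) * (1 + M * Complex.I)).re) := by
      have e1 : ((d₁ : ℂ) * (1 + M * Complex.I)).re = d₁ := by simp
      have e2 : ((d₂ : ℂ) * (1 + M * Complex.I)).re = d₂ := by simp
      rw [e1, e2, zero_mul, sub_zero]
      have h1 := Complex.abs_im_le_norm ((starRingEnd ℂ) ((d₁ : ℂ) * (1 + M * Complex.I)) +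
        d₂ * (1 + M * Complex.I))
      have e3 : ((starRingEnd ℂ) ((d₁ : ℂ) * (1 + M * Complex.I)) +
        d₂ * (1 + M * Complex.I)).im = (d₂ - d₁) * M := by simp; ring
      rw [e3] at h1
      linarith [le_abs_self ((d₂ - d₁) * M)]
    filter_upwards [hball M, self_mem_nhdsWithin, tlim.eventually (lt_mem_nhds hgt)] with t hb ht hl
    have ht0 : 0 < t := ht
    have htc : (t : ℂ) ≠ 0 := by exact_mod_cast ht0.ne'
    have hle := le_norm_one_sub_inner hη (hφ.norm_lt_one hb).le (hψ.norm_lt_one hb).le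
    have e1 : (1 - inner ℂ η (φ (slant M t • ζ)) : ℂ) = t * q₁ t := by simp only [hq₁]; field_simp
    have e2 : (1 - inner ℂ η (ψ (slant M t • ζ)) : ℂ) = t * q₂ t := by simp only [hq₂]; field_simp
    have e1' : (inner ℂ η (φ (slant M t • ζ)) : ℂ) = 1 - t * q₁ t := by rw [← e1]; ring
    have e2' : (inner ℂ η (ψ (slant M t • ζ)) : ℂ) = 1 - t * q₂ t := by rw [← e2]; ring
    have e3 : (1 : ℂ) - (starRingEnd ℂ) (1 - t * q₁ t) * (1 - t * q₂ t) =
        t * ((starRingEnd ℂ) (q₁ t) + q₂ t - t * ((starRingEnd ℂ) (q₁ t) * q₂ t)) := by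
      simp only [map_sub, map_mul, map_one, Complex.conj_ofReal]; ring
    rw [e1, e2, e1', e2', e3, norm_mul, Complex.norm_real, Real.norm_of_nonneg ht0.le,
      Complex.re_ofReal_mul, Complex.re_ofReal_mul, mul_left_comm 2 t (q₁ t).re,
      mul_left_comm 2 t (q₂ t).re,
      Real.sqrt_mul ht0.le, Real.sqrt_mul ht0.le, mul_mul_mul_comm, Real.mul_self_sqrt ht0.le,
      ← mul_sub] at hle
    rw [norm_slant_smul hζ, one_sub_norm_sq_slant]
    have h5 := mul_lt_mul_of_pos_left hl ht0
    have h6 := h5.trans_le hle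
    rw [mul_div_assoc', div_lt_iff₀ hε] at h6
    nlinarith [mul_nonneg (sq_nonneg t) (by positivity : 0 ≤ 1 + M ^ 2)]
  -- Distinct unit limits: 1 − ⟨ψ, φ⟩ tends to 1 − ⟨ω, η⟩ ≠ 0 while 1 − |z|² → 0.
  · refine ⟨0, (eventually_one_sub_norm_sq_le hζ hη (hη1 0) hε).and ?_⟩
    have hpos : 0 < ‖(1 : ℂ) - inner ℂ η ω‖ := by
      rw [norm_pos_iff, sub_ne_zero]
      exact fun h => hηω ((inner_eq_one_iff_of_norm_eq_one hη hω).1 h.symm)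
    have t1 : Tendsto (fun t => ε * ‖(1 : ℂ) - inner ℂ (φ (slant 0 t • ζ)) (ψ (slant 0 t • ζ))‖)
        (𝓝[>] 0) (𝓝 (ε * ‖(1 : ℂ) - inner ℂ η ω‖)) :=
      (tendsto_const_nhds.sub ((tφ 0).inner (tψ 0))).norm.const_mul ε
    have t2 : Tendsto (fun t => 1 - ‖slant 0 t • ζ‖ ^ 2) (𝓝[>] 0) (𝓝 0) := by
      have h := ((tendsto_nhdsWithin_iff.1 (tendsto_slant_smul hζ 0)).1.norm.pow 2).const_sub 1
      simpa [hζ] using h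
    filter_upwards [t2.eventually_lt t1 (by positivity)] with t h using h.le

end BallCompOp

namespace BallCompOp

/-! ### Essential norms of differences of composition operators -/

variable {N : ℕ}

/-- Sharp pointwise bounds for a space of holomorphic functions on the ball, together with the test
functions `(1 - ⟨·, a⟩) ^ (-β)` attaining them. -/
structure HasPowerKernel (p : HoloENorm N) (β : ℝ) : Prop where
  pos : 0 < β
  eval_le : ∀ ζ : Cn N, ‖ζ‖ = 1 → ∀ (f : HoloSpace p) (w : ℂ), ‖w‖ < 1 →
    (1 - ‖w‖ ^ 2) ^ (β / 2) * ‖f.toFun (w • ζ)‖ ≤ ‖f‖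
  eval_tendsto : ∀ ζ : Cn N, ‖ζ‖ = 1 → ∀ f : HoloSpace p,
    Tendsto (fun w : ℂ => (1 - ‖w‖ ^ 2) ^ (β / 2) * ‖f.toFun (w • ζ)‖) (comap norm (𝓝[<] 1)) (𝓝 0)
  exists_kernel : ∀ a : Cn N, ‖a‖ < 1 → ∃ f : HoloSpace p,
    (∀ z : Cn N, ‖z‖ < 1 → f.toFun z = (1 - inner ℂ a z) ^ (-(β : ℂ))) ∧
    ‖f‖ ≤ (1 - ‖a‖ ^ 2) ^ (-(β / 2))

theorem tendsto_slant_norm (M : ℝ) : Tendsto (slant M) (𝓝[>] 0) (comap norm (𝓝[<] 1)) := by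
  refine tendsto_comap_iff.2 (tendsto_nhdsWithin_iff.2 ⟨?_, eventually_norm_slant_lt M⟩)
  simpa [Function.comp_def] using (tendsto_slant M).norm

theorem HoloSpace.toFun_sub {p : HoloENorm N} (f g : HoloSpace p) (z : Cn N) :
    (f - g).toFun z = f.toFun z - g.toFun z := rfl

/-- A compact operator is uniformly small at normalised evaluations near the boundary. -/
theorem HasPowerKernel.eventually_compact_le {p : HoloENorm N} {β : ℝ} (hp : HasPowerKernel p β)
    {K : HoloSpace p →L[ℂ] HoloSpace p} (hK : IsCompactOperator K) {ζ : Cn N} (hζ : ‖ζ‖ = 1)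
    {ε : ℝ} (hε : 0 < ε) : ∀ᶠ w : ℂ in comap norm (𝓝[<] 1), ∀ f : HoloSpace p,
      (1 - ‖w‖ ^ 2) ^ (β / 2) * ‖(K f).toFun (w • ζ)‖ ≤ ε * ‖f‖ := by
  have hc : IsCompact (closure (K '' closedBall 0 1)) :=
    IsCompactOperator.isCompact_closure_image_closedBall
      (f := (K : HoloSpace p →ₗ[ℂ] HoloSpace p)) hK 1
  -- A finite ε/2-net for the image of the unit ball: the normalized evaluation is small on the
  -- finitely many centres, and being of norm at most 1 it adds at most ε/2 elsewhere.
  obtain ⟨s, hs, hcov⟩ := Metric.totallyBounded_iff.1 hc.totallyBounded (ε / 2) (by positivity)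
  have hnorm : ∀ᶠ w : ℂ in comap norm (𝓝[<] 1), ‖w‖ < 1 :=
    tendsto_comap.eventually self_mem_nhdsWithin
  have hsmall : ∀ᶠ w : ℂ in comap norm (𝓝[<] 1), ∀ g ∈ s,
      (1 - ‖w‖ ^ 2) ^ (β / 2) * ‖g.toFun (w • ζ)‖ < ε / 2 :=
    (eventually_all_finite hs).2 fun g _ =>
      (hp.eval_tendsto ζ hζ g).eventually (gt_mem_nhds (by positivity))
  filter_upwards [hnorm, hsmall] with w hw hg
  have hw0 : 0 ≤ (1 - ‖w‖ ^ 2) ^ (β / 2) := Real.rpow_nonneg (one_sub_norm_sq_pos hw).le _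
  have hunit : ∀ f : HoloSpace p, ‖f‖ ≤ 1 →
      (1 - ‖w‖ ^ 2) ^ (β / 2) * ‖(K f).toFun (w • ζ)‖ ≤ ε := by
    intro f hf
    have hm := hcov (subset_closure (mem_image_of_mem K (mem_closedBall_zero_iff.2 hf)))
    obtain ⟨g, hgs, hgK⟩ := mem_iUnion₂.1 hm
    rw [mem_ball, dist_eq_norm] at hgK
    have h1 := hp.eval_le ζ hζ (K f - g) w hw
    rw [HoloSpace.toFun_sub] at h1
    have h2 := hg g hgs
    have h3 := norm_le_norm_sub_add ((K f).toFun (w • ζ)) (g.toFun (w • ζ))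
    have h4 := mul_le_mul_of_nonneg_left h3 hw0
    rw [mul_add] at h4
    linarith
  intro f
  rcases eq_or_ne f 0 with rfl | hf
  · rw [map_zero, norm_zero, mul_zero]
    have : (0 : HoloSpace p).toFun (w • ζ) = 0 := rfl
    rw [this, norm_zero, mul_zero]
  · have hf0 : 0 < ‖f‖ := norm_pos_iff.2 hf
    have h := hunit (((‖f‖⁻¹ : ℝ) : ℂ) • f) (by
      rw [norm_smul, Complex.norm_real, norm_inv, norm_norm, inv_mul_cancel₀ hf0.ne'])
    rw [map_smul] at h
    have e : ((((‖f‖⁻¹ : ℝ) : ℂ) • K f).toFun (w • ζ)) =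
      ((‖f‖⁻¹ : ℝ) : ℂ) * (K f).toFun (w • ζ) := rfl
    rw [e, norm_mul, Complex.norm_real, norm_inv, norm_norm, mul_left_comm, inv_mul_le_iff₀ hf0] at h
    linarith

/-- T is applied to the kernel at φ(z) and evaluated at z. Normalization turns the value at φ(z)
into the main term ((1 − |z|²)/(1 − |φ(z)|²))^(β/2); the other contributions are errors. -/
theorem HasPowerKernel.le_norm_sub {p : HoloENorm N} {β : ℝ} (hp : HasPowerKernel p β)
    {φ ψ : Cn N → Cn N} (hφ : IsAnalyticSelfMap φ) (hψ : IsAnalyticSelfMap ψ)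
    (bφ : InducesBounded p φ) (bψ : InducesBounded p ψ)
    {ζ : Cn N} (hζ : ‖ζ‖ = 1) (hd : dCoeff φ ζ ≠ ∞)
    (hne : ¬ (SameRadialLimit φ ψ ζ ∧ dCoeff ψ ζ = dCoeff φ ζ))
    {K : HoloSpace p →L[ℂ] HoloSpace p} (hK : IsCompactOperator K) :
    (dCoeff φ ζ).toReal ^ (-(β / 2)) ≤ ‖compOp bφ - compOp bψ - K‖ := by
  set d := (dCoeff φ ζ).toReal with hd'
  have hd0 : 0 < d := ENNReal.toReal_pos (dCoeff_ne_zero hφ ζ) hd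
  have hβ := hp.pos
  set T := compOp bφ - compOp bψ - K with hT
  -- The three terms come from φ, ψ and K respectively; the last two vanish as ε → 0, because β > 0.
  have key : ∀ ε > 0, (d + ε) ^ (-(β / 2)) - ε ^ β * (d + ε) ^ (β / 2) - ε ≤ ‖T‖ := by
    intro ε hε
    obtain ⟨M, hM⟩ := exists_slant_separated hφ hψ hζ hd hne hε
    obtain ⟨t, ⟨h1, h2⟩, h3, ht⟩ := (hM.and (((tendsto_slant_norm M).eventually
      (hp.eventually_compact_le hK hζ hε)).and (eventually_norm_slant_lt M))).exists
    set w := slant M t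
    set z := w • ζ with hz
    have hzw : ‖z‖ = ‖w‖ := norm_slant_smul hζ M t
    have hz1 : ‖z‖ < 1 := hzw ▸ ht
    have ha := hφ.norm_lt_one hz1
    have hb := hψ.norm_lt_one hz1
    obtain ⟨f, hf, hfn⟩ := hp.exists_kernel (φ z) ha
    set x := 1 - ‖z‖ ^ 2 with hx
    set y := 1 - ‖φ z‖ ^ 2 with hy
    set u := ‖(1 : ℂ) - inner ℂ (φ z) (ψ z)‖ with hu
    have hx0 : 0 < x := one_sub_norm_sq_pos hz1
    have hy0 : 0 < y := one_sub_norm_sq_pos ha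
    have hu0 : 0 < u := norm_pos_iff.2 (one_sub_inner_ne_zero ha hb.le)
    have hfa : f.toFun (φ z) = ((y ^ (-β) : ℝ) : ℂ) := by
      rw [hf _ ha, inner_self_ofReal, ← Complex.ofReal_one, ← Complex.ofReal_sub,
        ← Complex.ofReal_neg, ← Complex.ofReal_cpow hy0.le]
    have hfb : ‖f.toFun (ψ z)‖ = u ^ (-β) := by
      rw [hf _ hb, ← Complex.ofReal_neg, Complex.norm_cpow_real]
    have hA0 : 0 < y ^ (-(β / 2)) := Real.rpow_pos_of_pos hy0 _
    have hxβ : 0 < x ^ (β / 2) := Real.rpow_pos_of_pos hx0 _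
    have hTf := hp.eval_le ζ hζ (T f) w ht
    have hKf := h3 f
    rw [← hzw, ← hz, ← hx] at hTf
    rw [← hzw, ← hx] at hKf
    have e1 : (T f).toFun z = f.toFun (φ z) - f.toFun (ψ z) - (K f).toFun z := by
      have e2 : (T f).toFun z = (compOp bφ f).toFun z - (compOp bψ f).toFun z - (K f).toFun z := rfl
      rw [e2, compOp_apply bφ f (mem_ball_zero_iff.2 hz1),
        compOp_apply bψ f (mem_ball_zero_iff.2 hz1)]
    have h5 : y ^ (-β) - u ^ (-β) ≤ ‖(T f).toFun z‖ + ‖(K f).toFun z‖ := by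
      have a1 := norm_sub_norm_le (f.toFun (φ z)) (f.toFun (ψ z))
      rw [hfb, hfa, Complex.norm_real, Real.norm_of_nonneg (Real.rpow_nonneg hy0.le _), ← hfa] at a1
      have a2 := norm_add_le ((T f).toFun z) ((K f).toFun z)
      rw [e1, sub_add_cancel, ← e1] at a2
      exact a1.trans a2
    have h6 : x ^ (β / 2) * (y ^ (-β) - u ^ (-β)) ≤ (‖T‖ + ε) * y ^ (-(β / 2)) := by
      calc _ ≤ x ^ (β / 2) * (‖(T f).toFun z‖ + ‖(K f).toFun z‖) := by gcongr
        _ ≤ ‖T f‖ + ε * ‖f‖ := by rw [mul_add]; exact add_le_add hTf hKf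
        _ ≤ (‖T‖ + ε) * ‖f‖ := by rw [add_mul]; gcongr; exact T.le_opNorm f
        _ ≤ _ := by gcongr
    have hyy : y ^ (-β) = y ^ (-(β / 2)) * y ^ (-(β / 2)) := by
      rw [← Real.rpow_add hy0, ← neg_add, add_halves]
    have hinv : y ^ (-(β / 2)) * y ^ (β / 2) = 1 := by rw [← Real.rpow_add hy0]; simp
    -- The bound for the norm of the kernel, y^(−β/2), is divided out.
    have h7 : x ^ (β / 2) * y ^ (-(β / 2)) - x ^ (β / 2) * u ^ (-β) * y ^ (β / 2) ≤ ‖T‖ + ε := by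
      refine le_of_mul_le_mul_right ?_ hA0
      calc _ = x ^ (β / 2) * (y ^ (-(β / 2)) * y ^ (-(β / 2)) -
            u ^ (-β) * (y ^ (-(β / 2)) * y ^ (β / 2))) := by ring
        _ ≤ _ := by rw [hinv, mul_one, ← hyy]; exact h6
    have h8 : (d + ε) ^ (-(β / 2)) ≤ x ^ (β / 2) * y ^ (-(β / 2)) := by
      have := Real.rpow_le_rpow hy0.le h1 (by positivity : 0 ≤ β / 2)
      rw [Real.mul_rpow (by positivity) hx0.le] at this
      rw [Real.rpow_neg (by positivity), Real.rpow_neg hy0.le, ← div_eq_mul_inv,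
        le_div_iff₀ (Real.rpow_pos_of_pos hy0 _), inv_mul_le_iff₀ (by positivity)]
      exact this
    have h9 : x ^ (β / 2) * u ^ (-β) * y ^ (β / 2) ≤ ε ^ β * (d + ε) ^ (β / 2) := by
      have a1 := Real.rpow_le_rpow hy0.le h1 (by positivity : 0 ≤ β / 2)
      rw [Real.mul_rpow (by positivity) hx0.le] at a1
      have a2 := Real.rpow_le_rpow hx0.le h2 hβ.le
      rw [Real.mul_rpow hε.le hu0.le] at a2
      have a3 : x ^ (β / 2) * x ^ (β / 2) = x ^ β := by rw [← Real.rpow_add hx0, add_halves]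
      have a4 : u ^ (-β) * u ^ β = 1 := by rw [← Real.rpow_add hu0]; simp
      have hu1 : 0 < u ^ (-β) := Real.rpow_pos_of_pos hu0 _
      calc _ ≤ x ^ (β / 2) * u ^ (-β) * ((d + ε) ^ (β / 2) * x ^ (β / 2)) := by gcongr
        _ = x ^ β * (u ^ (-β) * (d + ε) ^ (β / 2)) := by rw [← a3]; ring
        _ ≤ (ε ^ β * u ^ β) * (u ^ (-β) * (d + ε) ^ (β / 2)) := by gcongr
        _ = ε ^ β * (d + ε) ^ (β / 2) * (u ^ (-β) * u ^ β) := by ring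
        _ = _ := by rw [a4, mul_one]
    linarith
  have hlim : Tendsto (fun ε : ℝ => (d + ε) ^ (-(β / 2)) - ε ^ β * (d + ε) ^ (β / 2) - ε) (𝓝[>] 0)
      (𝓝 ((d + 0) ^ (-(β / 2)) - 0 ^ β * (d + 0) ^ (β / 2) - 0)) := by
    have hid : Tendsto (fun ε : ℝ => ε) (𝓝[>] 0) (𝓝 0) := nhdsWithin_le_nhds
    have hdd : Tendsto (fun ε : ℝ => d + ε) (𝓝[>] 0) (𝓝 (d + 0)) := hid.const_add d
    have hne : d + 0 ≠ 0 := by simpa using hd0.ne'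
    exact ((hdd.rpow_const (Or.inl hne)).sub ((hid.rpow_const (Or.inr hβ.le)).mul
      (hdd.rpow_const (Or.inl hne)))).sub hid
  rw [add_zero, Real.zero_rpow hβ.ne', zero_mul, sub_zero, sub_zero] at hlim
  exact le_of_tendsto hlim (by filter_upwards [self_mem_nhdsWithin] with ε hε using key ε hε)

theorem HasPowerKernel.rpow_le_essNorm_sq {p : HoloENorm N} {β : ℝ} (hp : HasPowerKernel p β)
    {φ ψ : Cn N → Cn N} (hφ : IsAnalyticSelfMap φ) (hψ : IsAnalyticSelfMap ψ)
    (bφ : InducesBounded p φ) (bψ : InducesBounded p ψ) {ζ : Cn N} (hζ : ‖ζ‖ = 1)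
    (hne : ¬ (SameRadialLimit φ ψ ζ ∧ dCoeff ψ ζ = dCoeff φ ζ)) :
    dCoeff φ ζ ^ (-β) ≤ ENNReal.ofReal (essNorm (compOp bφ - compOp bψ) ^ 2) := by
  -- In the extended nonnegative reals ∞ to a negative power is 0.
  by_cases hd : dCoeff φ ζ = ∞
  · rw [hd, ENNReal.top_rpow_of_neg (neg_lt_zero.2 hp.pos)]
    exact zero_le
  have hd0 : 0 < (dCoeff φ ζ).toReal := ENNReal.toReal_pos (dCoeff_ne_zero hφ ζ) hd
  have h : (dCoeff φ ζ).toReal ^ (-(β / 2)) ≤ essNorm (compOp bφ - compOp bψ) := by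
    refine le_csInf ⟨_, 0, isCompactOperator_zero, rfl⟩ ?_
    rintro c ⟨K, hK, rfl⟩
    exact hp.le_norm_sub hφ hψ bφ bψ hζ hd hne hK
  rw [← ENNReal.ofReal_toReal hd, ENNReal.ofReal_rpow_of_pos hd0]
  refine ENNReal.ofReal_le_ofReal ?_
  have h2 := pow_le_pow_left₀ (Real.rpow_nonneg hd0.le _) h 2
  rw [← Real.rpow_mul_natCast hd0.le] at h2
  rwa [show -(β / 2) * ((2 : ℕ) : ℝ) = -β by push_cast; ring] at h2

end BallCompOp

namespace BallCompOp

/-! ### Unitarily invariant measures -/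

section Rotation

variable {E : Type*} [NormedAddCommGroup E] [InnerProductSpace ℂ E]

/-- Multiplication by `a` on the line through the unit vector `u` and by `b` on its orthogonal
complement. -/
noncomputable def splitRotation (u : E) (a b : ℂ) : E →ₗ[ℂ] E :=
  b • LinearMap.id + (a - b) • (innerₛₗ ℂ u).smulRight u

theorem splitRotation_apply (u : E) (a b : ℂ) (w : E) :
    splitRotation u a b w = (a * inner ℂ u w) • u + b • (w - (inner ℂ u w : ℂ) • u) := by
  simp only [splitRotation, LinearMap.add_apply, LinearMap.smul_apply, LinearMap.id_apply,
    LinearMap.smulRight_apply, innerₛₗ_apply_apply]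
  module

theorem norm_splitRotation {u : E} (hu : ‖u‖ = 1) {a b : ℂ} (ha : ‖a‖ = 1) (hb : ‖b‖ = 1) (w : E) :
    ‖splitRotation u a b w‖ = ‖w‖ := by
  have h0 : ∀ c : ℂ, inner ℂ (c • u) (w - (inner ℂ u w : ℂ) • u) = 0 := fun c => by
    rw [inner_smul_left, inner_sub_right, inner_smul_right, inner_self_ofReal, hu]
    simp
  have h1 : ∀ c d : ℂ, ‖c • u + d • (w - (inner ℂ u w : ℂ) • u)‖ ^ 2 =
      ‖c‖ ^ 2 + ‖d‖ ^ 2 * ‖w - (inner ℂ u w : ℂ) • u‖ ^ 2 := fun c d => by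
    have := norm_add_sq_eq_norm_sq_add_norm_sq_of_inner_eq_zero (𝕜 := ℂ) (c • u)
      (d • (w - (inner ℂ u w : ℂ) • u)) (by rw [inner_smul_right, h0, mul_zero])
    rw [← pow_two, ← pow_two, ← pow_two] at this
    rw [this, norm_smul, norm_smul, hu, mul_one, mul_pow]
  have h2 := h1 (inner ℂ u w) 1
  rw [one_smul, add_sub_cancel] at h2
  rw [← sq_eq_sq₀ (norm_nonneg _) (norm_nonneg _), splitRotation_apply, h1, h2, norm_mul, ha, hb]
  simp

variable [FiniteDimensional ℂ E] in
/-- `splitRotation` as a unitary map. -/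
noncomputable def splitUnitary {u : E} (hu : ‖u‖ = 1) {a b : ℂ} (ha : ‖a‖ = 1) (hb : ‖b‖ = 1) :
    E ≃ₗᵢ[ℂ] E :=
  LinearIsometry.toLinearIsometryEquiv ⟨splitRotation u a b, norm_splitRotation hu ha hb⟩ rfl

end Rotation

variable {N : ℕ}

/-- A finite unitarily invariant measure on `ℂ^N` supported in the closed ball of radius `r < 1`. -/
structure IsUnitaryInvariant (μ : Measure (Cn N)) (r : ℝ) : Prop where
  finite : IsFiniteMeasure μ
  nonneg : 0 ≤ r
  lt_one : r < 1
  ae_norm_le : ∀ᵐ w ∂μ, ‖w‖ ≤ r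
  map_eq : ∀ U : Cn N ≃ₗᵢ[ℂ] Cn N, μ.map U = μ

theorem norm_inner_le_of_norm_eq_one {u w : Cn N} (hu : ‖u‖ = 1) : ‖(inner ℂ u w : ℂ)‖ ≤ ‖w‖ := by
  have h := norm_inner_le_norm (𝕜 := ℂ) u w
  rwa [hu, one_mul] at h

namespace IsUnitaryInvariant

variable {μ : Measure (Cn N)} {r : ℝ}

theorem measurePreserving (hμ : IsUnitaryInvariant μ r) (U : Cn N ≃ₗᵢ[ℂ] Cn N) :
    MeasurePreserving U μ μ := ⟨U.continuous.measurable, hμ.map_eq U⟩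

theorem integrable_of_continuous (hμ : IsUnitaryInvariant μ r) {g : Cn N → ℂ} (hg : Continuous g) :
    Integrable g μ := by
  have := hμ.finite
  obtain ⟨C, hC⟩ := (isCompact_closedBall (0 : Cn N) r).exists_bound_of_continuousOn hg.continuousOn
  refine Integrable.of_bound hg.aestronglyMeasurable C ?_
  filter_upwards [hμ.ae_norm_le] with w hw using hC w (mem_closedBall_zero_iff.2 hw)

/-- A scalar rotation by θ with (k − j)θ = π preserves μ and changes the sign of the integrand. -/
theorem integral_conj_inner_pow_mul (hμ : IsUnitaryInvariant μ r) {u : Cn N} (hu : ‖u‖ = 1)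
    {j k : ℕ} (hjk : j ≠ k) :
    ∫ w, (starRingEnd ℂ) (inner ℂ u w) ^ j * (inner ℂ u w : ℂ) ^ k ∂μ = 0 := by
  obtain ⟨θ, hθ⟩ : ∃ θ : ℝ, ((k : ℝ) - j) * θ = Real.pi :=
    ⟨Real.pi / ((k : ℝ) - j), mul_div_cancel₀ _ (sub_ne_zero.2 (by exact_mod_cast hjk.symm))⟩
  set c : ℂ := Complex.exp (θ * Complex.I) with hc
  have hc1 : ‖c‖ = 1 := Complex.norm_exp_ofReal_mul_I θ
  have hck : (starRingEnd ℂ) c ^ j * c ^ k = -1 := by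
    rw [hc, ← Complex.exp_conj, ← Complex.exp_nat_mul, ← Complex.exp_nat_mul, ← Complex.exp_add,
      ← Complex.exp_pi_mul_I, ← hθ]
    congr 1
    simp only [map_mul, Complex.conj_ofReal, Complex.conj_I]
    push_cast
    ring
  have h := (hμ.measurePreserving (splitUnitary hu hc1 hc1)).integral_comp
    (splitUnitary hu hc1 hc1).toHomeomorph.measurableEmbedding
    (fun w => (starRingEnd ℂ) (inner ℂ u w) ^ j * (inner ℂ u w : ℂ) ^ k)
  have e : ∀ w : Cn N, (inner ℂ u (splitUnitary hu hc1 hc1 w) : ℂ) = c * inner ℂ u w := by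
    intro w
    have : splitUnitary hu hc1 hc1 w = c • w := by
      change splitRotation u c c w = _
      rw [splitRotation_apply]; module
    rw [this, inner_smul_right]
  simp only [e, map_mul, mul_pow] at h
  have h2 : ∀ w : Cn N, (starRingEnd ℂ) c ^ j * (starRingEnd ℂ) (inner ℂ u w) ^ j *
      (c ^ k * (inner ℂ u w : ℂ) ^ k) =
      -((starRingEnd ℂ) (inner ℂ u w) ^ j * (inner ℂ u w : ℂ) ^ k) := fun w => by
    rw [mul_mul_mul_comm, hck, neg_one_mul]
  simp only [h2, integral_neg] at h
  have h3 : ∀ x : ℂ, -x = x → x = 0 := fun x hx => by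
    have : (2 : ℂ) * x = 0 := by linear_combination -hx
    simpa using this
  exact h3 _ h

theorem integral_norm_sum_sq (hμ : IsUnitaryInvariant μ r) {u : Cn N} (hu : ‖u‖ = 1)
    (b : ℕ → ℂ) (n : ℕ) :
    ∫ w, ‖∑ k ∈ Finset.range n, b k * (inner ℂ u w : ℂ) ^ k‖ ^ 2 ∂μ =
      ∑ k ∈ Finset.range n, ‖b k‖ ^ 2 * ∫ w, ‖(inner ℂ u w : ℂ)‖ ^ (2 * k) ∂μ := by
  have hint : ∀ j k : ℕ, Integrable (fun w : Cn N => (starRingEnd ℂ) (b j) * b k *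
      ((starRingEnd ℂ) (inner ℂ u w) ^ j * (inner ℂ u w : ℂ) ^ k)) μ := fun j k =>
    hμ.integrable_of_continuous (by fun_prop)
  have e : ∀ w : Cn N, ((‖∑ k ∈ Finset.range n, b k * (inner ℂ u w : ℂ) ^ k‖ ^ 2 : ℝ) : ℂ) =
      ∑ j ∈ Finset.range n, ∑ k ∈ Finset.range n, (starRingEnd ℂ) (b j) * b k *
      ((starRingEnd ℂ) (inner ℂ u w) ^ j * (inner ℂ u w : ℂ) ^ k) := by
    intro w
    rw [Complex.ofReal_pow, ← Complex.conj_mul', map_sum, Finset.sum_mul_sum]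
    refine Finset.sum_congr rfl fun j _ => Finset.sum_congr rfl fun k _ => ?_
    rw [map_mul, map_pow]
    ring
  have ec : ((∫ w, ‖∑ k ∈ Finset.range n, b k * (inner ℂ u w : ℂ) ^ k‖ ^ 2 ∂μ : ℝ) : ℂ) =
      ((∑ k ∈ Finset.range n, ‖b k‖ ^ 2 * ∫ w, ‖(inner ℂ u w : ℂ)‖ ^ (2 * k) ∂μ : ℝ) : ℂ) := by
    rw [← integral_complex_ofReal]
    simp only [e]
    rw [integral_finsetSum _ fun j _ => integrable_finsetSum _ fun k _ => hint j k,
      Complex.ofReal_sum]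
    refine Finset.sum_congr rfl fun j hj => ?_
    rw [integral_finsetSum _ fun k _ => hint j k, Finset.sum_eq_single j]
    · rw [integral_const_mul, Complex.conj_mul', Complex.ofReal_mul, Complex.ofReal_pow,
        ← integral_complex_ofReal]
      congr 2
      ext w
      rw [← mul_pow, Complex.conj_mul', ← pow_mul, Complex.ofReal_pow]
    · intro k _ hkj
      rw [integral_const_mul, hμ.integral_conj_inner_pow_mul hu hkj.symm, mul_zero]
    · exact fun h => absurd hj h
  exact_mod_cast ec

/-- Parseval's identity for power series in one linear functional. -/
theorem tendsto_sum_integral (hμ : IsUnitaryInvariant μ r) {u : Cn N} (hu : ‖u‖ = 1)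
    {b : ℕ → ℂ} (hb : Summable fun k => ‖b k‖ * r ^ k) {F : Cn N → ℂ}
    (hF : ∀ w : Cn N, ‖w‖ ≤ r → HasSum (fun k => b k * (inner ℂ u w : ℂ) ^ k) (F w)) :
    Tendsto (fun n => ∑ k ∈ Finset.range n, ‖b k‖ ^ 2 * ∫ w, ‖(inner ℂ u w : ℂ)‖ ^ (2 * k) ∂μ)
      atTop (𝓝 (∫ w, ‖F w‖ ^ 2 ∂μ)) := by
  have := hμ.finite
  simp only [← hμ.integral_norm_sum_sq hu]
  refine tendsto_integral_of_dominated_convergence (fun _ => (∑' k, ‖b k‖ * r ^ k) ^ 2)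
    (fun n => Continuous.aestronglyMeasurable (by fun_prop)) (integrable_const _) (fun n => ?_) ?_
  · filter_upwards [hμ.ae_norm_le] with w hw
    rw [Real.norm_of_nonneg (sq_nonneg _)]
    refine pow_le_pow_left₀ (norm_nonneg _) ((norm_sum_le _ _).trans ?_) 2
    refine le_trans (Finset.sum_le_sum fun k _ => ?_)
      (hb.sum_le_tsum _ fun k _ => mul_nonneg (norm_nonneg _) (pow_nonneg hμ.nonneg _))
    rw [norm_mul, norm_pow]
    have := (norm_inner_le_of_norm_eq_one (w := w) hu).trans hw
    gcongr
  · filter_upwards [hμ.ae_norm_le] with w hw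
    exact (hF w hw).tendsto_sum_nat.norm.pow 2

/-- Restricting a holomorphic function to a line through the origin does not increase norms. -/
theorem lintegral_slice_le (hμ : IsUnitaryInvariant μ r) {u : Cn N} (hu : ‖u‖ = 1)
    {f : Cn N → ℂ} (hf : IsHolo f) :
    ∫⁻ w, ‖f ((inner ℂ u w : ℂ) • u)‖ₑ ^ 2 ∂μ ≤ ∫⁻ w, ‖f w‖ₑ ^ 2 ∂μ := by
  have := hμ.finite
  have hfm : Measurable fun w => ‖f w‖ₑ ^ 2 := hf.measurable.enorm.pow_const 2
  -- The uniform probability measure on angles. The integral of |f|² is averaged over rotations that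
  -- fix u and turn its orthogonal complement.
  set ν : Measure ℝ := ENNReal.ofReal (2 * Real.pi)⁻¹ • volume.restrict (Ioc 0 (2 * Real.pi))
    with hν
  have hpi : 0 < 2 * Real.pi := Real.two_pi_pos
  have hνfin : IsFiniteMeasure ν := by
    refine ⟨?_⟩
    rw [hν, Measure.smul_apply, Measure.restrict_apply_univ, Real.volume_Ioc, smul_eq_mul]
    exact ENNReal.mul_lt_top ENNReal.ofReal_lt_top ENNReal.ofReal_lt_top
  have hν1 : ν univ = 1 := by
    rw [hν, Measure.smul_apply, Measure.restrict_apply_univ, Real.volume_Ioc, smul_eq_mul,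
      ← ENNReal.ofReal_mul (by positivity), sub_zero, inv_mul_cancel₀ hpi.ne', ENNReal.ofReal_one]
  set p : Cn N → Cn N := fun w => (inner ℂ u w : ℂ) • u with hp
  have hcirc : ∀ θ, ‖circleMap 0 1 θ‖ = 1 := fun θ => by simp
  have hrot : ∀ θ : ℝ, ∫⁻ w, ‖f w‖ₑ ^ 2 ∂μ =
      ∫⁻ w, ‖f (p w + circleMap 0 1 θ • (w - p w))‖ₑ ^ 2 ∂μ := by
    intro θ
    rw [← (hμ.measurePreserving (splitUnitary hu norm_one (hcirc θ))).lintegral_comp hfm]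
    refine lintegral_congr fun w => ?_
    have : splitUnitary hu norm_one (hcirc θ) w = p w + circleMap 0 1 θ • (w - p w) := by
      change splitRotation u 1 _ w = _
      rw [splitRotation_apply, one_mul]
    rw [this]
  have hpc : Continuous p := by simp only [hp]; fun_prop
  have hmeas : Measurable (Function.uncurry fun (θ : ℝ) (w : Cn N) =>
      ‖f (p w + circleMap 0 1 θ • (w - p w))‖ₑ ^ 2) := by
    refine hfm.comp (Continuous.measurable ?_)
    have h1 : Continuous (circleMap 0 1) := continuous_circleMap 0 1
    fun_prop
  have havg : ∫⁻ w, ‖f w‖ₑ ^ 2 ∂μ =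
      ∫⁻ w, ∫⁻ θ, ‖f (p w + circleMap 0 1 θ • (w - p w))‖ₑ ^ 2 ∂ν ∂μ := by
    rw [← lintegral_lintegral_swap hmeas.aemeasurable]
    simp only [← hrot]
    rw [lintegral_const, hν1, mul_one]
  rw [havg]
  refine lintegral_mono_ae ?_
  filter_upwards [hμ.ae_norm_le] with w hw
  -- The projection of w to the line is the centre z = 0 of an analytic disc whose boundary is the
  -- rotation orbit of w. The mean value property is applied to f², so |f|² at the centre is at most
  -- its average, with no appeal to subharmonicity.
  set g : ℂ → ℂ := fun z => f (p w + z • (w - p w)) ^ 2 with hg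
  have hq : ∀ z : ℂ, ‖z‖ = 1 → ‖p w + z • (w - p w)‖ = ‖w‖ := fun z hz => by
    have := norm_splitRotation hu norm_one hz w
    rwa [splitRotation_apply, one_mul] at this
  -- Every point of the closed disc is a convex combination of two antipodal points ±c of the
  -- circle, where the norm is |w|; hence the analytic disc stays in the ball.
  have hq2 : ∀ z : ℂ, ‖z‖ ≤ 1 → ‖p w + z • (w - p w)‖ ≤ ‖w‖ := fun z hz => by
    have h1 := hq 1 norm_one
    have h2 := hq (-1) (by simp)
    rcases eq_or_ne z 0 with rfl | hz0
    · rw [zero_smul, add_zero]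
      have : (2 : ℂ) • p w = (p w + (1 : ℂ) • (w - p w)) + (p w + (-1 : ℂ) • (w - p w)) := by module
      have h3 := norm_add_le (p w + (1 : ℂ) • (w - p w)) (p w + (-1 : ℂ) • (w - p w))
      rw [← this, norm_smul, h1, h2] at h3
      simp at h3
      linarith
    · have hzn : 0 < ‖z‖ := norm_pos_iff.2 hz0
      set c : ℂ := z / (‖z‖ : ℂ) with hc
      have hnc : ((‖z‖ : ℝ) : ℂ) ≠ 0 := by exact_mod_cast hzn.ne'
      have hc1 : ‖c‖ = 1 := by
        rw [hc, norm_div, Complex.norm_real, norm_norm, div_self hzn.ne']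
      have hzc : z = (‖z‖ : ℂ) * c := by rw [hc]; field_simp
      have h3 := hq c hc1
      have h4 := hq (-c) (by simpa using hc1)
      have e : p w + z • (w - p w) = (((1 + ‖z‖) / 2 : ℝ) : ℂ) • (p w + c • (w - p w)) +
          (((1 - ‖z‖) / 2 : ℝ) : ℂ) • (p w + (-c) • (w - p w)) := by
        have : z • (w - p w) = ((‖z‖ : ℂ) * c) • (w - p w) := by rw [← hzc]
        rw [this]
        push_cast
        module
      rw [e]
      refine (norm_add_le _ _).trans (le_of_eq ?_)
      rw [norm_smul, norm_smul, h3, h4, Complex.norm_real, Complex.norm_real,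
        Real.norm_of_nonneg (by linarith), Real.norm_of_nonneg (by linarith)]
      ring
  have hd : DiffContOnCl ℂ g (ball 0 |1|) := by
    refine DifferentiableOn.diffContOnCl_ball (U := closedBall 0 1) ?_ (by simp)
    intro z hz
    have hin : p w + z • (w - p w) ∈ unitBall N := mem_ball_zero_iff.2
      ((hq2 z (mem_closedBall_zero_iff.1 hz)).trans_lt (hw.trans_lt hμ.lt_one))
    have h1 := (hf.1 _ hin).differentiableAt (isOpen_ball.mem_nhds hin)
    have h2 : DifferentiableAt ℂ (fun z : ℂ => p w + z • (w - p w)) z := by fun_prop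
    exact ((DifferentiableAt.comp z h1 h2).pow 2).differentiableWithinAt
  have hmv : ∫ θ, g (circleMap 0 1 θ) ∂ν = f (p w) ^ 2 := by
    have h1 := hd.circleAverage
    rw [Real.circleAverage, intervalIntegral.integral_of_le hpi.le] at h1
    rw [hν, integral_smul_measure, ENNReal.toReal_ofReal (by positivity), h1]
    simp [hg]
  calc ‖f (p w)‖ₑ ^ 2 = ‖∫ θ, g (circleMap 0 1 θ) ∂ν‖ₑ := by rw [hmv, enorm_pow]
    _ ≤ ∫⁻ θ, ‖g (circleMap 0 1 θ)‖ₑ ∂ν := enorm_integral_le_lintegral_enorm _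
    _ = _ := by simp only [hg, enorm_pow]

end IsUnitaryInvariant

end BallCompOp

namespace BallCompOp

/-! ### The binomial series -/

/-- The coefficients of `(1 - z) ^ (-β)`. -/
noncomputable def powCoeff (β : ℝ) (k : ℕ) : ℝ :=
  Real.Gamma (β + k) / (k.factorial * Real.Gamma β)

theorem powCoeff_pos {β : ℝ} (hβ : 0 < β) (k : ℕ) : 0 < powCoeff β k := by
  have := Real.Gamma_pos_of_pos hβ
  have := Real.Gamma_pos_of_pos (show 0 < β + k by positivity)
  have := k.factorial_pos
  unfold powCoeff
  positivity

theorem ascPochhammer_eval_eq_Gamma {β : ℝ} (hβ : 0 < β) (k : ℕ) :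
    (ascPochhammer ℝ k).eval β * Real.Gamma β = Real.Gamma (β + k) := by
  induction k with
  | zero => simp
  | succ k ih =>
    rw [ascPochhammer_succ_eval, mul_right_comm, ih, Nat.cast_succ, ← add_assoc,
      Real.Gamma_add_one (by positivity), mul_comm]

theorem choose_eq_powCoeff {β : ℝ} (hβ : 0 < β) (k : ℕ) :
    Ring.choose (β + k - 1) k = powCoeff β k := by
  have h1 : Ring.choose (β + k - 1) k = Ring.multichoose β k := by
    unfold Ring.choose
    congr 1
    ring
  have h2 := Ring.factorial_nsmul_multichoose_eq_ascPochhammer β k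
  rw [Polynomial.ascPochhammer_smeval_eq_eval, nsmul_eq_mul] at h2
  have h3 : (k.factorial : ℝ) ≠ 0 := by exact_mod_cast k.factorial_ne_zero
  have h4 := (Real.Gamma_pos_of_pos hβ).ne'
  rw [h1, powCoeff, ← ascPochhammer_eval_eq_Gamma hβ, ← h2]
  field_simp

theorem hasSum_powCoeff {β : ℝ} (hβ : 0 < β) {z : ℂ} (hz : ‖z‖ < 1) :
    HasSum (fun k => (powCoeff β k : ℂ) * z ^ k) ((1 - z) ^ (-(β : ℂ))) := by
  have h := (Complex.one_div_one_sub_cpow_hasFPowerSeriesOnBall_zero (β : ℂ)).hasSum (y := z)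
    (by rw [mem_eball_zero_iff, enorm_eq_nnnorm]; exact_mod_cast hz)
  rw [zero_add, one_div, ← Complex.cpow_neg] at h
  refine h.congr_fun fun k => ?_
  rw [FormalMultilinearSeries.ofScalars_apply_eq, ← choose_eq_powCoeff hβ, Complex.ofReal_choose,
    smul_eq_mul]
  push_cast
  rfl

theorem hasSum_powCoeff_real {β : ℝ} (hβ : 0 < β) {x : ℝ} (hx0 : 0 ≤ x) (hx : x < 1) :
    HasSum (fun k => powCoeff β k * x ^ k) ((1 - x) ^ (-β)) := by
  have h := hasSum_powCoeff hβ (z := (x : ℂ))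
    (by rwa [Complex.norm_real, Real.norm_of_nonneg hx0])
  rw [← Complex.ofReal_one, ← Complex.ofReal_sub, ← Complex.ofReal_neg,
    ← Complex.ofReal_cpow (by linarith)] at h
  exact_mod_cast h

/-! ### Power series with coefficients in a weighted `ℓ²` space -/

/-- Cauchy–Schwarz with the weights `powCoeff β k`, whose generating series at |z|² sums to (1 −
|z|²)^(−β). -/
theorem norm_sum_Ico_sq_le {β : ℝ} (hβ : 0 < β) (b : ℕ → ℂ) {z : ℂ} (hz : ‖z‖ < 1) (n m : ℕ) :
    ‖∑ k ∈ Finset.Ico n m, b k * z ^ k‖ ^ 2 ≤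
      (∑ k ∈ Finset.Ico n m, ‖b k‖ ^ 2 * (powCoeff β k)⁻¹) * (1 - ‖z‖ ^ 2) ^ (-β) := by
  have h1 : (∑ k ∈ Finset.Ico n m, ‖b k‖ * ‖z‖ ^ k) ^ 2 ≤
      (∑ k ∈ Finset.Ico n m, ‖b k‖ ^ 2 * (powCoeff β k)⁻¹) *
        ∑ k ∈ Finset.Ico n m, powCoeff β k * (‖z‖ ^ 2) ^ k := by
    refine Finset.sum_sq_le_sum_mul_sum_of_sq_le_mul _ (fun k _ => ?_) (fun k _ => ?_)
      (fun k _ => le_of_eq ?_)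
    · have := powCoeff_pos hβ k; positivity
    · have := powCoeff_pos hβ k; positivity
    · have := (powCoeff_pos hβ k).ne'
      field_simp
      ring
  have hs := hasSum_powCoeff_real hβ (sq_nonneg ‖z‖) (by nlinarith [norm_nonneg z])
  have h2 := hs.summable.sum_le_tsum (Finset.Ico n m) fun k _ =>
    mul_nonneg (powCoeff_pos hβ k).le (pow_nonneg (sq_nonneg _) k)
  rw [hs.tsum_eq] at h2
  refine (pow_le_pow_left₀ (norm_nonneg _) (norm_sum_le _ _) 2).trans ?_
  simp only [norm_mul, norm_pow]
  refine h1.trans (mul_le_mul_of_nonneg_left h2 (Finset.sum_nonneg fun k _ => ?_))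
  have := powCoeff_pos hβ k
  positivity

/-- Head and tail are split at n. With n = 0 this is the sharp point evaluation bound; for large n
the tail constant is small and the head is killed by the vanishing weight. -/
theorem rpow_half_mul_norm_le {β : ℝ} (hβ : 0 < β) {b : ℕ → ℂ} {B : ℝ} (hB0 : 0 ≤ B)
    {n : ℕ} (hB : ∀ m, ∑ k ∈ Finset.Ico n m, ‖b k‖ ^ 2 * (powCoeff β k)⁻¹ ≤ B ^ 2)
    {z F : ℂ} (hz : ‖z‖ < 1) (hF : HasSum (fun k => b k * z ^ k) F) :
    (1 - ‖z‖ ^ 2) ^ (β / 2) * ‖F‖ ≤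
      (1 - ‖z‖ ^ 2) ^ (β / 2) * (∑ k ∈ Finset.range n, ‖b k‖) + B := by
  set x := 1 - ‖z‖ ^ 2 with hx
  have hx0 : 0 < x := one_sub_norm_sq_pos hz
  have hxβ : 0 < x ^ (β / 2) := Real.rpow_pos_of_pos hx0 _
  have hxx : x ^ (β / 2) * x ^ (-(β / 2)) = 1 := by rw [← Real.rpow_add hx0]; simp
  have hxs : (x ^ (-(β / 2))) ^ 2 = x ^ (-β) := by
    rw [pow_two, ← Real.rpow_add hx0, ← neg_add, add_halves]
  have hle : ∀ᶠ m in atTop, ‖∑ k ∈ Finset.range m, b k * z ^ k‖ ≤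
      (∑ k ∈ Finset.range n, ‖b k‖) + B * x ^ (-(β / 2)) := by
    filter_upwards [eventually_ge_atTop n] with m hm
    rw [← Finset.sum_range_add_sum_Ico _ hm]
    refine (norm_add_le _ _).trans (add_le_add ((norm_sum_le _ _).trans ?_) ?_)
    · refine Finset.sum_le_sum fun k _ => ?_
      rw [norm_mul, norm_pow]
      exact mul_le_of_le_one_right (norm_nonneg _) (pow_le_one₀ (norm_nonneg _) hz.le)
    · have hp : 0 ≤ B * x ^ (-(β / 2)) := mul_nonneg hB0 (Real.rpow_nonneg hx0.le _)
      refine le_of_sq_le_sq ?_ hp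
      rw [mul_pow, hxs]
      exact (norm_sum_Ico_sq_le hβ b hz n m).trans
        (mul_le_mul_of_nonneg_right (hB m) (Real.rpow_nonneg hx0.le _))
  have h := le_of_tendsto hF.tendsto_sum_nat.norm hle
  have h2 := mul_le_mul_of_nonneg_left h hxβ.le
  rw [mul_add, mul_left_comm _ B, hxx, mul_one] at h2
  exact h2

theorem tendsto_rpow_half_mul_norm {β : ℝ} (hβ : 0 < β) {b : ℕ → ℂ} {B : ℝ}
    (hB : ∀ n, ∑ k ∈ Finset.range n, ‖b k‖ ^ 2 * (powCoeff β k)⁻¹ ≤ B)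
    {F : ℂ → ℂ} (hF : ∀ z : ℂ, ‖z‖ < 1 → HasSum (fun k => b k * z ^ k) (F z)) :
    Tendsto (fun z => (1 - ‖z‖ ^ 2) ^ (β / 2) * ‖F z‖) (comap norm (𝓝[<] 1)) (𝓝 0) := by
  have hnn : ∀ k, 0 ≤ ‖b k‖ ^ 2 * (powCoeff β k)⁻¹ := fun k => by
    have := powCoeff_pos hβ k
    positivity
  have hs := summable_of_sum_range_le hnn hB
  have hball : ∀ᶠ z : ℂ in comap norm (𝓝[<] 1), ‖z‖ < 1 :=
    tendsto_comap.eventually self_mem_nhdsWithin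
  refine tendsto_order.2 ⟨fun a ha => ?_, fun ε hε => ?_⟩
  · filter_upwards [hball] with z hz
    exact ha.trans_le (mul_nonneg (Real.rpow_nonneg (one_sub_norm_sq_pos hz).le _) (norm_nonneg _))
  obtain ⟨n, hn⟩ : ∃ n, ∀ m, ∑ k ∈ Finset.Ico n m, ‖b k‖ ^ 2 * (powCoeff β k)⁻¹ ≤ (ε / 2) ^ 2 := by
    obtain ⟨n, hn⟩ := ((hs.hasSum.tendsto_sum_nat).eventually
      (lt_mem_nhds (sub_lt_self _ (by positivity : 0 < (ε / 2) ^ 2)))).exists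
    refine ⟨n, fun m => ?_⟩
    rcases le_total n m with h | h
    · have h1 := hs.sum_le_tsum (Finset.range m) fun k _ => hnn k
      rw [← Finset.sum_range_add_sum_Ico _ h] at h1
      linarith
    · rw [Finset.Ico_eq_empty_of_le h, Finset.sum_empty]
      positivity
  have ht : Tendsto (fun z : ℂ => (1 - ‖z‖ ^ 2) ^ (β / 2) * (∑ k ∈ Finset.range n, ‖b k‖))
      (comap norm (𝓝[<] 1)) (𝓝 0) := by
    have h1 : Tendsto (fun z : ℂ => ‖z‖) (comap norm (𝓝[<] 1)) (𝓝 1) :=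
      tendsto_comap.mono_right nhdsWithin_le_nhds
    have h2 := (((h1.pow 2).const_sub 1).rpow_const (p := β / 2) (Or.inr (by positivity))).mul_const
      (∑ k ∈ Finset.range n, ‖b k‖)
    rwa [one_pow, sub_self, Real.zero_rpow (by positivity), zero_mul] at h2
  filter_upwards [hball, ht.eventually (gt_mem_nhds (half_pos hε))] with z hz h
  have := rpow_half_mul_norm_le hβ (half_pos hε).le hn hz (hF z hz)
  linarith

/-! ### Norms given by unitarily invariant measures -/

variable {N : ℕ}

/-- The norm `p` is the increasing limit of `L²` norms for unitarily invariant measures `μ r`, whose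
moments converge to the reciprocals of the coefficients of `(1 - z) ^ (-β)`. -/
structure HasInvariantMeasures (p : HoloENorm N) (β : ℝ) (μ : ℝ → Measure (Cn N)) : Prop where
  pos : 0 < β
  invariant : ∀ r ∈ Ioo (0 : ℝ) 1, IsUnitaryInvariant (μ r) r
  lintegral_le : ∀ r ∈ Ioo (0 : ℝ) 1, ∀ f, IsHolo f → ∫⁻ w, ‖f w‖ₑ ^ 2 ∂μ r ≤ p.toFun f ^ 2
  le_of_lintegral_le : ∀ f, IsHolo f → ∀ C, (∀ r ∈ Ioo (0 : ℝ) 1, ∫⁻ w, ‖f w‖ₑ ^ 2 ∂μ r ≤ C ^ 2) →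
    p.toFun f ≤ C
  moment_le : ∀ u : Cn N, ‖u‖ = 1 → ∀ k, ∀ r ∈ Ioo (0 : ℝ) 1,
    ∫ w, ‖(inner ℂ u w : ℂ)‖ ^ (2 * k) ∂μ r ≤ (powCoeff β k)⁻¹
  moment_tendsto : ∀ u : Cn N, ‖u‖ = 1 → ∀ k,
    Tendsto (fun r => ∫ w, ‖(inner ℂ u w : ℂ)‖ ^ (2 * k) ∂μ r) (𝓝[<] 1) (𝓝 (powCoeff β k)⁻¹)

theorem IsHolo.hasSum_slice {f : Cn N → ℂ} (hf : IsHolo f) {u : Cn N} (hu : ‖u‖ = 1) :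
    ∃ b : ℕ → ℂ, ∀ z : ℂ, ‖z‖ < 1 → HasSum (fun k => b k * z ^ k) (f (z • u)) := by
  have hmaps : MapsTo (fun z : ℂ => z • u) (ball 0 1) (unitBall N) := fun z hz => by
    rw [mem_ball_zero_iff] at hz ⊢
    rwa [norm_smul, hu, mul_one]
  have hd : DifferentiableOn ℂ (fun z : ℂ => f (z • u)) (ball 0 1) :=
    hf.1.comp (by fun_prop) hmaps
  refine ⟨fun k => (k.factorial : ℂ)⁻¹ * iteratedDeriv k (fun z : ℂ => f (z • u)) 0,
    fun z hz => ?_⟩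
  have h := Complex.hasSum_taylorSeries_on_ball hd (mem_ball_zero_iff.2 hz)
  simpa [mul_comm, mul_left_comm, mul_assoc] using h

theorem summable_norm_mul_pow {b : ℕ → ℂ} {F : ℂ → ℂ}
    (hF : ∀ z : ℂ, ‖z‖ < 1 → HasSum (fun k => b k * z ^ k) (F z)) {r : ℝ} (hr0 : 0 ≤ r)
    (hr : r < 1) : Summable fun k => ‖b k‖ * r ^ k := by
  have h := (hF (r : ℂ) (by rwa [Complex.norm_real, Real.norm_of_nonneg hr0])).summable.norm
  simpa [abs_of_nonneg hr0] using h

namespace HasInvariantMeasures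

variable {p : HoloENorm N} {β : ℝ} {μ : ℝ → Measure (Cn N)}

/-- Parseval is applied to w ↦ f(⟨w, u⟩u), a series in the single functional ⟨·, u⟩, whose norm
`lintegral_slice_le` bounds by that of f; then r → 1. -/
theorem sum_coeff_le (hp : HasInvariantMeasures p β μ) (f : HoloSpace p) {u : Cn N} (hu : ‖u‖ = 1)
    {b : ℕ → ℂ} (hb : ∀ z : ℂ, ‖z‖ < 1 → HasSum (fun k => b k * z ^ k) (f.toFun (z • u))) (n : ℕ) :
    ∑ k ∈ Finset.range n, ‖b k‖ ^ 2 * (powCoeff β k)⁻¹ ≤ ‖f‖ ^ 2 := by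
  have hf : IsHolo f.toFun := f.2.1
  have hfin : p.toFun f.toFun ≠ ∞ := f.2.2.ne
  have hr : ∀ r ∈ Ioo (0 : ℝ) 1, ∑ k ∈ Finset.range n,
      ‖b k‖ ^ 2 * ∫ w, ‖(inner ℂ u w : ℂ)‖ ^ (2 * k) ∂μ r ≤ ‖f‖ ^ 2 := by
    intro r hr
    have hμ := hp.invariant r hr
    have hlim := hμ.tendsto_sum_integral hu (b := b) (F := fun w => f.toFun ((inner ℂ u w : ℂ) • u))
      (summable_norm_mul_pow hb hr.1.le hr.2)
      (fun w hw => hb _ (((norm_inner_le_of_norm_eq_one hu).trans hw).trans_lt hr.2))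
    have h1 : ∫ w, ‖f.toFun ((inner ℂ u w : ℂ) • u)‖ ^ 2 ∂μ r ≤ ‖f‖ ^ 2 := by
      have h2 := (hμ.lintegral_slice_le hu hf).trans (hp.lintegral_le r hr _ hf)
      have hm : Measurable fun w : Cn N => f.toFun ((inner ℂ u w : ℂ) • u) :=
        hf.measurable.comp (Continuous.measurable (by fun_prop))
      rw [integral_eq_lintegral_of_nonneg_ae (Eventually.of_forall fun w => sq_nonneg _)
        (hm.norm.pow_const 2).aestronglyMeasurable, HoloSpace.norm_def, ← ENNReal.toReal_pow]
      refine ENNReal.toReal_mono (ENNReal.pow_ne_top hfin) ?_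
      refine le_trans (le_of_eq (lintegral_congr fun w => ?_)) h2
      rw [ENNReal.ofReal_pow (norm_nonneg _), ofReal_norm]
    refine le_trans (ge_of_tendsto hlim ?_) h1
    filter_upwards [eventually_ge_atTop n] with m hm
    exact Finset.sum_le_sum_of_subset_of_nonneg (Finset.range_mono hm) fun k _ _ =>
      mul_nonneg (sq_nonneg _) (integral_nonneg fun w => by positivity)
  have hlim : Tendsto (fun r => ∑ k ∈ Finset.range n,
      ‖b k‖ ^ 2 * ∫ w, ‖(inner ℂ u w : ℂ)‖ ^ (2 * k) ∂μ r) (𝓝[<] 1)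
      (𝓝 (∑ k ∈ Finset.range n, ‖b k‖ ^ 2 * (powCoeff β k)⁻¹)) :=
    tendsto_finsetSum _ fun k _ => (hp.moment_tendsto u hu k).const_mul _
  refine le_of_tendsto hlim ?_
  filter_upwards [Ioo_mem_nhdsLT (zero_lt_one' ℝ)] with r h using hr r h

/-- With a = ρu, the kernel is a series in ⟨·, u⟩ with coefficients `powCoeff β k` · ρ^k. The moment
bounds reduce its squared norm to the series Σ `powCoeff β k` · ρ^(2k) = (1 − ρ²)^(−β). -/
theorem exists_kernel [NeZero N] (hp : HasInvariantMeasures p β μ) {a : Cn N} (ha : ‖a‖ < 1) :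
    ∃ f : HoloSpace p, (∀ z : Cn N, ‖z‖ < 1 → f.toFun z = (1 - inner ℂ a z) ^ (-(β : ℂ))) ∧
      ‖f‖ ≤ (1 - ‖a‖ ^ 2) ^ (-(β / 2)) := by
  have hβ := hp.pos
  obtain ⟨u, hu, hau⟩ : ∃ u : Cn N, ‖u‖ = 1 ∧ a = ((‖a‖ : ℝ) : ℂ) • u := by
    rcases eq_or_ne a 0 with rfl | h
    · exact ⟨EuclideanSpace.single 0 1, by simp, by simp⟩
    · have h0 : ‖a‖ ≠ 0 := norm_ne_zero_iff.2 h
      refine ⟨((‖a‖⁻¹ : ℝ) : ℂ) • a, ?_, ?_⟩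
      · rw [norm_smul, Complex.norm_real, norm_inv, norm_norm, inv_mul_cancel₀ h0]
      · rw [smul_smul, ← Complex.ofReal_mul, mul_inv_cancel₀ h0, Complex.ofReal_one, one_smul]
  set ρ := ‖a‖ with hρ
  have hρ0 : 0 ≤ ρ := norm_nonneg _
  have hin : ∀ z : Cn N, (inner ℂ a z : ℂ) = (ρ : ℂ) * inner ℂ u z := fun z => by
    rw [hau, inner_smul_left, Complex.conj_ofReal]
  set g : Cn N → ℂ := (unitBall N).indicator fun z => (1 - inner ℂ a z) ^ (-(β : ℂ)) with hg
  have hgz : ∀ z : Cn N, ‖z‖ < 1 → g z = (1 - inner ℂ a z) ^ (-(β : ℂ)) := fun z hz =>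
    indicator_of_mem (mem_ball_zero_iff.2 hz) _
  have hgh : IsHolo g := by
    refine ⟨?_, fun z hz => indicator_of_notMem hz _⟩
    refine DifferentiableOn.congr (f := fun z => (1 - inner ℂ a z : ℂ) ^ (-(β : ℂ))) ?_
      fun z hz => hgz z (mem_ball_zero_iff.1 hz)
    have hinner : Differentiable ℂ fun z : Cn N => (inner ℂ a z : ℂ) := (innerSL ℂ a).differentiable
    refine DifferentiableOn.cpow_const (by fun_prop) fun z hz => ?_
    have h1 := norm_inner_lt_one ha (mem_ball_zero_iff.1 hz).le
    have := Complex.mem_slitPlane_of_norm_lt_one (z := -inner ℂ a z) (by rwa [norm_neg])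
    rwa [← sub_eq_add_neg] at this
  set b : ℕ → ℂ := fun k => (powCoeff β k : ℂ) * (ρ : ℂ) ^ k with hb
  have hsum : ∀ z : ℂ, ‖z‖ < 1 → HasSum (fun k => b k * z ^ k) ((1 - ρ * z) ^ (-(β : ℂ))) := by
    intro z hz
    have h1 : ‖(ρ : ℂ) * z‖ < 1 := by
      rw [norm_mul, Complex.norm_real, Real.norm_of_nonneg hρ0]
      nlinarith [norm_nonneg z]
    refine (hasSum_powCoeff hβ h1).congr_fun fun k => ?_
    simp only [hb]
    rw [mul_pow, mul_assoc]
  have hreal := hasSum_powCoeff_real hβ (sq_nonneg ρ) (by nlinarith : ρ ^ 2 < 1)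
  have hx0 : 0 < 1 - ρ ^ 2 := by nlinarith
  have hle : p.toFun g ≤ ENNReal.ofReal ((1 - ρ ^ 2) ^ (-(β / 2))) := by
    refine hp.le_of_lintegral_le g hgh _ fun r hr => ?_
    have hμ := hp.invariant r hr
    have := hμ.finite
    have hF : ∀ w : Cn N, ‖w‖ ≤ r → HasSum (fun k => b k * (inner ℂ u w : ℂ) ^ k) (g w) := by
      intro w hw
      rw [hgz w (hw.trans_lt hr.2), hin]
      exact hsum _ (((norm_inner_le_of_norm_eq_one hu).trans hw).trans_lt hr.2)
    have hlim := hμ.tendsto_sum_integral hu (b := b) (F := g)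
      (summable_norm_mul_pow hsum hr.1.le hr.2) hF
    have h1 : ∫ w, ‖g w‖ ^ 2 ∂μ r ≤ (1 - ρ ^ 2) ^ (-β) := by
      refine le_of_tendsto_of_tendsto' hlim hreal.tendsto_sum_nat fun n =>
        Finset.sum_le_sum fun k _ => ?_
      have hc := powCoeff_pos hβ k
      have hbk : ‖b k‖ ^ 2 = powCoeff β k ^ 2 * (ρ ^ 2) ^ k := by
        simp only [hb]
        rw [norm_mul, norm_pow, Complex.norm_real, Complex.norm_real, Real.norm_of_nonneg hρ0,
          Real.norm_of_nonneg hc.le]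
        ring
      calc _ ≤ ‖b k‖ ^ 2 * (powCoeff β k)⁻¹ := by
            gcongr; exact hp.moment_le u hu k r hr
        _ = _ := by rw [hbk]; field_simp
    have hint : Integrable (fun w => ‖g w‖ ^ 2) (μ r) := by
      refine Integrable.of_bound (hgh.measurable.norm.pow_const 2).aestronglyMeasurable
        ((∑' k, ‖b k‖ * r ^ k) ^ 2) ?_
      filter_upwards [hμ.ae_norm_le] with w hw
      rw [Real.norm_of_nonneg (sq_nonneg _)]
      refine pow_le_pow_left₀ (norm_nonneg _) ?_ 2
      rw [← (hF w hw).tsum_eq]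
      refine tsum_of_norm_bounded (summable_norm_mul_pow hsum hr.1.le hr.2).hasSum fun k => ?_
      rw [norm_mul, norm_pow]
      have := (norm_inner_le_of_norm_eq_one (w := w) hu).trans hw
      gcongr
    have h2 : ∫⁻ w, ‖g w‖ₑ ^ 2 ∂μ r = ENNReal.ofReal (∫ w, ‖g w‖ ^ 2 ∂μ r) := by
      rw [ofReal_integral_eq_lintegral_ofReal hint (Eventually.of_forall fun w => sq_nonneg _)]
      refine lintegral_congr fun w => ?_
      rw [ENNReal.ofReal_pow (norm_nonneg _), ofReal_norm]
    rw [h2, ← ENNReal.ofReal_pow (Real.rpow_nonneg hx0.le _), pow_two, ← Real.rpow_add hx0,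
      ← neg_add, add_halves]
    exact ENNReal.ofReal_le_ofReal h1
  obtain ⟨f, hf⟩ : ∃ f : HoloSpace p, f.toFun = g :=
    ⟨⟨g, hgh, hle.trans_lt ENNReal.ofReal_lt_top⟩, rfl⟩
  refine ⟨f, fun z hz => by rw [hf, hgz z hz], ?_⟩
  rw [HoloSpace.norm_def, hf]
  exact ENNReal.toReal_le_of_le_ofReal (Real.rpow_nonneg hx0.le _) hle

theorem hasPowerKernel [NeZero N] (hp : HasInvariantMeasures p β μ) : HasPowerKernel p β where
  pos := hp.pos
  eval_le ζ hζ f w hw := by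
    obtain ⟨b, hb⟩ := IsHolo.hasSum_slice (f := f.toFun) f.2.1 hζ
    have h := rpow_half_mul_norm_le hp.pos (norm_nonneg f) (n := 0) (fun m => by
      rw [← Finset.range_eq_Ico]; exact hp.sum_coeff_le f hζ hb m) hw (hb w hw)
    simpa using h
  eval_tendsto ζ hζ f := by
    obtain ⟨b, hb⟩ := IsHolo.hasSum_slice (f := f.toFun) f.2.1 hζ
    exact tendsto_rpow_half_mul_norm hp.pos (hp.sum_coeff_le f hζ hb) hb
  exists_kernel a ha := hp.exists_kernel ha

end HasInvariantMeasures

end BallCompOp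

namespace BallCompOp

/-! ### Moments of linear functionals on the sphere -/

/-- Integration in polar coordinates. -/
theorem lintegral_polar {E : Type*} [NormedAddCommGroup E] [NormedSpace ℝ E] [MeasurableSpace E]
    [BorelSpace E] [FiniteDimensional ℝ E] [Nontrivial E] (μ : Measure E) [μ.IsAddHaarMeasure]
    {f : E → ℝ≥0∞} (hf : Measurable f) :
    ∫⁻ x, f x ∂μ = ∫⁻ ξ : sphere (0 : E) 1, (∫⁻ r in Ioi (0 : ℝ),
      ENNReal.ofReal (r ^ (Module.finrank ℝ E - 1)) * f (r • (ξ : E))) ∂μ.toSphere := by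
  have hsymm := μ.measurePreserving_homeomorphUnitSphereProd.symm
    (homeomorphUnitSphereProd E).toMeasurableEquiv
  have hg : Measurable fun q : sphere (0 : E) 1 × Ioi (0 : ℝ) => f ((q.2 : ℝ) • (q.1 : E)) :=
    hf.comp (Continuous.measurable (by fun_prop))
  calc ∫⁻ x, f x ∂μ = ∫⁻ x : ({(0)}ᶜ : Set E), f x ∂(μ.comap (↑)) := by
        rw [lintegral_subtype_comap (measurableSet_singleton _).compl, restrict_compl_singleton]
    _ = ∫⁻ q : sphere (0 : E) 1 × Ioi (0 : ℝ), f ((q.2 : ℝ) • (q.1 : E))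
          ∂(μ.toSphere.prod (.volumeIoiPow (Module.finrank ℝ E - 1))) := by
        rw [← hsymm.lintegral_comp (f := fun x => f x.1) (hf.comp measurable_subtype_coe)]
        exact lintegral_congr fun q => by simp
    _ = _ := by
        rw [lintegral_prod _ hg.aemeasurable]
        refine lintegral_congr fun ξ => ?_
        have hm : Measurable fun r : Ioi (0 : ℝ) => f ((r : ℝ) • (ξ : E)) :=
          hf.comp (Continuous.measurable (by fun_prop))
        refine (lintegral_withDensity_eq_lintegral_mul _ (by fun_prop) hm).trans ?_
        exact lintegral_subtype_comap measurableSet_Ioi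
          (fun r : ℝ => ENNReal.ofReal (r ^ (Module.finrank ℝ E - 1)) * f (r • (ξ : E)))

theorem lintegral_comp_sq (g : ℝ → ℝ≥0∞) {s t : Set ℝ} (hs : MeasurableSet s) (hs0 : s ⊆ Ioi 0)
    (hst : (fun r : ℝ => r ^ 2) '' s = t) :
    ∫⁻ x in t, g x = ∫⁻ r in s, ENNReal.ofReal (2 * r) * g (r ^ 2) := by
  rw [← hst, lintegral_image_eq_lintegral_abs_deriv_mul (f' := fun r => 2 * r) hs
    (fun x _ => by simpa using (hasDerivAt_pow 2 x).hasDerivWithinAt)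
    (fun x hx y hy h => (pow_left_inj₀ (hs0 hx).le (hs0 hy).le two_ne_zero).1 h)]
  refine setLIntegral_congr_fun hs fun r hr => ?_
  have : 0 < r := hs0 hr
  rw [abs_of_pos (by positivity)]

variable {N : ℕ}

theorem finrank_real_Cn (N : ℕ) : Module.finrank ℝ (Cn N) = 2 * N := by
  rw [← Module.finrank_mul_finrank ℝ ℂ (Cn N), Complex.finrank_real_complex, finrank_euclideanSpace,
    Fintype.card_fin]

instance nontrivial_Cn [NeZero N] : Nontrivial (Cn N) :=
  ⟨⟨EuclideanSpace.single 0 1, 0, fun h => by simpa using congrArg norm h⟩⟩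

/-- The integral of `|⟨ξ, u⟩|^{2k}` over the sphere, with respect to unnormalised surface measure. -/
noncomputable def sphereMoment (u : Cn N) (k : ℕ) : ℝ≥0∞ :=
  ∫⁻ ξ : sphere (0 : Cn N) 1, ‖(inner ℂ u (ξ : Cn N) : ℂ)‖ₑ ^ (2 * k)
    ∂(volume : Measure (Cn N)).toSphere

/-- Polar coordinates for the product of a power of a linear functional and a radial function. -/
theorem lintegral_inner_pow_mul_radial [NeZero N] (u : Cn N) (k : ℕ) {h : ℝ → ℝ≥0∞}
    (hh : Measurable h) :
    2 * ∫⁻ x : Cn N, ‖(inner ℂ u x : ℂ)‖ₑ ^ (2 * k) * h (‖x‖ ^ 2) =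
      sphereMoment u k * ∫⁻ x in Ioi (0 : ℝ), ENNReal.ofReal (x ^ (N + k - 1)) * h x := by
  have hN : 1 ≤ N := Nat.one_le_iff_ne_zero.2 (NeZero.ne N)
  have him : (fun r : ℝ => r ^ 2) '' Ioi 0 = Ioi 0 := by
    ext x
    constructor
    · rintro ⟨r, hr, rfl⟩
      exact pow_pos (mem_Ioi.1 hr) 2
    · intro hx
      exact ⟨√x, Real.sqrt_pos.2 hx, Real.sq_sqrt (le_of_lt hx)⟩
  have hinner : Continuous fun x : Cn N => (inner ℂ u x : ℂ) := by fun_prop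
  rw [lintegral_polar volume (f := fun x => ‖(inner ℂ u x : ℂ)‖ₑ ^ (2 * k) * h (‖x‖ ^ 2)) ((hinner.measurable.enorm.pow_const _).mul
    (hh.comp (measurable_norm.pow_const 2))), finrank_real_Cn]
  have key : ∀ ξ : sphere (0 : Cn N) 1, ∫⁻ r in Ioi (0 : ℝ), ENNReal.ofReal (r ^ (2 * N - 1)) *
      (‖(inner ℂ u (r • (ξ : Cn N)) : ℂ)‖ₑ ^ (2 * k) * h (‖r • (ξ : Cn N)‖ ^ 2)) =
      ‖(inner ℂ u (ξ : Cn N) : ℂ)‖ₑ ^ (2 * k) *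
        ∫⁻ r in Ioi (0 : ℝ), ENNReal.ofReal (r ^ (2 * N - 1 + 2 * k)) * h (r ^ 2) := by
    intro ξ
    rw [← lintegral_const_mul _ (by fun_prop)]
    refine setLIntegral_congr_fun measurableSet_Ioi fun r hr => ?_
    have hr0 : 0 < r := hr
    have hξ : ‖(ξ : Cn N)‖ = 1 := by simp
    have e : (inner ℂ u (r • (ξ : Cn N)) : ℂ) = (r : ℂ) * inner ℂ u (ξ : Cn N) := by
      rw [← Complex.coe_smul, inner_smul_right]
    have e2 : ‖(r : ℂ)‖ₑ = ENNReal.ofReal r := by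
      rw [← ofReal_norm, Complex.norm_real, Real.norm_of_nonneg hr0.le]
    rw [e, enorm_mul, mul_pow, e2, norm_smul, hξ, mul_one, Real.norm_of_nonneg hr0.le, pow_add,
      ENNReal.ofReal_mul (by positivity), ENNReal.ofReal_pow hr0.le (2 * k)]
    ring
  simp only [key]
  rw [lintegral_mul_const _ (by fun_prop), mul_left_comm, sphereMoment,
    lintegral_comp_sq (fun x => ENNReal.ofReal (x ^ (N + k - 1)) * h x) measurableSet_Ioi
      subset_rfl him, ← lintegral_const_mul _ (by fun_prop)]
  congr 1
  -- After x = r² the exponents agree: 2(N + k − 1) and one more from dx = 2r dr make 2N − 1 + 2k.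
  refine setLIntegral_congr_fun measurableSet_Ioi fun r hr => ?_
  have hr0 : 0 < r := hr
  rw [← mul_assoc, ← mul_assoc, ← ENNReal.ofReal_mul (by positivity),
    show (2 : ℝ≥0∞) = ENNReal.ofReal 2 by simp, ← ENNReal.ofReal_mul (by positivity)]
  congr 2
  rw [← pow_mul, mul_assoc, ← pow_succ']
  congr 2
  omega

theorem exists_unitary_map_eq_single [NeZero N] {u : Cn N} (hu : ‖u‖ = 1) :
    ∃ U : Cn N ≃ₗᵢ[ℂ] Cn N, ∀ x, (inner ℂ u x : ℂ) = U x 0 := by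
  have hv : Orthonormal ℂ (({0} : Set (Fin N)).domRestrict fun _ => u) := by
    refine ⟨fun _ => hu, fun i j hij => ?_⟩
    exact absurd (Subtype.ext (i.2.trans j.2.symm)) hij
  obtain ⟨b, hb⟩ := hv.exists_orthonormalBasis_extension_of_card_eq
    (by rw [finrank_euclideanSpace])
  refine ⟨b.repr, fun x => ?_⟩
  rw [b.repr_apply_apply, hb 0 rfl]

theorem integral_norm_pow_mul_exp (m : ℕ) :
    ∫ z : ℂ, ‖z‖ ^ (2 * m) * Real.exp (-‖z‖ ^ 2) = Real.pi * m.factorial := by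
  have h := Complex.integral_rpow_mul_exp_neg_rpow (p := 2) (q := ((2 * m : ℕ) : ℝ)) (by norm_num)
    (by push_cast; linarith [(Nat.cast_nonneg m : (0 : ℝ) ≤ m)])
  have e : (((2 * m : ℕ) : ℝ) + 2) / 2 = (m : ℝ) + 1 := by push_cast; ring
  rw [e, Real.Gamma_nat_eq_factorial] at h
  simp only [Real.rpow_natCast, Real.rpow_two] at h
  rw [h]
  ring

/-- A unitary change of variables makes u the first basis vector; the Gaussian then factors over
coordinates, and only the first factor depends on k. -/
theorem exists_gaussian_moment (N : ℕ) [NeZero N] : ∃ c : ℝ≥0∞, ∀ u : Cn N, ‖u‖ = 1 → ∀ k : ℕ,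
    ∫⁻ x : Cn N, ‖(inner ℂ u x : ℂ)‖ₑ ^ (2 * k) * ENNReal.ofReal (Real.exp (-‖x‖ ^ 2)) =
      c * k.factorial := by
  set L := PiLp.continuousLinearEquiv 2 ℝ (fun _ : Fin N => ℂ) with hL
  have hHaar : ((volume : Measure (Cn N)).map L).IsAddHaarMeasure :=
    L.isAddHaarMeasure_map volume
  -- Uniqueness of Haar measure compares the Euclidean volume with the product volume. The constant
  -- can stay unknown, since only ratios of moments are used.
  obtain ⟨c, hc⟩ : ∃ c : ℝ≥0, (volume : Measure (Cn N)).map L = c • volume :=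
    ⟨_, Measure.isAddLeftInvariant_eq_smul _ _⟩
  refine ⟨c * ENNReal.ofReal (Real.pi ^ N), fun u hu k => ?_⟩
  obtain ⟨U, hU⟩ := exists_unitary_map_eq_single hu
  set q : Fin N → ℕ := fun i => if i = 0 then k else 0 with hq
  set g : Fin N → ℂ → ℝ := fun i z => ‖z‖ ^ (2 * q i) * Real.exp (-‖z‖ ^ 2) with hg
  have hgi : ∀ i, Integrable (g i) := fun i => by
    -- A nonintegrable function has Bochner integral 0, so the explicit nonzero value proves
    -- integrability.
    refine Integrable.of_integral_ne_zero ?_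
    rw [hg, integral_norm_pow_mul_exp]
    have := (q i).factorial_pos
    positivity
  have hgint : Integrable (fun y : Fin N → ℂ => ∏ i, g i (y i)) volume :=
    Integrable.fintype_prod_dep hgi
  have hprod : ∫⁻ y : Fin N → ℂ, ENNReal.ofReal (∏ i, g i (y i)) =
      ENNReal.ofReal (Real.pi ^ N * k.factorial) := by
    rw [← ofReal_integral_eq_lintegral_ofReal hgint
      (Eventually.of_forall fun y => Finset.prod_nonneg fun i _ => by simp only [hg]; positivity),
      integral_fintype_prod_volume_eq_prod]
    congr 1
    simp only [hg, integral_norm_pow_mul_exp]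
    rw [Finset.prod_mul_distrib, Finset.prod_const, Finset.card_univ, Fintype.card_fin,
      Finset.prod_eq_single (0 : Fin N)]
    · simp [hq]
    · intro i _ hi; simp [hq, hi]
    · simp
  have hgm : Measurable fun y : Fin N → ℂ => ENNReal.ofReal (∏ i, g i (y i)) := by
    refine ENNReal.measurable_ofReal.comp (Continuous.measurable ?_)
    simp only [hg]
    fun_prop
  have hpt : ∀ x : Cn N, ENNReal.ofReal (∏ i, g i (L x i)) =
      ‖x 0‖ₑ ^ (2 * k) * ENNReal.ofReal (Real.exp (-‖x‖ ^ 2)) := by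
    intro x
    have : ∏ i, g i (L x i) = ‖x 0‖ ^ (2 * k) * Real.exp (-‖x‖ ^ 2) := by
      simp only [hg]
      rw [Finset.prod_mul_distrib, ← Real.exp_sum, Finset.sum_neg_distrib,
        EuclideanSpace.norm_sq_eq x, Finset.prod_eq_single (0 : Fin N)]
      · simp [hq, hL]
      · intro i _ hi; simp [hq, hi]
      · simp
    rw [this, ENNReal.ofReal_mul (by positivity), ENNReal.ofReal_pow (norm_nonneg _), ofReal_norm]
  have hUmp : MeasurePreserving U (volume : Measure (Cn N)) volume :=
    LinearIsometryEquiv.measurePreserving ⟨U.toLinearEquiv.restrictScalars ℝ, U.norm_map⟩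
  have hm : Measurable fun x : Cn N => ‖x 0‖ₑ ^ (2 * k) * ENNReal.ofReal (Real.exp (-‖x‖ ^ 2)) := by
    have : Continuous fun x : Cn N => x 0 := by fun_prop
    exact (this.measurable.enorm.pow_const _).mul
      (ENNReal.measurable_ofReal.comp (Continuous.measurable (by fun_prop)))
  calc _ = ∫⁻ x : Cn N, ‖U x 0‖ₑ ^ (2 * k) * ENNReal.ofReal (Real.exp (-‖U x‖ ^ 2)) := by
        simp only [hU, U.norm_map]
    _ = ∫⁻ x : Cn N, ‖x 0‖ₑ ^ (2 * k) * ENNReal.ofReal (Real.exp (-‖x‖ ^ 2)) :=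
        hUmp.lintegral_comp hm
    _ = ∫⁻ y, ENNReal.ofReal (∏ i, g i (y i)) ∂((volume : Measure (Cn N)).map L) := by
        rw [lintegral_map hgm L.continuous.measurable]
        exact lintegral_congr fun x => (hpt x).symm
    _ = _ := by
        rw [hc, lintegral_smul_measure, hprod, ENNReal.ofReal_mul (by positivity),
          ENNReal.ofReal_natCast, mul_assoc]
        rfl

theorem sphereMoment_zero (u : Cn N) :
    sphereMoment u 0 = (volume : Measure (Cn N)).toSphere univ := by
  simp [sphereMoment]

/-- Polar coordinates turn the Gaussian moment into the sphere moment times Γ(N + k). Dividing by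
the case k = 0 removes the unknown constant and leaves k! Γ(N)/Γ(N + k). -/
theorem sphereMoment_eq [NeZero N] {u : Cn N} (hu : ‖u‖ = 1) (k : ℕ) :
    sphereMoment u k = (volume : Measure (Cn N)).toSphere univ *
      ENNReal.ofReal (powCoeff N k)⁻¹ := by
  have hN : 0 < N := Nat.pos_of_ne_zero (NeZero.ne N)
  have hNr : (0 : ℝ) < N := by exact_mod_cast hN
  obtain ⟨c, hc⟩ := exists_gaussian_moment N
  have h : ∀ k : ℕ, 2 * (c * k.factorial) =
      sphereMoment u k * ENNReal.ofReal (Real.Gamma (N + k)) := by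
    intro k
    rw [← hc u hu k, lintegral_inner_pow_mul_radial u k
      (h := fun x => ENNReal.ofReal (Real.exp (-x))) (by fun_prop)]
    congr 1
    rw [Real.Gamma_eq_integral (by positivity), ofReal_integral_eq_lintegral_ofReal
      (Real.GammaIntegral_convergent (by positivity)) ?_]
    · refine setLIntegral_congr_fun measurableSet_Ioi fun x hx => ?_
      have hx0 : 0 < x := hx
      rw [← ENNReal.ofReal_mul (by positivity), mul_comm]
      congr 2
      rw [← Real.rpow_natCast, Nat.cast_sub (by omega)]
      push_cast
      rfl
    · filter_upwards [ae_restrict_mem measurableSet_Ioi] with x hx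
      have hx0 : 0 < x := hx
      simp only [Pi.zero_apply]
      positivity
  have h0 := h 0
  have hk := h k
  rw [sphereMoment_zero, Nat.factorial_zero, Nat.cast_one, mul_one, Nat.cast_zero, add_zero] at h0
  have hG : 0 < Real.Gamma (N + k) := Real.Gamma_pos_of_pos (by positivity)
  have hG0 : 0 < Real.Gamma N := Real.Gamma_pos_of_pos hNr
  rw [← mul_assoc, h0] at hk
  have hne : ENNReal.ofReal (Real.Gamma (N + k)) ≠ 0 := by simpa using hG
  refine (ENNReal.mul_left_inj hne ENNReal.ofReal_ne_top).1 ?_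
  rw [← hk, mul_assoc, mul_assoc, ← ENNReal.ofReal_mul (inv_nonneg.2 (powCoeff_pos hNr k).le),
    ← ENNReal.ofReal_natCast, ← ENNReal.ofReal_mul hG0.le]
  congr 2
  rw [powCoeff]
  field_simp

end BallCompOp

namespace BallCompOp

variable {N : ℕ}

/-! ### Squared norms as lower integrals, and unitary invariance of volume -/

theorem eLpNorm_two_sq {α : Type*} [MeasurableSpace α] (f : α → ℂ) (μ : Measure α) :
    eLpNorm f 2 μ ^ 2 = ∫⁻ x, ‖f x‖ₑ ^ 2 ∂μ := by
  have h := eLpNorm_nnreal_pow_eq_lintegral (f := f) (μ := μ) (p := 2) two_ne_zero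
  simpa using h

theorem integral_norm_pow_eq_of_lintegral {α : Type*} [MeasurableSpace α] {μ : Measure α} {g : α → ℂ}
    (hg : Measurable g) {n : ℕ} {c : ℝ} (hc : 0 ≤ c)
    (h : ∫⁻ x, ‖g x‖ₑ ^ n ∂μ = ENNReal.ofReal c) :
    Integrable (fun x => ‖g x‖ ^ n) μ ∧ ∫ x, ‖g x‖ ^ n ∂μ = c := by
  have e : ∫⁻ x, ENNReal.ofReal (‖g x‖ ^ n) ∂μ = ENNReal.ofReal c := by
    rw [← h]
    exact lintegral_congr fun x => by rw [ENNReal.ofReal_pow (norm_nonneg _), ofReal_norm]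
  have hm : AEStronglyMeasurable (fun x => ‖g x‖ ^ n) μ := (hg.norm.pow_const n).aestronglyMeasurable
  refine ⟨⟨hm, ?_⟩, ?_⟩
  · rw [hasFiniteIntegral_iff_ofReal (Eventually.of_forall fun x => by positivity), e]
    exact ENNReal.ofReal_lt_top
  · rw [integral_eq_lintegral_of_nonneg_ae (Eventually.of_forall fun x => by positivity) hm, e,
      ENNReal.toReal_ofReal hc]

theorem measurePreserving_unitary (U : Cn N ≃ₗᵢ[ℂ] Cn N) :
    MeasurePreserving U (volume : Measure (Cn N)) volume :=
  LinearIsometryEquiv.measurePreserving ⟨U.toLinearEquiv.restrictScalars ℝ, U.norm_map⟩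

/-! ### The Hardy space -/

theorem toSphere_univ_ne_zero [NeZero N] : (volume : Measure (Cn N)).toSphere univ ≠ 0 := by
  rw [Measure.measure_univ_ne_zero]
  exact Measure.toSphere_ne_zero _

theorem sigma_univ [NeZero N] : sigma N univ = 1 := by
  rw [sigma, Measure.smul_apply, smul_eq_mul,
    ENNReal.inv_mul_cancel toSphere_univ_ne_zero (measure_ne_top _ _)]

theorem lintegral_sigma_inner_pow [NeZero N] {u : Cn N} (hu : ‖u‖ = 1) (k : ℕ) :
    ∫⁻ ξ : sphere (0 : Cn N) 1, ‖(inner ℂ u (ξ : Cn N) : ℂ)‖ₑ ^ (2 * k) ∂sigma N =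
      ENNReal.ofReal (powCoeff N k)⁻¹ := by
  rw [sigma, lintegral_smul_measure, ← sphereMoment, sphereMoment_eq hu, smul_eq_mul, ← mul_assoc,
    ENNReal.inv_mul_cancel toSphere_univ_ne_zero (measure_ne_top _ _), one_mul]

/-- The restriction of a unitary map to the unit sphere. -/
noncomputable def sphereMap (U : Cn N ≃ₗᵢ[ℂ] Cn N) (ξ : sphere (0 : Cn N) 1) : sphere (0 : Cn N) 1 :=
  ⟨U ξ, by simp⟩

theorem continuous_sphereMap (U : Cn N ≃ₗᵢ[ℂ] Cn N) : Continuous (sphereMap U) :=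
  (U.continuous.comp continuous_subtype_val).subtype_mk _

open scoped Pointwise in
theorem map_sphereMap_sigma (U : Cn N ≃ₗᵢ[ℂ] Cn N) : (sigma N).map (sphereMap U) = sigma N := by
  have hm := (continuous_sphereMap U).measurable
  have h : (volume : Measure (Cn N)).toSphere.map (sphereMap U) =
      (volume : Measure (Cn N)).toSphere := by
    ext s hs
    rw [Measure.map_apply hm hs, Measure.toSphere_apply' _ (hm hs), Measure.toSphere_apply' _ hs]
    congr 1
    -- `toSphere` measures a set by the volume of the cone over it, and a unitary map commutes with
    -- forming cones.
    have : Ioo (0 : ℝ) 1 • ((↑) '' (sphereMap U ⁻¹' s) : Set (Cn N)) =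
        U ⁻¹' (Ioo (0 : ℝ) 1 • ((↑) '' s : Set (Cn N))) := by
      ext x
      simp only [Set.mem_smul, mem_image, mem_preimage]
      constructor
      · rintro ⟨r, hr, _, ⟨ξ, hξ, rfl⟩, rfl⟩
        refine ⟨r, hr, _, ⟨_, hξ, rfl⟩, ?_⟩
        rw [← Complex.coe_smul, ← Complex.coe_smul, map_smul]
        rfl
      · rintro ⟨r, hr, _, ⟨ξ, hξ, rfl⟩, h⟩
        refine ⟨r, hr, _, ⟨sphereMap U.symm ξ, ?_, rfl⟩, ?_⟩
        · have : sphereMap U (sphereMap U.symm ξ) = ξ := Subtype.ext (U.apply_symm_apply _)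
          rwa [this]
        · apply U.injective
          rw [← h, ← Complex.coe_smul, ← Complex.coe_smul, map_smul]
          congr 1
          exact U.apply_symm_apply _
    rw [this]
    exact (measurePreserving_unitary U).measure_preimage_emb
      U.toHomeomorph.measurableEmbedding _
  rw [sigma, Measure.map_smul, h]

/-- The normalised surface measure of the sphere of radius `r`. -/
noncomputable def dilatedSigma (N : ℕ) (r : ℝ) : Measure (Cn N) :=
  (sigma N).map fun ξ : sphere (0 : Cn N) 1 => r • (ξ : Cn N)

theorem continuous_dilation (r : ℝ) :
    Continuous fun ξ : sphere (0 : Cn N) 1 => r • (ξ : Cn N) := by fun_prop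

theorem isUnitaryInvariant_dilatedSigma [NeZero N] {r : ℝ} (hr : r ∈ Ioo (0 : ℝ) 1) :
    IsUnitaryInvariant (dilatedSigma N r) r where
  finite := by
    refine ⟨?_⟩
    rw [dilatedSigma, Measure.map_apply (continuous_dilation r).measurable .univ, preimage_univ,
      sigma_univ]
    exact ENNReal.one_lt_top
  nonneg := hr.1.le
  lt_one := hr.2
  ae_norm_le := by
    rw [dilatedSigma, ae_map_iff (continuous_dilation r).aemeasurable
      (measurableSet_le measurable_norm measurable_const)]
    refine Eventually.of_forall fun ξ => ?_
    have : ‖(ξ : Cn N)‖ = 1 := by simp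
    rw [norm_smul, this, mul_one, Real.norm_of_nonneg hr.1.le]
  map_eq U := by
    rw [dilatedSigma, Measure.map_map U.continuous.measurable (continuous_dilation r).measurable]
    conv_rhs => rw [← map_sphereMap_sigma U, Measure.map_map (continuous_dilation r).measurable
      (continuous_sphereMap U).measurable]
    congr 1
    ext1 ξ
    simp only [Function.comp_apply]
    rw [← Complex.coe_smul, map_smul, Complex.coe_smul]
    rfl

theorem lintegral_dilatedSigma {f : Cn N → ℂ} (hf : IsHolo f) (r : ℝ) :
    ∫⁻ w, ‖f w‖ₑ ^ 2 ∂dilatedSigma N r =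
      eLpNorm (fun ξ : sphere (0 : Cn N) 1 => f (r • (ξ : Cn N))) 2 (sigma N) ^ 2 := by
  rw [eLpNorm_two_sq, dilatedSigma,
    lintegral_map (hf.measurable.enorm.pow_const 2) (continuous_dilation r).measurable]

theorem integral_dilatedSigma_inner_pow [NeZero N] {u : Cn N} (hu : ‖u‖ = 1) (k : ℕ) {r : ℝ}
    (hr : 0 ≤ r) : ∫ w, ‖(inner ℂ u w : ℂ)‖ ^ (2 * k) ∂dilatedSigma N r =
      r ^ (2 * k) * (powCoeff N k)⁻¹ := by
  have hN : (0 : ℝ) < N := by exact_mod_cast Nat.pos_of_ne_zero (NeZero.ne N)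
  have h := (integral_norm_pow_eq_of_lintegral (μ := sigma N)
    (g := fun ξ : sphere (0 : Cn N) 1 => inner ℂ u (ξ : Cn N))
    (Continuous.measurable (by fun_prop)) (inv_nonneg.2 (powCoeff_pos hN k).le)
    (lintegral_sigma_inner_pow hu k)).2
  rw [dilatedSigma, integral_map (continuous_dilation r).aemeasurable
    (Continuous.aestronglyMeasurable (by fun_prop)), ← h, ← integral_const_mul]
  congr 1
  ext ξ
  rw [← Complex.coe_smul, inner_smul_right, norm_mul, Complex.norm_real, Real.norm_of_nonneg hr,
    mul_pow]

theorem hasInvariantMeasures_hardyNorm (N : ℕ) [NeZero N] :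
    HasInvariantMeasures (hardyNorm N) N (dilatedSigma N) where
  pos := by exact_mod_cast Nat.pos_of_ne_zero (NeZero.ne N)
  invariant r hr := isUnitaryInvariant_dilatedSigma hr
  lintegral_le r hr f hf := by
    rw [lintegral_dilatedSigma hf]
    exact pow_le_pow_left' (le_iSup₂_of_le (f := fun (r : ℝ) (_ : r ∈ Ioo (0 : ℝ) 1) =>
        eLpNorm (fun ξ : sphere (0 : Cn N) 1 => f (r • (ξ : Cn N))) 2 (sigma N)) r hr le_rfl) 2
  le_of_lintegral_le f hf C hC := by
    refine iSup₂_le fun r hr => ?_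
    have h := hC r hr
    rw [lintegral_dilatedSigma hf] at h
    exact (ENNReal.pow_right_strictMono two_ne_zero).le_iff_le.1 h
  moment_le u hu k r hr := by
    have hN : (0 : ℝ) < N := by exact_mod_cast Nat.pos_of_ne_zero (NeZero.ne N)
    rw [integral_dilatedSigma_inner_pow hu k hr.1.le]
    exact mul_le_of_le_one_left (inv_nonneg.2 (powCoeff_pos hN k).le)
      (pow_le_one₀ hr.1.le hr.2.le)
  moment_tendsto u hu k := by
    have h : Tendsto (fun r : ℝ => r ^ (2 * k) * (powCoeff N k)⁻¹) (𝓝[<] 1)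
        (𝓝 (powCoeff N k)⁻¹) := by
      apply Tendsto.mono_left _ nhdsWithin_le_nhds
      have : Continuous fun r : ℝ => r ^ (2 * k) * (powCoeff N k)⁻¹ := by fun_prop
      simpa using this.tendsto 1
    refine h.congr' ?_
    filter_upwards [Ioo_mem_nhdsLT (zero_lt_one' ℝ)] with r hr
    rw [integral_dilatedSigma_inner_pow hu k hr.1.le]

/-! ### The weighted Bergman spaces -/

/-- The Bergman weight as a function of `|z|²`. -/
noncomputable def radialWeight (N : ℕ) (s x : ℝ) : ℝ≥0∞ :=
  (Iio 1).indicator (fun x => ENNReal.ofReal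
    (Real.Gamma (N + s + 1) / (Real.Gamma (N + 1) * Real.Gamma (s + 1)) * (1 - x) ^ s)) x

theorem measurable_radialWeight (N : ℕ) (s : ℝ) : Measurable (radialWeight N s) :=
  Measurable.indicator (by fun_prop) measurableSet_Iio

theorem measurable_bergmanWeight (N : ℕ) (s : ℝ) :
    Measurable fun z : Cn N => ENNReal.ofReal (bergmanWeight N s z) := by
  unfold bergmanWeight
  fun_prop

theorem lintegral_bergmanMeasure (s : ℝ) {g : Cn N → ℝ≥0∞} (hg : Measurable g) :
    ∫⁻ w, g w ∂bergmanMeasure N s =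
      (volume (unitBall N))⁻¹ * ∫⁻ w, g w * radialWeight N s (‖w‖ ^ 2) := by
  rw [bergmanMeasure, lintegral_withDensity_eq_lintegral_mul _ (measurable_bergmanWeight N s) hg, nu,
    lintegral_smul_measure, ← lintegral_indicator measurableSet_ball, smul_eq_mul]
  congr 1
  refine lintegral_congr fun w => ?_
  rw [radialWeight]
  by_cases hw : w ∈ unitBall N
  · have hw1 : ‖w‖ < 1 := mem_ball_zero_iff.1 hw
    rw [indicator_of_mem hw, indicator_of_mem (show ‖w‖ ^ 2 ∈ Iio (1 : ℝ) from
      mem_Iio.2 (by nlinarith [norm_nonneg w]))]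
    rw [Pi.mul_apply, mul_comm]
    rfl
  · have hw1 : 1 ≤ ‖w‖ := not_lt.1 fun h => hw (mem_ball_zero_iff.2 h)
    rw [indicator_of_notMem hw, indicator_of_notMem (show ‖w‖ ^ 2 ∉ Iio (1 : ℝ) from
      fun h => by have := mem_Iio.1 h; nlinarith), mul_zero]

/-- A beta integral with parameters n and s + 1, read off from the total mass 1 of the beta
distribution. -/
theorem lintegral_radialWeight {s : ℝ} (hs : -1 < s) {n : ℕ} (hn : 0 < n) :
    ∫⁻ x in Ioi (0 : ℝ), ENNReal.ofReal (x ^ (n - 1)) * radialWeight N s x =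
      ENNReal.ofReal (Real.Gamma (N + s + 1) / (Real.Gamma (N + 1) * Real.Gamma (s + 1)) *
        (Real.Gamma n * Real.Gamma (s + 1) / Real.Gamma (n + s + 1))) := by
  set C := Real.Gamma (N + s + 1) / (Real.Gamma (N + 1) * Real.Gamma (s + 1)) with hC
  have hN : (0 : ℝ) ≤ N := N.cast_nonneg
  have hn0 : (0 : ℝ) < n := by exact_mod_cast hn
  have hs1 : 0 < s + 1 := by linarith
  have hC0 : 0 < C := by
    have a := Real.Gamma_pos_of_pos (show 0 < (N : ℝ) + s + 1 by linarith)
    have b := Real.Gamma_pos_of_pos (show 0 < (N : ℝ) + 1 by linarith)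
    have c := Real.Gamma_pos_of_pos hs1
    positivity
  have hB := ProbabilityTheory.beta_pos hn0 hs1
  set B := ProbabilityTheory.beta n (s + 1) with hBdef
  have hBeq : Real.Gamma n * Real.Gamma (s + 1) / Real.Gamma (n + s + 1) = B := by
    rw [hBdef, ProbabilityTheory.beta, add_assoc]
  have h1 := ProbabilityTheory.lintegral_betaPDF_eq_one hn0 hs1
  rw [ProbabilityTheory.lintegral_betaPDF, ← hBdef] at h1
  have hind : ∀ x, ENNReal.ofReal (x ^ (n - 1)) * radialWeight N s x =
      (Iio 1).indicator (fun x => ENNReal.ofReal (x ^ (n - 1)) * ENNReal.ofReal (C * (1 - x) ^ s)) x :=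
    fun x => by rw [radialWeight, ← hC, indicator_mul_right]
  simp only [hind]
  rw [lintegral_indicator measurableSet_Iio, Measure.restrict_restrict measurableSet_Iio,
    Iio_inter_Ioi, hBeq]
  calc _ = ∫⁻ x in Ioo (0 : ℝ) 1, ENNReal.ofReal (C * B) *
        ENNReal.ofReal (1 / B * x ^ ((n : ℝ) - 1) * (1 - x) ^ (s + 1 - 1)) := by
        refine setLIntegral_congr_fun measurableSet_Ioo fun x hx => ?_
        have hx0 : 0 < x := hx.1
        rw [← ENNReal.ofReal_mul (by positivity), ← ENNReal.ofReal_mul (by positivity),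
          ← Real.rpow_natCast x (n - 1), Nat.cast_sub (by omega), add_sub_cancel_right,
          Nat.cast_one]
        congr 1
        field_simp
    _ = _ := by
        rw [lintegral_const_mul _ (by fun_prop), h1, mul_one]

theorem lintegral_bergmanMeasure_inner_pow [NeZero N] {s : ℝ} (hs : -1 < s) {u : Cn N}
    (hu : ‖u‖ = 1) (k : ℕ) :
    ∫⁻ w, ‖(inner ℂ u w : ℂ)‖ₑ ^ (2 * k) ∂bergmanMeasure N s =
      ENNReal.ofReal (powCoeff (N + s + 1) k)⁻¹ := by
  have hN : 0 < N := Nat.pos_of_ne_zero (NeZero.ne N)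
  have hNr : (0 : ℝ) < N := by exact_mod_cast hN
  have hm : Measurable fun w : Cn N => ‖(inner ℂ u w : ℂ)‖ₑ ^ (2 * k) := by
    have : Continuous fun w : Cn N => (inner ℂ u w : ℂ) := by fun_prop
    exact this.measurable.enorm.pow_const _
  have hV0 : volume (unitBall N) ≠ 0 := (measure_ball_pos volume (0 : Cn N) one_pos).ne'
  have hVt : volume (unitBall N) ≠ ∞ := measure_ball_lt_top.ne
  rw [lintegral_bergmanMeasure s hm]
  -- The polar formula was stated with a factor 2 to avoid halves. On the other side the mass of the
  -- sphere is 2N times the volume of the ball, which cancels the normalization.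
  refine (ENNReal.mul_right_inj (two_ne_zero) (ENNReal.ofNat_ne_top)).1 ?_
  rw [mul_left_comm, lintegral_inner_pow_mul_radial u k (measurable_radialWeight N s),
    lintegral_radialWeight hs (by omega), sphereMoment_eq hu, Measure.toSphere_apply_univ,
    finrank_real_Cn, mul_assoc, mul_comm ((2 * N : ℕ) : ℝ≥0∞), mul_assoc, ← mul_assoc,
    ENNReal.inv_mul_cancel hV0 hVt, one_mul,
    ← ENNReal.ofReal_mul (inv_nonneg.2 (powCoeff_pos hNr k).le), Nat.cast_mul, mul_assoc,
    Nat.cast_ofNat, ← ENNReal.ofReal_natCast, ← ENNReal.ofReal_mul hNr.le]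
  congr 2
  have hs1 : 0 < s + 1 := by linarith
  have a1 := (Real.Gamma_pos_of_pos hs1).ne'
  have a2 := (Real.Gamma_pos_of_pos hNr).ne'
  have a3 := (Real.Gamma_pos_of_pos (show 0 < (N : ℝ) + k by positivity)).ne'
  have a4 := (Real.Gamma_pos_of_pos (show 0 < (N : ℝ) + s + 1 by linarith)).ne'
  have a5 := (Real.Gamma_pos_of_pos (show 0 < (N : ℝ) + k + s + 1 by
    have : (0 : ℝ) ≤ k := k.cast_nonneg
    linarith)).ne'
  have e : (N : ℝ) + s + 1 + k = N + k + s + 1 := by ring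
  rw [powCoeff, powCoeff, Real.Gamma_add_one hNr.ne', e, Nat.cast_add]
  field_simp

theorem isUnitaryInvariant_bergmanMeasure [NeZero N] {s : ℝ} (hs : -1 < s) {r : ℝ}
    (hr : r ∈ Ioo (0 : ℝ) 1) :
    IsUnitaryInvariant ((bergmanMeasure N s).restrict (ball 0 r)) r where
  finite := by
    refine ⟨?_⟩
    -- The moment of order k = 0 is the total mass.
    have h := lintegral_bergmanMeasure_inner_pow (N := N) hs
      (u := EuclideanSpace.single 0 1) (by simp) 0
    simp only [mul_zero, pow_zero, lintegral_one] at h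
    rw [Measure.restrict_apply_univ]
    refine (measure_mono (subset_univ _)).trans_lt ?_
    rw [h]
    exact ENNReal.ofReal_lt_top
  nonneg := hr.1.le
  lt_one := hr.2
  ae_norm_le := by
    filter_upwards [ae_restrict_mem measurableSet_ball] with w hw
    exact (mem_ball_zero_iff.1 hw).le
  map_eq U := by
    ext t ht
    have hU : Measurable U := U.continuous.measurable
    have hb : U ⁻¹' (ball 0 r) = ball 0 r := by
      ext x; simp
    rw [Measure.map_apply hU ht, Measure.restrict_apply (hU ht), Measure.restrict_apply ht]
    conv_lhs => rw [← hb, ← preimage_inter]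
    have hmeas : MeasurableSet (t ∩ ball 0 r) := ht.inter measurableSet_ball
    have hf : Measurable fun x : Cn N => (t ∩ ball 0 r).indicator (1 : Cn N → ℝ≥0∞) x *
        radialWeight N s (‖x‖ ^ 2) :=
      (measurable_one.indicator hmeas).mul
        ((measurable_radialWeight N s).comp (measurable_norm.pow_const 2))
    rw [← lintegral_indicator_one hmeas, ← lintegral_indicator_one (hU hmeas),
      lintegral_bergmanMeasure s (measurable_one.indicator (hU hmeas)),
      lintegral_bergmanMeasure s (measurable_one.indicator hmeas),
      ← (measurePreserving_unitary U).lintegral_comp hf]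
    congr 1
    refine lintegral_congr fun x => ?_
    simp only [U.norm_map]
    rfl

theorem ae_mem_unitBall_bergmanMeasure (N : ℕ) (s : ℝ) :
    ∀ᵐ w ∂bergmanMeasure N s, w ∈ unitBall N := by
  have h : ∀ᵐ w ∂nu N, w ∈ unitBall N :=
    Measure.ae_smul_measure (ae_restrict_mem measurableSet_ball) _
  exact (withDensity_absolutelyContinuous _ _).ae_le h

theorem hasInvariantMeasures_bergmanNorm (N : ℕ) [NeZero N] {s : ℝ} (hs : -1 < s) :
    HasInvariantMeasures (bergmanNorm N s hs) (N + s + 1)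
      fun r => (bergmanMeasure N s).restrict (ball 0 r) := by
  have hNr : (0 : ℝ) ≤ N := N.cast_nonneg
  have hβ : 0 < (N : ℝ) + s + 1 := by linarith
  have hfull := fun {u : Cn N} (hu : ‖u‖ = 1) (k : ℕ) =>
    integral_norm_pow_eq_of_lintegral (μ := bergmanMeasure N s) (g := fun w => inner ℂ u w)
      (Continuous.measurable (by fun_prop)) (inv_nonneg.2 (powCoeff_pos hβ k).le)
      (lintegral_bergmanMeasure_inner_pow hs hu k)
  have hnorm : ∀ f : Cn N → ℂ, (bergmanNorm N s hs).toFun f ^ 2 =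
      ∫⁻ w, ‖f w‖ₑ ^ 2 ∂bergmanMeasure N s := fun f => eLpNorm_two_sq f _
  refine ⟨hβ, fun r hr => isUnitaryInvariant_bergmanMeasure hs hr, fun r _ f _ => ?_,
    fun f _ C hC => ?_, fun u hu k r _ => ?_, fun u hu k => ?_⟩
  · rw [hnorm]
    exact lintegral_mono' Measure.restrict_le_self le_rfl
  · refine (ENNReal.pow_right_strictMono two_ne_zero).le_iff_le.1 ?_
    rw [hnorm, ← Measure.restrict_eq_self_of_ae_mem (ae_mem_unitBall_bergmanMeasure N s)]
    -- The shift by 2 keeps the radius positive already at n = 0; these balls exhaust the unit ball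
    -- and monotone convergence applies.
    have hr : ∀ n : ℕ, 1 - 1 / ((n : ℝ) + 2) ∈ Ioo (0 : ℝ) 1 := fun n => by
      have h2 : (1 : ℝ) < n + 2 := by linarith [(Nat.cast_nonneg n : (0 : ℝ) ≤ n)]
      have h3 : 1 / ((n : ℝ) + 2) < 1 := by rw [div_lt_one (by linarith)]; exact h2
      have h4 : 0 < 1 / ((n : ℝ) + 2) := by positivity
      exact ⟨by linarith, by linarith⟩
    have hmono : Monotone fun n : ℕ => ball (0 : Cn N) (1 - 1 / ((n : ℝ) + 2)) := by
      intro m n hmn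
      refine ball_subset_ball ?_
      have : (m : ℝ) ≤ n := by exact_mod_cast hmn
      gcongr
    have hU : unitBall N = ⋃ n : ℕ, ball (0 : Cn N) (1 - 1 / ((n : ℝ) + 2)) := by
      ext w
      rw [mem_iUnion, mem_ball_zero_iff]
      constructor
      · intro hw
        obtain ⟨n, hn⟩ := exists_nat_one_div_lt (sub_pos.2 hw)
        refine ⟨n, mem_ball_zero_iff.2 ?_⟩
        have : 1 / ((n : ℝ) + 2) ≤ 1 / ((n : ℝ) + 1) := by gcongr; norm_num
        linarith
      · rintro ⟨n, hn⟩
        exact (mem_ball_zero_iff.1 hn).trans (hr n).2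
    rw [hU, setLIntegral_iUnion_of_directed _ hmono.directed_le]
    exact iSup_le fun n => hC _ (hr n)
  · rw [← (hfull hu k).2]
    exact integral_mono_measure Measure.restrict_le_self
      (Eventually.of_forall fun w => by positivity) (hfull hu k).1
  · rw [← (hfull hu k).2]
    simp only [← integral_indicator (measurableSet_ball (x := (0 : Cn N)))]
    -- The full moment dominates, and almost every w lies in the ball of radius r once r > |w|.
    refine tendsto_integral_filter_of_dominated_convergence
      (fun w => ‖(inner ℂ u w : ℂ)‖ ^ (2 * k)) ?_ ?_ (hfull hu k).1 ?_
    · exact Eventually.of_forall fun r =>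
        ((hfull hu k).1.aestronglyMeasurable).indicator measurableSet_ball
    · refine Eventually.of_forall fun r => Eventually.of_forall fun w => ?_
      refine (norm_indicator_le_norm_self _ _).trans ?_
      rw [Real.norm_of_nonneg (by positivity)]
    · filter_upwards [ae_mem_unitBall_bergmanMeasure N s] with w hw
      refine tendsto_const_nhds.congr' ?_
      filter_upwards [Ioo_mem_nhdsLT (mem_ball_zero_iff.1 hw)] with r hr
      rw [indicator_of_mem (mem_ball_zero_iff.2 hr.1)]

end BallCompOp

open BallCompOp

/-! ### The theorem for the Hardy and weighted Bergman spaces -/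

theorem theorem2p1 (N : ℕ) [NeZero N] (φ ψ : Cn N → Cn N)
    (hφ : IsAnalyticSelfMap φ) (hψ : IsAnalyticSelfMap ψ)
    (ζ : Cn N) (hζ : ζ ∈ sphere (0 : Cn N) 1)
    (hang : HasFiniteAngularDeriv φ ζ)
    (hne : ¬ (SameRadialLimit φ ψ ζ ∧ dCoeff ψ ζ = dCoeff φ ζ)) :
    (∀ (bφ : InducesBounded (hardyNorm N) φ) (bψ : InducesBounded (hardyNorm N) ψ),
      dCoeff φ ζ ^ (-(N : ℝ)) ≤ ENNReal.ofReal (essNorm (compOp bφ - compOp bψ) ^ 2)) ∧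
    (∀ (s : ℝ) (hs : -1 < s)
      (bφ : InducesBounded (bergmanNorm N s hs) φ) (bψ : InducesBounded (bergmanNorm N s hs) ψ),
      dCoeff φ ζ ^ (-((N : ℝ) + s + 1)) ≤
        ENNReal.ofReal (essNorm (compOp bφ - compOp bψ) ^ 2)) := by
  have hζ1 : ‖ζ‖ = 1 := mem_sphere_zero_iff_norm.1 hζ
  exact ⟨fun bφ bψ => (hasInvariantMeasures_hardyNorm N).hasPowerKernel.rpow_le_essNorm_sq
      hφ hψ bφ bψ hζ1 hne,
    fun s hs bφ bψ => (hasInvariantMeasures_bergmanNorm N hs).hasPowerKernel.rpow_le_essNorm_sq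
      hφ hψ bφ bψ hζ1 hne⟩
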